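/- Let $p:A\to M$ be a smooth (real, finite-rank) Lie algebroid over a smooth finite-dimensional manifold $M$ without boundary, with anchor $\#:A\to TM$, bracket $[\,,]$ and isotropy algebras $\mathcal G_x=\ker\#_x$, and let $\langle\,,\rangle$ be a Riemannian metric on $A$ (a smooth family of scalar products on the fibres). Let $\mathcal D$ be its Levi-Civita $A$-connection, given by $$2\langle\mathcal D_ab,c\rangle=\#(a).\langle b,c\rangle+\#(b).\langle a,c\rangle-\#(c).\langle a,b\rangle+\langle[c,a],b\rangle+\langle[c,b],a\rangle+\langle[a,b],c\rangle .$$ Let $X_E$ be the geodesic vector field on $A$: the vector field whose integral curves are the geodesics of $\mathcal D$, i.e. the paths $\alpha$ in $A$ with $\#(\alpha)=\frac{d}{dt}(p\circ\alpha)$ and $\mathcal D^\alpha\alpha=0$, where $\mathcal D^\alpha$ is the covariant derivative along $\alpha$. Let $L$ be a leaf of the characteristic foliation of $A$ and $p_L:A_L\to L$ the restriction of $A$ to $L$; $X_E$ is tangent to $A_L$ and its restriction to $A_L$ is again denoted $X_E$. For $x\in L$ and $a\in A_x$ write $a=a^v+a^h$ with $a^v\in\mathcal G_x$ and $a^h\in\mathcal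 G_x^\perp$, and let $\langle\,,\rangle_L$ be the Riemannian metric on $L$ for which $\#:\mathcal G_x^\perp\to T_xL$ is an isometry for every $x \in L$. The Sasaki metric on $A_L$ is $$g_L(Z,Z)=\langle dp_L(Z),dp_L(Z)\rangle_L+\langle K(Z),K(Z)\rangle,\qquad K(Z)=(\mathcal D^\alpha\beta)(0),$$ where $\beta$ is any path in $A_L$ with $\dot\beta(0)=Z$ and $\alpha$ is the path in $\mathcal G_L^\perp$ with $p_L\circ\alpha=p_L\circ\beta$ and $\#(\alpha)=\frac{d}{dt}(p_L\circ\beta)$. Finally let $$T_ab=(\mathcal D_{a^v}b^v)^h+(\mathcal D_{a^v}b^h)^v,\qquad N_x=\sum_iT_{b_i}b_i\quad(x\in L),$$ where $(b_i)$ is any orthonormal basis of $\mathcal G_x$. (1) For every $a\in A_L$, with $x=p_L(a)$, the divergence of $X_E$ with respect to $g_L$ is $$\operatorname{div}(X_E)(a)=\operatorname{Tr}(\operatorname{ad}_{a^v})+\langle a^h,N_x\rangle,\qquad \operatorname{ad}_{a^v}:\mathcal G_x\to\mathcal G_x,\ b\mapsto[a^v,b].$$ (2) The (local) flow of $X_E$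 on $A_L$ preserves the Riemannian volume of $g_L$ if and only if $N_x=0$ for all $x\in L$ and the Lie algebra $\mathcal G_x$ is unimodular (i.e. $\operatorname{Tr}(\operatorname{ad}_u)=0$ for all $u\in\mathcal G_x$) for some $x\in L$. -/

import Mathlib

open Bundle Set
open scoped Manifold ContDiff Topology

noncomputable section

/-! ## Divergence and volume preservation on a manifold with a metric -/

section Volume

variable {E H N : Type*} [NormedAddCommGroup E] [NormedSpace ℝ E] [FiniteDimensional ℝ E]
  [TopologicalSpace H] (J : ModelWithCorners ℝ E H) [TopologicalSpace N] [ChartedSpace H N]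

/-- The Gram determinant `det (g_x(v_i, v_j))`: the square of the `g`-volume of the parallelepiped
spanned by `v_1, …, v_k`. -/
def gramDet (g : ∀ x : N, TangentSpace J x → TangentSpace J x → ℝ) {k : ℕ} (x : N)
    (v : Fin k → TangentSpace J x) : ℝ :=
  Matrix.det (Matrix.of fun i j => g x (v i) (v j))

/-- The density `√|det g_ij|` of the Riemannian volume in the coordinates given by the preferred
chart at `a` (for a fixed basis of the model space). -/
def volDensity (g : ∀ x : N, TangentSpace J x → TangentSpace J x → ℝ) (a : N) (u : E) : ℝ :=
  √(gramDet J g ((extChartAt J a).symm u)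
    (fun i => mfderiv 𝓘(ℝ, E) J (extChartAt J a).symm u (Module.finBasis ℝ E i)))

/-- The coordinate expression of a vector field in the preferred chart at `a`. -/
def chartField (X : ∀ x : N, TangentSpace J x) (a : N) (u : E) : E :=
  mfderiv J 𝓘(ℝ, E) (extChartAt J a) ((extChartAt J a).symm u) (X ((extChartAt J a).symm u))

/-- The divergence `(1/√|g|) ∑ ∂_i (√|g| X^i)` of the vector field `X` with respect to the
Riemannian metric `g`, on a manifold without boundary. -/
def divergence (g : ∀ x : N, TangentSpace J x → TangentSpace J x → ℝ)
    (X : ∀ x : N, TangentSpace J x) (a : N) : ℝ :=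
  (volDensity J g a (extChartAt J a a))⁻¹ *
    LinearMap.trace ℝ E
      (fderiv ℝ (fun u => volDensity J g a u • chartField J X a u) (extChartAt J a a)).toLinearMap

/-- `Φ` is a (local) flow of `X` on `(t₀, t₁) × U`. -/
structure IsLocalFlow (X : ∀ x : N, TangentSpace J x) (U : Set N) (t₀ t₁ : ℝ)
    (Φ : ℝ → N → N) : Prop where
  isOpen : IsOpen U
  neg : t₀ < 0
  pos : 0 < t₁
  contMDiffOn : ContMDiffOn (𝓘(ℝ, ℝ).prod J) J 1 (fun p : ℝ × N => Φ p.1 p.2) (Ioo t₀ t₁ ×ˢ U)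
  init : ∀ x ∈ U, Φ 0 x = x
  integralCurve : ∀ x ∈ U, IsMIntegralCurveOn (I := J) (fun t => Φ t x) X (Ioo t₀ t₁)

/-- The flow of `X` preserves the Riemannian volume of `g`: wherever the flow `Φ_t` is defined, its
differential preserves the `g`-volume of all parallelepipeds in the tangent spaces, that is, the
pullback by `Φ_t` of the Riemannian volume density is the Riemannian volume density. -/
def FlowPreservesVolume (g : ∀ x : N, TangentSpace J x → TangentSpace J x → ℝ)
    (X : ∀ x : N, TangentSpace J x) : Prop :=
  ∀ (U : Set N) (t₀ t₁ : ℝ) (Φ : ℝ → N → N), IsLocalFlow J X U t₀ t₁ Φ →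
    ∀ t ∈ Ioo t₀ t₁, ∀ x ∈ U, ∀ v : Fin (Module.finrank ℝ E) → TangentSpace J x,
      gramDet J g (Φ t x) (fun i => mfderiv J J (Φ t) x (v i)) = gramDet J g x v

end Volume

/-! ## Tangent vectors of the total space of a vector bundle -/

section TotalSpace

variable (EB F : Type*) {B : Type*} [NormedAddCommGroup EB] [NormedSpace ℝ EB]
  [NormedAddCommGroup F] [NormedSpace ℝ F] [TopologicalSpace B] [ChartedSpace EB B]
  {V : B → Type*} [TopologicalSpace (TotalSpace F V)]
  [∀ x, AddCommMonoid (V x)] [∀ x, Module ℝ (V x)] [∀ x, TopologicalSpace (V x)]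
  [FiberBundle F V] [VectorBundle ℝ F V]

/-- The vertical lift at `a` of an element `w` of the fibre through `a`: the velocity at `t = 0` of
`t ↦ a + t w`. It identifies the fibre with the kernel of the differential of the projection. -/
def vlift (a : TotalSpace F V) (w : V a.proj) :
    TangentSpace (𝓘(ℝ, EB).prod 𝓘(ℝ, F)) a :=
  mfderiv 𝓘(ℝ, ℝ) (𝓘(ℝ, EB).prod 𝓘(ℝ, F))
    (fun t : ℝ => (⟨a.proj, a.2 + t • w⟩ : TotalSpace F V)) 0 (1 : ℝ)

/-- The differential `ds(u)` of a section `s` through `a`, as a tangent vector at `a`. -/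
def dsection (a : TotalSpace F V) (s : ∀ x, V x) (u : TangentSpace 𝓘(ℝ, EB) a.proj) :
    TangentSpace (𝓘(ℝ, EB).prod 𝓘(ℝ, F)) a :=
  mfderiv 𝓘(ℝ, EB) (𝓘(ℝ, EB).prod 𝓘(ℝ, F)) (fun x => (⟨x, s x⟩ : TotalSpace F V)) a.proj u

end TotalSpace

/-! ## Sections of vector bundles -/

section Sections

variable {EM F M : Type*} [NormedAddCommGroup EM] [NormedSpace ℝ EM]
  [NormedAddCommGroup F] [NormedSpace ℝ F] [TopologicalSpace M] [ChartedSpace EM M]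
  {A : M → Type*} [TopologicalSpace (TotalSpace F A)]
  [∀ x, AddCommGroup (A x)] [∀ x, Module ℝ (A x)] [∀ x, TopologicalSpace (A x)]
  [FiberBundle F A] [VectorBundle ℝ F A]

/-- The derivative of a real function at `x` in the direction of a tangent vector. -/
def dirDeriv (f : M → ℝ) (x : M) (u : TangentSpace 𝓘(ℝ, EM) x) : ℝ :=
  mfderiv 𝓘(ℝ, EM) 𝓘(ℝ, ℝ) f x u

/-- The product of a smooth function and a smooth section. -/
def smulSection (f : C^∞⟮𝓘(ℝ, EM), M; ℝ⟯) (b : Cₛ^∞⟮𝓘(ℝ, EM); F, A⟯) :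
    Cₛ^∞⟮𝓘(ℝ, EM); F, A⟯ :=
  ⟨fun x => f x • b x, f.contMDiff.smul_section b.contMDiff⟩

/-- Elements of a fibre extend linearly to global smooth sections. -/
theorem exists_linear_extension [FiniteDimensional ℝ EM] [T2Space M] [IsManifold 𝓘(ℝ, EM) ∞ M]
    [ContMDiffVectorBundle ∞ F A 𝓘(ℝ, EM)] (x : M) :
    ∃ T : A x →ₗ[ℝ] Cₛ^∞⟮𝓘(ℝ, EM); F, A⟯, ∀ v, T v x = v := by
  set t := trivializationAt F A x
  have hx : x ∈ t.baseSet := FiberBundle.mem_baseSet_trivializationAt' x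
  obtain ⟨ψ, -, hψ⟩ := (SmoothBumpFunction.nhds_basis_tsupport (I := 𝓘(ℝ, EM)) x).mem_iff.1
    (t.open_baseSet.mem_nhds hx)
  have hs : ∀ w : F, ContMDiff 𝓘(ℝ, EM) (𝓘(ℝ, EM).prod 𝓘(ℝ, F)) ∞
      (fun y => TotalSpace.mk' F y (ψ y • t.symmL ℝ y w)) := by
    intro w
    refine ContMDiffOn.smul_section_of_tsupport (u := t.baseSet)
      (s := fun y => t.symmL ℝ y w) ψ.contMDiff.contMDiffOn t.open_baseSet hψ ?_
    intro y hy
    rw [t.contMDiffWithinAt_section _ hy]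
    refine (contMDiffOn_const (c := w) y hy).congr (fun z hz => ?_) ?_
    · simp [Trivialization.symmL_apply, Trivialization.apply_mk_symm, hz]
    · simp [Trivialization.symmL_apply, Trivialization.apply_mk_symm, hy]
  refine ⟨⟨⟨fun v => ⟨fun y => ψ y • t.symmL ℝ y (t.continuousLinearMapAt ℝ x v), hs _⟩, ?_⟩, ?_⟩,
    ?_⟩
  · intro v w
    ext y
    simp
  · intro c v
    ext y
    simp [smul_comm c]
  · intro v
    change ψ x • t.symmL ℝ x (t.continuousLinearMapAt ℝ x v) = v
    rw [ψ.eq_one, one_smul, t.symmL_continuousLinearMapAt hx]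

variable (EM F) in
/-- A (linear) choice of global smooth sections through the elements of the fibre over `x`. All
notions below that use it do not depend on the choice. -/
def sectionThrough [FiniteDimensional ℝ EM] [T2Space M] [IsManifold 𝓘(ℝ, EM) ∞ M]
    [ContMDiffVectorBundle ∞ F A 𝓘(ℝ, EM)] (x : M) : A x →ₗ[ℝ] Cₛ^∞⟮𝓘(ℝ, EM); F, A⟯ :=
  (exists_linear_extension x).choose

theorem sectionThrough_apply_self [FiniteDimensional ℝ EM] [T2Space M] [IsManifold 𝓘(ℝ, EM) ∞ M]
    [ContMDiffVectorBundle ∞ F A 𝓘(ℝ, EM)] (x : M) (v : A x) : sectionThrough EM F x v x = v :=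
  (exists_linear_extension x).choose_spec v

end Sections

/-! ## Lie algebroids -/

/-- A Lie algebroid structure on the smooth vector bundle `A` over `M`: a smooth bundle map
`anchor : A → TM` and a Lie bracket on the space of smooth sections of `A` satisfying the Leibniz
identity, such that the anchor maps it to the Lie bracket of vector fields. -/
structure LieAlgebroid (EM F : Type*) [NormedAddCommGroup EM] [NormedSpace ℝ EM]
    [NormedAddCommGroup F] [NormedSpace ℝ F] {M : Type*} [TopologicalSpace M] [ChartedSpace EM M]
    [IsManifold 𝓘(ℝ, EM) ∞ M]
    (A : M → Type*) [TopologicalSpace (TotalSpace F A)]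
    [∀ x, AddCommGroup (A x)] [∀ x, Module ℝ (A x)] [∀ x, TopologicalSpace (A x)]
    [FiberBundle F A] [VectorBundle ℝ F A] where
  /-- the anchor map -/
  anchor : ∀ x : M, A x →L[ℝ] TangentSpace 𝓘(ℝ, EM) x
  contMDiff_anchor : ContMDiff (𝓘(ℝ, EM).prod 𝓘(ℝ, F)) 𝓘(ℝ, EM).tangent ∞
    (fun a : TotalSpace F A => (⟨a.proj, anchor a.proj a.2⟩ : TangentBundle 𝓘(ℝ, EM) M))
  /-- the bracket of sections -/
  bracket : Cₛ^∞⟮𝓘(ℝ, EM); F, A⟯ →ₗ[ℝ] Cₛ^∞⟮𝓘(ℝ, EM); F, A⟯ →ₗ[ℝ] Cₛ^∞⟮𝓘(ℝ, EM); F, A⟯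
  bracket_self : ∀ a, bracket a a = 0
  jacobi : ∀ a b c,
    bracket a (bracket b c) + bracket b (bracket c a) + bracket c (bracket a b) = 0
  leibniz : ∀ (a b : Cₛ^∞⟮𝓘(ℝ, EM); F, A⟯) (f : C^∞⟮𝓘(ℝ, EM), M; ℝ⟯) (x : M),
    bracket a (smulSection f b) x =
      f x • bracket a b x + dirDeriv (EM := EM) f x (anchor x (a x)) • b x
  anchor_bracket : ∀ (a b : Cₛ^∞⟮𝓘(ℝ, EM); F, A⟯) (x : M),
    anchor x (bracket a b x) =
      VectorField.mlieBracket 𝓘(ℝ, EM) (fun y => anchor y (a y)) (fun y => anchor y (b y)) x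

namespace LieAlgebroid

section Basic

variable {EM F : Type*} [NormedAddCommGroup EM] [NormedSpace ℝ EM]
  [NormedAddCommGroup F] [NormedSpace ℝ F] {M : Type*} [TopologicalSpace M] [ChartedSpace EM M]
  [IsManifold 𝓘(ℝ, EM) ∞ M]
  {A : M → Type*} [TopologicalSpace (TotalSpace F A)]
  [∀ x, AddCommGroup (A x)] [∀ x, Module ℝ (A x)] [∀ x, TopologicalSpace (A x)]
  [FiberBundle F A] [VectorBundle ℝ F A] (𝒜 : LieAlgebroid EM F A)

/-- The isotropy `𝒢_x = Ker #_x`. -/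
def isotropy (x : M) : Submodule ℝ (A x) := LinearMap.ker (𝒜.anchor x).toLinearMap

/-- The bracket of two sections with values in the isotropy at `x` has value in the isotropy. -/
theorem bracket_mem_isotropy (x : M) (a b : Cₛ^∞⟮𝓘(ℝ, EM); F, A⟯)
    (ha : a x ∈ 𝒜.isotropy x) (hb : b x ∈ 𝒜.isotropy x) :
    𝒜.bracket a b x ∈ 𝒜.isotropy x := by
  have ha' : 𝒜.anchor x (a x) = 0 := ha
  have hb' : 𝒜.anchor x (b x) = 0 := hb
  change 𝒜.anchor x (𝒜.bracket a b x) = 0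
  rw [𝒜.anchor_bracket, ← VectorField.mlieBracketWithin_univ]
  exact VectorField.mlieBracketWithin_eq_zero_of_eq_zero ha' hb'

/-- An `A`-path (parametrized by `ℝ`): a smooth path in `A` whose anchor is the velocity of its
base path. -/
structure IsAPath (α : ℝ → TotalSpace F A) : Prop where
  contMDiff : ContMDiff 𝓘(ℝ, ℝ) (𝓘(ℝ, EM).prod 𝓘(ℝ, F)) ∞ α
  velocity : ∀ t, HasMFDerivAt 𝓘(ℝ, ℝ) 𝓘(ℝ, EM) (fun s => (α s).proj) t
    ((1 : ℝ →L[ℝ] ℝ).smulRight (𝒜.anchor (α t).proj (α t).2))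

/-- `ι : L → M` is (the inclusion of) a leaf of the characteristic foliation: an injectively
immersed connected manifold, whose tangent spaces are the images of the anchor, and which is
maximal in the sense that no `A`-path leaves it. -/
structure IsLeaf {EL L : Type*} [NormedAddCommGroup EL] [NormedSpace ℝ EL] [TopologicalSpace L]
    [ChartedSpace EL L] (ι : C^∞⟮𝓘(ℝ, EL), L; 𝓘(ℝ, EM), M⟯) : Prop where
  connected : ConnectedSpace L
  injective : Function.Injective ι
  immersion : ∀ y, Function.Injective (mfderiv 𝓘(ℝ, EL) 𝓘(ℝ, EM) ι y)
  tangent : ∀ y, range (mfderiv 𝓘(ℝ, EL) 𝓘(ℝ, EM) ι y) = range (𝒜.anchor (ι y))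
  maximal : ∀ α, 𝒜.IsAPath α → (α 0).proj ∈ range ι → ∀ t, (α t).proj ∈ range ι

variable [FiniteDimensional ℝ EM] [T2Space M] [ContMDiffVectorBundle ∞ F A 𝓘(ℝ, EM)]

/-- The Lie bracket of the isotropy algebra `𝒢_x`, induced by the bracket of sections:
`[u, v]_x = [a, b](x)` for sections `a`, `b` through `u`, `v`. Thus `𝒜.isotropyBracket x u` is
`ad_u : 𝒢_x → 𝒢_x`. -/
def isotropyBracket (x : M) :
    𝒜.isotropy x →ₗ[ℝ] 𝒜.isotropy x →ₗ[ℝ] 𝒜.isotropy x :=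
  LinearMap.mk₂ ℝ
    (fun u v => ⟨𝒜.bracket (sectionThrough EM F x u) (sectionThrough EM F x v) x,
      𝒜.bracket_mem_isotropy x _ _ (by rw [sectionThrough_apply_self]; exact u.2)
        (by rw [sectionThrough_apply_self]; exact v.2)⟩)
    (fun u u' v => by ext; simp) (fun c u v => by ext; simp)
    (fun u v v' => by ext; simp) (fun c u v => by ext; simp)

/-- The isotropy algebra `𝒢_x` is unimodular: `Tr ad_u = 0` for all `u`. -/
def IsUnimodularAt (x : M) : Prop :=
  ∀ u : 𝒜.isotropy x, LinearMap.trace ℝ (𝒜.isotropy x) (𝒜.isotropyBracket x u) = 0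

end Basic

/-! ## Riemannian Lie algebroids -/

section Riemannian

variable {EM F : Type*} [NormedAddCommGroup EM] [NormedSpace ℝ EM]
  [NormedAddCommGroup F] [NormedSpace ℝ F] {M : Type*} [TopologicalSpace M] [ChartedSpace EM M]
  [IsManifold 𝓘(ℝ, EM) ∞ M]
  {A : M → Type*} [TopologicalSpace (TotalSpace F A)]
  [∀ x, NormedAddCommGroup (A x)] [∀ x, InnerProductSpace ℝ (A x)]
  [FiberBundle F A] [VectorBundle ℝ F A] (𝒜 : LieAlgebroid EM F A)

/-- `#(v).f`: the derivative at `x` of a function in the direction of the anchor of `v`. -/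
def anchorDeriv {x : M} (v : A x) (f : M → ℝ) : ℝ :=
  dirDeriv (EM := EM) f x (𝒜.anchor x v)

/-- The right hand side of the Koszul formula. -/
def koszul (a b c : Cₛ^∞⟮𝓘(ℝ, EM); F, A⟯) (x : M) : ℝ :=
  𝒜.anchorDeriv (a x) (fun y => inner ℝ (b y) (c y))
    + 𝒜.anchorDeriv (b x) (fun y => inner ℝ (a y) (c y))
    - 𝒜.anchorDeriv (c x) (fun y => inner ℝ (a y) (b y))
    + inner ℝ (𝒜.bracket c a x) (b x)
    + inner ℝ (𝒜.bracket c b x) (a x)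
    + inner ℝ (𝒜.bracket a b x) (c x)

variable [FiniteDimensional ℝ EM] [T2Space M] [ContMDiffVectorBundle ∞ F A 𝓘(ℝ, EM)]
  [∀ x, FiniteDimensional ℝ (A x)]

/-- The Levi-Civita `A`-connection: `𝒜.leviCivita a b x` is the vector `(𝒟_a b)(x)` of `A_x`
determined by the Koszul formula `2⟨𝒟_a b, c⟩ = koszul a b c`, expanded in an orthonormal basis of
`A_x`. -/
def leviCivita (a b : Cₛ^∞⟮𝓘(ℝ, EM); F, A⟯) (x : M) : A x :=
  ∑ i, ((1 / 2 : ℝ) * 𝒜.koszul a b (sectionThrough EM F x (stdOrthonormalBasis ℝ (A x) i)) x) •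
    stdOrthonormalBasis ℝ (A x) i

/-- The vertical component `v^v`: the orthogonal projection of `v` to the isotropy. -/
def vert {x : M} (v : A x) : 𝒜.isotropy x := (𝒜.isotropy x).orthogonalProjectionOnto v

/-- The horizontal component `v^h` of `v`, orthogonal to the isotropy. -/
def hor {x : M} (v : A x) : A x := v - 𝒜.vert v

/-- The O'Neill tensor `T_u w = (𝒟_{u^v} w^v)^h + (𝒟_{u^v} w^h)^v` at `x`. Since `u^v` lies in the
kernel of the anchor, only the values at `x` of the sections matter. -/
def oneillT (x : M) (u w : A x) : A x :=
  𝒜.hor (𝒜.leviCivita (sectionThrough EM F x (𝒜.vert u)) (sectionThrough EM F x (𝒜.vert w)) x) +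
    𝒜.vert (𝒜.leviCivita (sectionThrough EM F x (𝒜.vert u)) (sectionThrough EM F x (𝒜.hor w)) x)

/-- `N = ∑ T_{b_i} b_i` over an orthonormal basis of the isotropy at `x`. -/
def oneillN (x : M) {k : ℕ} (b : OrthonormalBasis (Fin k) ℝ (𝒜.isotropy x)) : A x :=
  ∑ i, 𝒜.oneillT x (b i) (b i)

/-- The geodesic vector field `X_E` on `A`, whose integral curves are the geodesics: the `A`-paths
`α` with `𝒟^α α = 0`. If `s` is a section through `a`, an `A`-path `α` with `α(0) = a` has
`(𝒟^α α)(0) = (𝒟_s s)(x) + (vertical vector α'(0) - ds(# a))`. -/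
def geodesicField (a : TotalSpace F A) : TangentSpace (𝓘(ℝ, EM).prod 𝓘(ℝ, F)) a :=
  dsection EM F a (sectionThrough EM F a.proj a.2) (𝒜.anchor a.proj a.2)
    - vlift EM F a (𝒜.leviCivita (sectionThrough EM F a.proj a.2) (sectionThrough EM F a.proj a.2) a.proj)

/-! ### Restriction to a leaf -/

variable {EL L : Type*} [NormedAddCommGroup EL] [NormedSpace ℝ EL] [TopologicalSpace L]
  [ChartedSpace EL L] (ι : C^∞⟮𝓘(ℝ, EL), L; 𝓘(ℝ, EM), M⟯)

/-- The fibre component in `A` of an element of `A_L = ι^* A`. -/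
def fib {ι : C^∞⟮𝓘(ℝ, EL), L; 𝓘(ℝ, EM), M⟯} (a : TotalSpace F (ι *ᵖ A)) : A (ι a.proj) := a.2

/-- The geodesic vector field on `A_L`: the restriction of `X_E`, which is tangent to `A_L`; that
is, the vector field mapped to `X_E` by the differential of the immersion `A_L → A`. -/
def leafGeodesicField (a : TotalSpace F (ι *ᵖ A)) :
    TangentSpace (𝓘(ℝ, EL).prod 𝓘(ℝ, F)) a :=
  Function.invFun
    (mfderiv (𝓘(ℝ, EL).prod 𝓘(ℝ, F)) (𝓘(ℝ, EM).prod 𝓘(ℝ, F))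
      (Pullback.lift ι : TotalSpace F (ι *ᵖ A) → TotalSpace F A) a)
    (𝒜.geodesicField (Pullback.lift ι a))

/-- The horizontal lift of `u ∈ T_y L`: the element of `𝒢_y^⊥` with anchor `u`. -/
def horLift (y : L) (u : TangentSpace 𝓘(ℝ, EL) y) : A (ι y) :=
  (Function.invFun (fun w : (𝒜.isotropy (ι y))ᗮ => 𝒜.anchor (ι y) w)
    (mfderiv 𝓘(ℝ, EL) 𝓘(ℝ, EM) ι y u) : (𝒜.isotropy (ι y))ᗮ)

/-- The induced Riemannian metric `⟨u, w⟩_L` on the leaf. -/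
def leafMetric (y : L) (u w : TangentSpace 𝓘(ℝ, EL) y) : ℝ :=
  inner ℝ (𝒜.horLift ι y u) (𝒜.horLift ι y w)

/-- The differential at `a` of the projection `p : A_L → L`. -/
def dproj (a : TotalSpace F (ι *ᵖ A)) (Z : TangentSpace (𝓘(ℝ, EL).prod 𝓘(ℝ, F)) a) :
    TangentSpace 𝓘(ℝ, EL) a.proj :=
  mfderiv (𝓘(ℝ, EL).prod 𝓘(ℝ, F)) 𝓘(ℝ, EL)
    (TotalSpace.proj : TotalSpace F (ι *ᵖ A) → L) a Z

/-- The element of the fibre through `a` whose vertical lift is the vertical tangent vector `Z`. -/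
def unlift {ι : C^∞⟮𝓘(ℝ, EL), L; 𝓘(ℝ, EM), M⟯} (a : TotalSpace F (ι *ᵖ A))
    (Z : TangentSpace (𝓘(ℝ, EL).prod 𝓘(ℝ, F)) a) : A (ι a.proj) :=
  Function.invFun (vlift EL F a) Z

/-- The connection map `K : T A_L → A_L`, `K(Z) = (𝒟^α β)(0)`, where `β` is a path with
`β'(0) = Z` and `α` is the horizontal `A`-path over `p ∘ β`. If `s` is a section through `a` then
`K(Z)` is the sum of `𝒟_{α(0)} s` and of the vertical vector `Z - ds(dp(Z))`. -/
def connector (a : TotalSpace F (ι *ᵖ A)) (Z : TangentSpace (𝓘(ℝ, EL).prod 𝓘(ℝ, F)) a) :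
    A (ι a.proj) :=
  𝒜.leviCivita (sectionThrough EM F (ι a.proj) (𝒜.horLift ι a.proj (dproj ι a Z)))
      (sectionThrough EM F (ι a.proj) (fib a)) (ι a.proj) +
    unlift a (Z - dsection EL F a (fun y => sectionThrough EM F (ι a.proj) (fib a) (ι y))
      (dproj ι a Z))

/-- The Sasaki metric on `A_L`: `g_L(Z, W) = ⟨dp(Z), dp(W)⟩_L + ⟨K(Z), K(W)⟩`. -/
def sasaki (a : TotalSpace F (ι *ᵖ A)) (Z W : TangentSpace (𝓘(ℝ, EL).prod 𝓘(ℝ, F)) a) : ℝ :=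
  𝒜.leafMetric ι a.proj (dproj ι a Z) (dproj ι a W) +
    inner ℝ (𝒜.connector ι a Z) (𝒜.connector ι a W)

end Riemannian

end LieAlgebroid

end

/-!
Both assertions are about the manifold `A_L`, the total space of the pulled back bundle `ι *ᵖ A`,
and are proved in the charts of the bundle. Near a point of the leaf, the restriction of `A` is
given by a metric `G`, a surjective anchor `ρ`, structure functions `c`, Christoffel symbols `Γ`
and the horizontal lift `h`, the right inverse of `ρ` orthogonal to its kernel (`AlgebroidChart`,
`LieAlgebroid.exists_isLeafChart`). In the coordinates `(q, ξ)` the geodesic field is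
`(ρ ξ, -Γ(ξ, ξ))`, and the Sasaki metric is the product metric `G(h u, h u') + G(w, w')` pulled back by the
shear `(u, w) ↦ (u, w + Γ(h u, ξ))` (`LieAlgebroid.IsLeafChart.leafGeodesicField_leafPoint`,
`LieAlgebroid.IsLeafChart.sasaki_leafPoint`).

**Divergence.** The divergence of a field `X` is `Tr ∂X + ∂_X log √det` (`divergence_eq`). A shear
preserves volume, so the determinant is that of the product metric. Since `Γ` is metric and
torsion-free, the contributions of the horizontal directions cancel, and what remains is minus the
trace of `w ↦ Γ(w - h ρ w, ξ)`, that is, `-∑ ⟨𝒟_{bᵢ} a, bᵢ⟩` for an orthonormal basis of the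
isotropy algebra (`AlgebroidChart.trace_geodesicField_add`). For the vertical part of `a`,
torsion-freeness and metricity turn this into `Tr ad_{a^v}`; for the horizontal part, metricity
turns it into `∑ ⟨a^h, 𝒟_{bᵢ} bᵢ⟩ = ⟨a^h, N⟩` (`LieAlgebroid.IsLeafChart.neg_trace_eq`).

**Volume.** By Liouville's theorem the flow preserves the volume if and only if the divergence
vanishes (`flowPreservesVolume_iff`; the local flows of class `C¹` come from
`exists_contDiffOn_flow`). As `N` is horizontal, the divergence at `a = N` is `‖N‖²`, and at a
vertical `a` it is `Tr ad_a`; so it vanishes identically exactly if `N = 0` and all isotropy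
algebras of the leaf are unimodular. One of them suffices: the form `w ↦ Tr ad_w` on the isotropy
is the restriction of the modular form of `A_L`, which is closed
(`AlgebroidChart.hasFDerivAt_modularForm`); hence it is parallel along the leaf, so by Grönwall's
inequality its vanishing is an open and closed condition on the connected leaf
(`LieAlgebroid.isUnimodularAt_of_isLeaf`).
-/

noncomputable section

set_option maxSynthPendingDepth 3
set_option synthInstance.maxHeartbeats 200000
set_option linter.unusedSectionVars false

/-! ### Determinants and traces -/

section LinearAlgebra

/-- Jacobi's formula for the derivative of a determinant. -/
theorem hasFDerivAt_det {X : Type*} [NormedAddCommGroup X] [NormedSpace ℝ X] {n : Type*} [Fintype n]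
    [DecidableEq n] {P : X → Matrix n n ℝ} {P' : n → n → X →L[ℝ] ℝ} {x : X}
    (h : ∀ i j, HasFDerivAt (fun y => P y i j) (P' i j) x) :
    HasFDerivAt (fun y => (P y).det) (∑ i, ∑ j, (P x).adjugate i j • P' j i) x := by
  have h1 : HasFDerivAt (fun y => (P y).det)
      (∑ σ : Equiv.Perm n, (Equiv.Perm.sign σ : ℝ) •
        ∑ i, (∏ j ∈ Finset.univ.erase i, P x (σ j) j) • P' (σ i) i) x := by
    simp only [Matrix.det_apply']
    refine HasFDerivAt.fun_sum fun σ _ => ?_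
    exact (HasFDerivAt.finsetProd fun i _ => h (σ i) i).const_mul _
  convert! h1 using 1
  ext v
  have h2 : ∀ i, ∑ j, (P x).adjugate i j * P' j i v =
      ((P x).updateCol i (fun j => P' j i v)).det := by
    intro i
    rw [← Matrix.cramer_apply, Matrix.cramer_eq_adjugate_mulVec]
    rfl
  simp only [sum_apply, smul_apply, smul_eq_mul, h2]
  simp only [Matrix.det_apply', Finset.mul_sum]
  rw [Finset.sum_comm]
  refine Finset.sum_congr rfl fun σ _ => Finset.sum_congr rfl fun i _ => ?_
  congr 1
  rw [← Finset.mul_prod_erase _ _ (Finset.mem_univ i), Matrix.updateCol_self, mul_comm]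
  congr 1
  refine Finset.prod_congr rfl fun j hj => ?_
  rw [Matrix.updateCol_ne (Finset.ne_of_mem_erase hj)]

theorem hasDerivAt_det {n : Type*} [Fintype n]
    [DecidableEq n] {P : ℝ → Matrix n n ℝ} {P' : Matrix n n ℝ} {t : ℝ}
    (h : ∀ i j, HasDerivAt (fun s => P s i j) (P' i j) t) :
    HasDerivAt (fun s => (P s).det) ((P t).adjugate * P').trace t := by
  have := (hasFDerivAt_det (fun i j => (h i j).hasFDerivAt)).hasDerivAt
  convert! this using 1
  simp [Matrix.trace, Matrix.mul_apply]

variable {E : Type*} [NormedAddCommGroup E] [NormedSpace ℝ E] [FiniteDimensional ℝ E]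

/-- The Gram matrix of a bilinear form in a basis of the space. -/
def gramMatrix {n : Type*} [Fintype n] (e : Module.Basis n ℝ E) (B : E →L[ℝ] E →L[ℝ] ℝ) :
    Matrix n n ℝ :=
  Matrix.of fun i j => B (e i) (e j)

variable {n : Type*} [Fintype n] [DecidableEq n] (e : Module.Basis n ℝ E)

theorem bilin_eq_sum_repr (B : E →L[ℝ] E →L[ℝ] ℝ) (v w : E) :
    B v w = ∑ k, ∑ l, e.repr v k * e.repr w l * B (e k) (e l) := by
  conv_lhs => rw [← e.sum_repr v, ← e.sum_repr w]
  simp only [map_sum, map_smul, sum_apply, smul_apply,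
    smul_eq_mul, Finset.mul_sum]
  rw [Finset.sum_comm]
  exact Finset.sum_congr rfl fun _ _ => Finset.sum_congr rfl fun _ _ => by ring

/-- The Gram determinant of an arbitrary family is that of the basis times the square of the
determinant of the coordinates of the family. -/
theorem det_gram_family (B : E →L[ℝ] E →L[ℝ] ℝ) (v : n → E) :
    (Matrix.of fun i j => B (v i) (v j)).det =
      (Matrix.of fun i j => e.repr (v j) i).det ^ 2 * (gramMatrix e B).det := by
  have : (Matrix.of fun i j => B (v i) (v j)) =
      (Matrix.of fun i j => e.repr (v j) i).transpose * gramMatrix e B *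
        (Matrix.of fun i j => e.repr (v j) i) := by
    ext i j
    simp only [Matrix.of_apply, Matrix.mul_apply, Matrix.transpose_apply, gramMatrix]
    rw [bilin_eq_sum_repr e, Finset.sum_comm]
    simp only [Finset.sum_mul]
    exact Finset.sum_congr rfl fun _ _ => Finset.sum_congr rfl fun _ _ => by ring
  rw [this, Matrix.det_mul, Matrix.det_mul, Matrix.det_transpose]
  ring

theorem det_gram_comp (B : E →L[ℝ] E →L[ℝ] ℝ) (f : E →ₗ[ℝ] E) :
    (Matrix.of fun i j => B (f (e i)) (f (e j))).det =
      LinearMap.det f ^ 2 * (gramMatrix e B).det := by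
  rw [det_gram_family e, ← LinearMap.det_toMatrix e]
  congr 3
  ext i j
  simp [LinearMap.toMatrix_apply]

theorem det_gramMatrix_pos {B : E →L[ℝ] E →L[ℝ] ℝ} (hs : ∀ v w, B v w = B w v)
    (hp : ∀ v, v ≠ 0 → 0 < B v v) : 0 < (gramMatrix e B).det := by
  refine Matrix.PosDef.det_pos (Matrix.PosDef.of_dotProduct_mulVec_pos ?_ ?_)
  · ext i j
    simp [gramMatrix, hs]
  · intro x hx
    have hv : ∑ i, x i • e i ≠ 0 := fun h0 => hx (by
      ext i
      have := congrArg (fun v => e.repr v i) h0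
      simpa [Finsupp.single_apply] using this)
    have h := hp _ hv
    rw [bilin_eq_sum_repr e] at h
    have hr : ∀ k, e.repr (∑ i, x i • e i) k = x k := fun k => by
      simp [Finsupp.single_apply]
    simp only [hr] at h
    refine lt_of_lt_of_eq h (Finset.sum_congr rfl fun k _ => ?_)
    simp only [Matrix.mulVec, dotProduct, gramMatrix, Matrix.of_apply, Finset.mul_sum, star_trivial,
      Pi.star_apply]
    exact Finset.sum_congr rfl fun _ _ => by ring

/-- The logarithmic derivative of a Gram determinant: if the derivative of the bilinear form is
`S`-symmetrized, that of the determinant is `2 Tr S` times the determinant. -/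
theorem hasFDerivAt_det_gramMatrix {X : Type*} [NormedAddCommGroup X] [NormedSpace ℝ X]
    {B : X → E →L[ℝ] E →L[ℝ] ℝ} {B' : X →L[ℝ] E →L[ℝ] E →L[ℝ] ℝ} {x : X}
    (hB : HasFDerivAt B B' x) :
    ∃ D : X →L[ℝ] ℝ, HasFDerivAt (fun y => (gramMatrix e (B y)).det) D x ∧
      ∀ (v : X) (S : E →ₗ[ℝ] E), (∀ z w, B' v z w = B x (S z) w + B x z (S w)) →
        D v = 2 * LinearMap.trace ℝ E S * (gramMatrix e (B x)).det := by
  refine ⟨_, hasFDerivAt_det (P' := fun i j =>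
    (ContinuousLinearMap.apply ℝ ℝ (e j)) ∘L (ContinuousLinearMap.apply ℝ _ (e i)) ∘L B') ?_, ?_⟩
  · intro i j
    exact (((hB.clm_apply (hasFDerivAt_const (e i) x)).clm_apply
      (hasFDerivAt_const (e j) x)).congr_fderiv (by ext; simp))
  · intro v S hS
    set P := gramMatrix e (B x) with hP
    set s := LinearMap.toMatrix e e S with hs
    have hcol : ∀ j, S (e j) = ∑ k, s k j • e k := by
      intro j
      conv_lhs => rw [← e.sum_repr (S (e j))]
      simp [hs, LinearMap.toMatrix_apply]
    have key : (Matrix.of fun i j => B' v (e i) (e j)) = s.transpose * P + P * s := by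
      ext i j
      simp only [Matrix.of_apply, hS, hcol, Matrix.add_apply, Matrix.mul_apply,
        Matrix.transpose_apply, hP, gramMatrix]
      simp [mul_comm]
    have : (∑ i, ∑ j, P.adjugate i j •
        ((ContinuousLinearMap.apply ℝ ℝ (e i)) ∘L (ContinuousLinearMap.apply ℝ _ (e j)) ∘L B')) v
        = (P.adjugate * (s.transpose * P + P * s)).trace := by
      rw [← key]
      simp [Matrix.trace, Matrix.mul_apply]
    rw [this, Matrix.mul_add, Matrix.trace_add, ← Matrix.mul_assoc, ← Matrix.mul_assoc,
      Matrix.trace_mul_cycle, Matrix.mul_adjugate, Matrix.adjugate_mul,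
      LinearMap.trace_eq_matrix_trace ℝ e, ← hs]
    simp [Matrix.trace_transpose]
    ring

end LinearAlgebra

section Trace

variable {E F : Type*} [AddCommGroup E] [Module ℝ E] [FiniteDimensional ℝ E]
  [AddCommGroup F] [Module ℝ F] [FiniteDimensional ℝ F]

theorem trace_prod_eq (f : E × F →ₗ[ℝ] E × F) :
    LinearMap.trace ℝ (E × F) f =
      LinearMap.trace ℝ E (LinearMap.fst ℝ E F ∘ₗ f ∘ₗ LinearMap.inl ℝ E F) +
      LinearMap.trace ℝ F (LinearMap.snd ℝ E F ∘ₗ f ∘ₗ LinearMap.inr ℝ E F) := by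
  have hid : (LinearMap.inl ℝ E F ∘ₗ LinearMap.fst ℝ E F) +
      (LinearMap.inr ℝ E F ∘ₗ LinearMap.snd ℝ E F) = LinearMap.id := by
    ext <;> simp
  conv_lhs => rw [← LinearMap.comp_id f, ← hid, LinearMap.comp_add, map_add, ← LinearMap.comp_assoc,
    ← LinearMap.comp_assoc, LinearMap.trace_comp_comm' (LinearMap.fst ℝ E F),
    LinearMap.trace_comp_comm' (LinearMap.snd ℝ E F)]

/-- The trace is additive on short exact sequences (here the sequence `ker r → F → E`, split by
`h`). -/
theorem trace_eq_trace_restrict_add {r : F →ₗ[ℝ] E} {h : E →ₗ[ℝ] F} (hr : ∀ u, r (h u) = u)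
    {f : F →ₗ[ℝ] F} {g : E →ₗ[ℝ] E} (hfg : ∀ w, r (f w) = g (r w))
    (hf : ∀ w ∈ LinearMap.ker r, f w ∈ LinearMap.ker r) :
    LinearMap.trace ℝ F f =
      LinearMap.trace ℝ (LinearMap.ker r) (f.restrict hf) + LinearMap.trace ℝ E g := by
  let p : F →ₗ[ℝ] LinearMap.ker r :=
    LinearMap.codRestrict _ (LinearMap.id - h ∘ₗ r) (fun w => by simp [hr])
  have hid : f = (f ∘ₗ (LinearMap.ker r).subtype) ∘ₗ p + (f ∘ₗ h) ∘ₗ r := by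
    ext w
    simp [p]
  conv_lhs => rw [hid]
  rw [map_add, LinearMap.trace_comp_comm' p, LinearMap.trace_comp_comm' r]
  congr 2
  · ext w
    have : r (f w) = 0 := hf _ w.2
    simp [p, this]
  · ext u
    simp [hfg, hr]

/-- A shear of a product has determinant of square one. -/
theorem det_shear_sq (l : E →ₗ[ℝ] F) :
    LinearMap.det ((LinearMap.fst ℝ E F).prod (LinearMap.snd ℝ E F + l ∘ₗ LinearMap.fst ℝ E F)) ^ 2
      = 1 := by
  set s := (LinearMap.fst ℝ E F).prod (LinearMap.snd ℝ E F + l ∘ₗ LinearMap.fst ℝ E F)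
  set d := (LinearMap.fst ℝ E F).prod (-LinearMap.snd ℝ E F)
  -- `d` is an involution that conjugates the shear to its inverse
  have hd : d ∘ₗ d = LinearMap.id := by ext <;> simp [d]
  have hsd : s ∘ₗ d ∘ₗ s ∘ₗ d = LinearMap.id := by ext <;> simp [d, s]
  have h1 := congrArg LinearMap.det hd
  have h2 := congrArg LinearMap.det hsd
  simp only [LinearMap.det_comp, LinearMap.det_id] at h1 h2
  linear_combination h2 - LinearMap.det s ^ 2 * h1

end Trace

/-! ### Differentiable dependence of flows on the initial condition -/

section Flow

variable {E : Type*} [NormedAddCommGroup E] [NormedSpace ℝ E]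

/-- Equality of mixed partial derivatives, in the form needed for `C¹` flows: if `∂ₜf` exists near
the point and has a continuous `s`-derivative, then `∂ₛf` is differentiable in `t`. -/
theorem hasDerivAt_partial_of_mixed {f ft fts : ℝ → ℝ → E} {fs : ℝ → E} {t₀ : ℝ}
    (h1 : ∀ᶠ p in 𝓝 (t₀, (0 : ℝ)), HasDerivAt (fun t => f t p.2) (ft p.1 p.2) p.1)
    (h2 : ∀ᶠ p in 𝓝 (t₀, (0 : ℝ)), HasDerivAt (fun s => ft p.1 s) (fts p.1 p.2) p.2)
    (h3 : ContinuousAt (fun p : ℝ × ℝ => fts p.1 p.2) (t₀, 0))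
    (h4 : ∀ᶠ t in 𝓝 t₀, HasDerivAt (fun s => f t s) (fs t) 0) :
    HasDerivAt fs (fts t₀ 0) t₀ := by
  set l := fts t₀ 0 with hl
  rw [hasDerivAt_iff_isLittleO, Asymptotics.isLittleO_iff]
  intro ε hε
  have h3' : ∀ᶠ p in 𝓝 (t₀, (0 : ℝ)), ‖fts p.1 p.2 - l‖ < ε := by
    have := Metric.tendsto_nhds.1 h3 ε hε
    simpa [dist_eq_norm] using this
  obtain ⟨δ, hδ, hb⟩ := Metric.eventually_nhds_iff_ball.1 (h1.and (h2.and h3'))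
  have hb' : ∀ t ∈ Metric.ball t₀ δ, ∀ s ∈ Metric.ball (0 : ℝ) δ,
      HasDerivAt (fun t => f t s) (ft t s) t ∧ HasDerivAt (fun s => ft t s) (fts t s) s ∧
        ‖fts t s - l‖ < ε := by
    intro t ht s hs
    refine hb (t, s) ?_
    rw [← ball_prod_same]
    exact ⟨ht, hs⟩
  have h0 : (0 : ℝ) ∈ Metric.ball (0 : ℝ) δ := Metric.mem_ball_self hδ
  have ht₀ : t₀ ∈ Metric.ball t₀ δ := Metric.mem_ball_self hδ
  have h4₀ := h4.self_of_nhds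
  filter_upwards [h4, Metric.ball_mem_nhds t₀ hδ] with t h4t ht
  have hs1 : ∀ t' ∈ Metric.ball t₀ δ, ∀ s ∈ Metric.ball (0 : ℝ) δ,
      ‖ft t' s - ft t' 0 - s • l‖ ≤ ε * ‖s‖ := by
    intro t' ht' s hs
    have := (convex_ball (0 : ℝ) δ).norm_image_sub_le_of_norm_hasDerivWithin_le
      (f := fun s => ft t' s - s • l) (f' := fun s => fts t' s - l) (C := ε)
      (fun x hx => by
        simpa using ((hb' t' ht' x hx).2.1.fun_sub
          ((hasDerivAt_id x).smul_const l)).hasDerivWithinAt)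
      (fun x hx => (hb' t' ht' x hx).2.2.le) h0 hs
    simpa [sub_right_comm] using this
  have hs2 : ∀ s ∈ Metric.ball (0 : ℝ) δ,
      ‖(f t s - f t 0 - (f t₀ s - f t₀ 0)) - s • ((t - t₀) • l)‖ ≤ (ε * ‖t - t₀‖) * ‖s‖ := by
    intro s hs
    have := (convex_ball t₀ δ).norm_image_sub_le_of_norm_hasDerivWithin_le
      (f := fun t => f t s - f t 0 - t • (s • l)) (f' := fun t => ft t s - ft t 0 - s • l)
      (C := ε * ‖s‖)
      (fun x hx => by
        simpa using (((hb' x hx s hs).1.fun_sub (hb' x hx 0 h0).1).fun_sub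
          ((hasDerivAt_id x).smul_const (s • l))).hasDerivWithinAt)
      (fun x hx => hs1 x hx s hs) ht₀ ht
    calc _ = ‖f t s - f t 0 - t • s • l - (f t₀ s - f t₀ 0 - t₀ • s • l)‖ := by
          congr 1
          module
      _ ≤ _ := this
      _ = _ := by ring
  have hd : HasDerivAt (fun s => (f t s - f t 0 - (f t₀ s - f t₀ 0)) - s • ((t - t₀) • l))
      (fs t - fs t₀ - (t - t₀) • l) 0 := by
    simpa using ((h4t.sub_const (f t 0)).fun_sub (h4₀.sub_const (f t₀ 0))).fun_sub
      ((hasDerivAt_id (0 : ℝ)).smul_const ((t - t₀) • l))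
  refine hd.le_of_lip' (by positivity) ?_
  filter_upwards [Metric.ball_mem_nhds (0 : ℝ) hδ] with s hs
  simpa using hs2 s hs

/-- Second order Taylor estimate for a map with Lipschitz derivative. -/
theorem norm_sub_sub_fderiv_le {X : E → E} {s : Set E} (hs : Convex ℝ s) {K : NNReal}
    (hd : ∀ x ∈ s, DifferentiableAt ℝ X x) (hK : LipschitzOnWith K (fderiv ℝ X) s)
    {a b : E} (ha : a ∈ s) (hb : b ∈ s) :
    ‖X b - X a - fderiv ℝ X a (b - a)‖ ≤ K * ‖b - a‖ ^ 2 := by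
  have hseg : segment ℝ a b ⊆ s := hs.segment_subset ha hb
  have := (convex_segment (𝕜 := ℝ) a b).norm_image_sub_le_of_norm_hasFDerivWithin_le'
    (f := X) (f' := fderiv ℝ X) (φ := fderiv ℝ X a) (C := K * ‖b - a‖)
    (fun x hx => (hd x (hseg hx)).hasFDerivAt.hasFDerivWithinAt)
    (fun x hx => by
      have h1 := hK.dist_le_mul x (hseg hx) a ha
      rw [dist_eq_norm, dist_eq_norm] at h1
      refine h1.trans (mul_le_mul_of_nonneg_left ?_ K.2)
      obtain ⟨θ, hθ, rfl⟩ := (segment_eq_image' ℝ a b) ▸ hx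
      simp only [add_sub_cancel_left, norm_smul, Real.norm_eq_abs, abs_of_nonneg hθ.1]
      exact mul_le_of_le_one_left (norm_nonneg _) hθ.2)
    (left_mem_segment ℝ a b) (right_mem_segment ℝ a b)
  linarith

variable [CompleteSpace E]

/-- If `Y` solves the linearized equation along the solution `a`, with `Y(0) = 1`, then
`Y(t)(b(0) - a(0))` approximates `b(t) - a(t)` to second order for nearby solutions `b`. -/
theorem norm_sub_sub_linearized_le {X : E → E} {s : Set E} (hs : Convex ℝ s) {K C : NNReal} {l : ℝ}
    (hd : ∀ x ∈ s, DifferentiableAt ℝ X x) (hK : LipschitzOnWith K (fderiv ℝ X) s)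
    (hC : ∀ x ∈ s, ‖fderiv ℝ X x‖ ≤ C) {ε : ℝ} {a b : ℝ → E} {Y : ℝ → E →L[ℝ] E}
    (ha : ∀ t ∈ Ioo (-ε) ε, HasDerivAt a (X (a t)) t ∧ a t ∈ s)
    (hb : ∀ t ∈ Ioo (-ε) ε, HasDerivAt b (X (b t)) t ∧ b t ∈ s)
    (hY : ∀ t ∈ Ioo (-ε) ε, HasDerivAt Y (fderiv ℝ X (a t) ∘L Y t) t) (hY0 : Y 0 = 1)
    (hl : ∀ t ∈ Ioo (-ε) ε, ‖b t - a t‖ ≤ l) {t : ℝ} (ht : t ∈ Ioo (-ε) ε) :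
    ‖b t - a t - Y t (b 0 - a 0)‖ ≤ gronwallBound 0 C (K * l ^ 2) |t| := by
  -- reduce to positive times by reversing time if necessary
  obtain ⟨σ, hσ, hσt⟩ : ∃ σ : ℝ, |σ| = 1 ∧ σ * |t| = t := by
    rcases le_total 0 t with h | h
    · exact ⟨1, by simp, by rw [abs_of_nonneg h, one_mul]⟩
    · exact ⟨-1, by simp, by rw [abs_of_nonpos h]; ring⟩
  have hmem : ∀ r ∈ Icc (0 : ℝ) |t|, σ * r ∈ Ioo (-ε) ε := by
    intro r hr
    refine abs_lt.1 ?_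
    rw [abs_mul, hσ, one_mul, abs_of_nonneg hr.1]
    exact hr.2.trans_lt (abs_lt.2 ht)
  set v := b 0 - a 0
  let D : ℝ → E := fun r => b (σ * r) - a (σ * r) - Y (σ * r) v
  let D' : ℝ → E := fun r => σ • (X (b (σ * r)) - X (a (σ * r)) -
    fderiv ℝ X (a (σ * r)) (Y (σ * r) v))
  have hD : ∀ r ∈ Icc (0 : ℝ) |t|, HasDerivAt D (D' r) r := by
    intro r hr
    have hr' := hmem r hr
    have hlin : HasDerivAt (fun r : ℝ => σ * r) σ r := by
      simpa using (hasDerivAt_id r).const_mul σ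
    have h := (((hb _ hr').1.sub (ha _ hr').1).sub
      ((hY _ hr').clm_apply (hasDerivAt_const (σ * r) v))).scomp r hlin
    convert! h using 1
    simp [D']
  have := norm_le_gronwallBound_of_norm_deriv_right_le (f := D) (f' := D') (δ := 0) (K := C)
    (ε := K * l ^ 2) (a := 0) (b := |t|)
    (fun r hr => (hD r hr).continuousAt.continuousWithinAt)
    (fun r hr => (hD r (Ico_subset_Icc_self hr)).hasDerivWithinAt)
    (by simp [D, v, hY0]) (fun r hr => by
      have hr' := hmem r (Ico_subset_Icc_self hr)
      have h1 := norm_sub_sub_fderiv_le hs hd hK (ha _ hr').2 (hb _ hr').2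
      have h2 : ‖fderiv ℝ X (a (σ * r)) (D r)‖ ≤ C * ‖D r‖ :=
        (ContinuousLinearMap.le_opNorm _ _).trans
          (mul_le_mul_of_nonneg_right (hC _ (ha _ hr').2) (norm_nonneg _))
      have h3 : (K : ℝ) * ‖b (σ * r) - a (σ * r)‖ ^ 2 ≤ K * l ^ 2 :=
        mul_le_mul_of_nonneg_left (pow_le_pow_left₀ (norm_nonneg _) (hl _ hr') 2) K.2
      have h4 : D' r = σ • ((X (b (σ * r)) - X (a (σ * r)) -
          fderiv ℝ X (a (σ * r)) (b (σ * r) - a (σ * r))) + fderiv ℝ X (a (σ * r)) (D r)) := by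
        simp only [D, D', map_sub]
        congr 1
        abel
      rw [h4, norm_smul, Real.norm_eq_abs, hσ, one_mul]
      refine (norm_add_le _ _).trans ?_
      linarith) |t| (right_mem_Icc.2 (abs_nonneg t))
  simpa [D, hσt] using this

/-- A vector field of class `C²` has local flows of class `C¹`. The derivative of the flow in the
initial condition is found by solving the linearized equation together with the equation. -/
theorem exists_contDiffOn_flow {X : E → E} {x₀ : E} (hX : ContDiffAt ℝ 2 X x₀) {V : Set E}
    (hV : V ∈ 𝓝 x₀) :
    ∃ (U : Set E) (ε : ℝ) (Φ : ℝ → E → E), IsOpen U ∧ x₀ ∈ U ∧ 0 < ε ∧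
      ContDiffOn ℝ 1 (fun p : ℝ × E => Φ p.1 p.2) (Ioo (-ε) ε ×ˢ U) ∧
      ∀ x ∈ U, Φ 0 x = x ∧ ∀ t ∈ Ioo (-ε) ε, HasDerivAt (fun t => Φ t x) (X (Φ t x)) t ∧
        Φ t x ∈ V := by
  have hX' : ContDiffAt ℝ 1 (fderiv ℝ X) x₀ := hX.fderiv_right (by norm_num)
  -- a convex neighbourhood on which the field has bounded, Lipschitz derivative
  obtain ⟨K, s₁, hs₁, hK⟩ := hX'.exists_lipschitzOnWith
  have hC : ∀ᶠ x in 𝓝 x₀, ‖fderiv ℝ X x‖ ≤ (‖fderiv ℝ X x₀‖₊ + 1 : NNReal) := by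
    have := (hX'.continuousAt.norm).eventually_lt continuousAt_const
      (show ‖fderiv ℝ X x₀‖ < ‖fderiv ℝ X x₀‖ + 1 by linarith)
    filter_upwards [this] with x hx
    simpa using hx.le
  have hdiff : ∀ᶠ x in 𝓝 x₀, DifferentiableAt ℝ X x :=
    (hX.eventually (by simp)).mono fun x hx => hx.differentiableAt (by norm_num)
  have hcont : ∀ᶠ x in 𝓝 x₀, ContinuousAt (fderiv ℝ X) x :=
    (hX'.eventually (by simp)).mono fun x hx => hx.continuousAt
  obtain ⟨δ, hδ, hball⟩ := Metric.eventually_nhds_iff_ball.1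
    (hC.and (hdiff.and (hcont.and (Filter.Eventually.and hs₁ hV))))
  set s := Metric.ball x₀ δ with hs
  set C : NNReal := ‖fderiv ℝ X x₀‖₊ + 1
  -- the extended field
  let Z : E × (E →L[ℝ] E) → E × (E →L[ℝ] E) := fun p => (X p.1, fderiv ℝ X p.1 ∘L p.2)
  have hZ : ContDiffAt ℝ 1 Z (x₀, 1) := by
    have h1 : ContDiffAt ℝ 1 (fun p : E × (E →L[ℝ] E) => X p.1) (x₀, 1) :=
      (hX.of_le (by norm_num)).comp (x₀, (1 : E →L[ℝ] E)) contDiffAt_fst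
    have h2 : ContDiffAt ℝ 1 (fun p : E × (E →L[ℝ] E) => fderiv ℝ X p.1) (x₀, 1) :=
      hX'.comp (x₀, (1 : E →L[ℝ] E)) contDiffAt_fst
    exact h1.prodMk (h2.clm_comp contDiffAt_snd)
  obtain ⟨ε₀, hε₀, a, r, M, K', hr, hpl⟩ := IsPicardLindelof.of_contDiffAt_one hZ
  obtain ⟨α, hα, l, hl⟩ :=
    (hpl 0).exists_forall_mem_closedBall_eq_hasDerivWithinAt_lipschitzOnWith
  simp only [zero_sub, zero_add] at hα hl
  have hcontα : ContinuousOn (fun p : (E × (E →L[ℝ] E)) × ℝ => α p.1 p.2)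
      (Metric.closedBall (x₀, 1) r ×ˢ Icc (-ε₀) ε₀) :=
    continuousOn_prod_of_continuousOn_lipschitzOnWith _ l
      (fun x hx => HasDerivWithinAt.continuousOn (hα x hx).2) hl
  have hmemB : ∀ x ∈ Metric.ball x₀ r,
      (x, (1 : E →L[ℝ] E)) ∈ Metric.closedBall (x₀, 1) (r : ℝ) := by
    intro x hx
    rw [← closedBall_prod_same]
    exact ⟨Metric.ball_subset_closedBall hx, Metric.mem_closedBall_self r.2⟩
  let Φ : ℝ → E → E := fun t x => (α (x, 1) t).1
  let Y : ℝ → E → (E →L[ℝ] E) := fun t x => (α (x, 1) t).2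
  have hcontP : ContinuousOn (fun p : ℝ × E => α (p.2, 1) p.1)
      (Ioo (-ε₀) ε₀ ×ˢ Metric.ball x₀ r) := by
    refine hcontα.comp (f := fun p : ℝ × E => ((p.2, (1 : E →L[ℝ] E)), p.1)) (by fun_prop) ?_
    rintro ⟨t, x⟩ ⟨ht, hx⟩
    exact ⟨hmemB x hx, Ioo_subset_Icc_self ht⟩
  have hopen : IsOpen (Ioo (-ε₀) ε₀ ×ˢ Metric.ball x₀ (r : ℝ)) :=
    isOpen_Ioo.prod Metric.isOpen_ball
  have h0mem : ((0 : ℝ), x₀) ∈ Ioo (-ε₀) ε₀ ×ˢ Metric.ball x₀ (r : ℝ) :=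
    ⟨⟨by linarith, hε₀⟩, Metric.mem_ball_self hr⟩
  have hα0 : ∀ x ∈ Metric.ball x₀ (r : ℝ), α (x, 1) 0 = (x, 1) := fun x hx =>
    (hα _ (hmemB x hx)).1
  -- shrink so that the flow stays in the neighbourhood
  have hev : ∀ᶠ p in 𝓝 ((0 : ℝ), x₀), Φ p.1 p.2 ∈ s := by
    have hc : ContinuousAt (fun p : ℝ × E => Φ p.1 p.2) (0, x₀) :=
      (hcontP.continuousAt (hopen.mem_nhds h0mem)).fst
    refine hc.eventually_mem ?_
    have : Φ 0 x₀ = x₀ := by simp [Φ, hα0 x₀ (Metric.mem_ball_self hr)]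
    simpa [this] using Metric.ball_mem_nhds x₀ hδ
  obtain ⟨η, hη, hηb⟩ := Metric.eventually_nhds_iff_ball.1 hev
  set ε := min ε₀ η with hεdef
  set ρ := min (r : ℝ) η with hρdef
  have hε : 0 < ε := lt_min hε₀ hη
  have hIoo : Ioo (-ε) ε ⊆ Ioo (-ε₀) ε₀ :=
    Ioo_subset_Ioo (neg_le_neg (min_le_left _ _)) (min_le_left _ _)
  have hballr : Metric.ball x₀ ρ ⊆ Metric.ball x₀ r := Metric.ball_subset_ball (min_le_left _ _)
  have hΦs : ∀ x ∈ Metric.ball x₀ ρ, ∀ t ∈ Ioo (-ε) ε, Φ t x ∈ s := by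
    intro x hx t ht
    refine hηb (t, x) ?_
    rw [← ball_prod_same]
    refine ⟨?_, Metric.ball_subset_ball (min_le_right _ _) hx⟩
    rw [mem_ball_zero_iff, Real.norm_eq_abs]
    exact (abs_lt.2 ht).trans_le (min_le_right _ _)
  have hαd : ∀ x ∈ Metric.ball x₀ ρ, ∀ t ∈ Ioo (-ε) ε, HasDerivAt (α (x, 1)) (Z (α (x, 1) t)) t :=
    fun x hx t ht => ((hα _ (hmemB x (hballr hx))).2 t
      (Ioo_subset_Icc_self (hIoo ht))).hasDerivAt (Icc_mem_nhds (hIoo ht).1 (hIoo ht).2)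
  have hΦd : ∀ x ∈ Metric.ball x₀ ρ, ∀ t ∈ Ioo (-ε) ε,
      HasDerivAt (fun t => Φ t x) (X (Φ t x)) t := fun x hx t ht =>
    (hasFDerivAt_fst (𝕜 := ℝ) (p := α (x, 1) t)).comp_hasDerivAt t (hαd x hx t ht)
  have hYd : ∀ x ∈ Metric.ball x₀ ρ, ∀ t ∈ Ioo (-ε) ε,
      HasDerivAt (fun t => Y t x) (fderiv ℝ X (Φ t x) ∘L Y t x) t := fun x hx t ht =>
    (hasFDerivAt_snd (𝕜 := ℝ) (p := α (x, 1) t)).comp_hasDerivAt t (hαd x hx t ht)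
  have hΦ0 : ∀ x ∈ Metric.ball x₀ ρ, Φ 0 x = x := fun x hx => by simp [Φ, hα0 x (hballr hx)]
  have hY0 : ∀ x ∈ Metric.ball x₀ ρ, Y 0 x = 1 := fun x hx => by simp [Y, hα0 x (hballr hx)]
  -- `Y` is the derivative of the flow
  have hder : ∀ x ∈ Metric.ball x₀ ρ, ∀ t ∈ Ioo (-ε) ε, HasFDerivAt (fun x => Φ t x) (Y t x) x := by
    intro x hx t ht
    rw [hasFDerivAt_iff_isLittleO]
    refine Asymptotics.IsBigO.trans_isLittleO ?_
      (Asymptotics.isLittleO_pow_sub_sub x (show 1 < 2 by norm_num))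
    refine Asymptotics.IsBigO.of_bound (abs (gronwallBound 0 C (K * l ^ 2) (abs t))) ?_
    filter_upwards [Metric.isOpen_ball.mem_nhds hx] with y hy
    have h := norm_sub_sub_linearized_le (convex_ball x₀ δ) (fun z hz => (hball z hz).2.1)
      (hK.mono fun z hz => (hball z hz).2.2.2.1) (fun z hz => (hball z hz).1)
      (a := fun t => Φ t x) (b := fun t => Φ t y) (Y := fun t => Y t x) (l := l * ‖y - x‖)
      (fun t ht => ⟨hΦd x hx t ht, hΦs x hx t ht⟩) (fun t ht => ⟨hΦd y hy t ht, hΦs y hy t ht⟩)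
      (hYd x hx) (hY0 x hx)
      (fun t ht => by
        have h1 := (hl t (Ioo_subset_Icc_self (hIoo ht))).dist_le_mul _ (hmemB y (hballr hy)) _
          (hmemB x (hballr hx))
        have h2 : ‖Φ t y - Φ t x‖ ≤ dist (α (y, 1) t) (α (x, 1) t) := by
          rw [dist_eq_norm]
          exact norm_fst_le (α (y, 1) t - α (x, 1) t)
        have h3 : dist (y, (1 : E →L[ℝ] E)) (x, 1) = ‖y - x‖ := by
          simp [dist_eq_norm]
        rw [h3] at h1
        exact h2.trans h1) ht
    rw [hΦ0 x hx, hΦ0 y hy] at h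
    refine h.trans ?_
    have hC0 : (C : ℝ) ≠ 0 := by
      have : (0 : ℝ) < C := by positivity
      exact this.ne'
    rw [gronwallBound_of_K_ne_0 hC0, gronwallBound_of_K_ne_0 hC0]
    have h5 : ‖‖y - x‖ ^ 2‖ = ‖y - x‖ ^ 2 := by simp
    rw [h5]
    calc _ = (0 * Real.exp (C * |t|) + K * l ^ 2 / C * (Real.exp (C * |t|) - 1)) * ‖y - x‖ ^ 2 := by
          field_simp; ring
      _ ≤ _ := mul_le_mul_of_nonneg_right (le_abs_self _) (by positivity)
  refine ⟨Metric.ball x₀ ρ, ε, Φ, Metric.isOpen_ball,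
    Metric.mem_ball_self (lt_min hr hη), hε, ?_, fun x hx => ⟨hΦ0 x hx, fun t ht =>
      ⟨hΦd x hx t ht, (hball _ (hΦs x hx t ht)).2.2.2.2⟩⟩⟩
  have hopen' : IsOpen (Ioo (-ε) ε ×ˢ Metric.ball x₀ ρ) := isOpen_Ioo.prod Metric.isOpen_ball
  have hcontQ : ContinuousOn (fun p : ℝ × E => α (p.2, 1) p.1) (Ioo (-ε) ε ×ˢ Metric.ball x₀ ρ) :=
    hcontP.mono (prod_mono hIoo hballr)
  let f₁ : ℝ → E → (ℝ →L[ℝ] E) := fun t x => ContinuousLinearMap.toSpanSingleton ℝ (X (Φ t x))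
  have hcΦ : ∀ p ∈ Ioo (-ε) ε ×ˢ Metric.ball x₀ ρ,
      ContinuousAt (fun p : ℝ × E => X (Φ p.1 p.2)) p := fun p hp =>
    ContinuousAt.comp (g := X) ((hball _ (hΦs _ hp.2 _ hp.1)).2.1.continuousAt)
      (hcontQ.continuousAt (hopen'.mem_nhds hp)).fst
  have hcf₁ : ∀ p ∈ Ioo (-ε) ε ×ˢ Metric.ball x₀ ρ,
      ContinuousAt (fun p : ℝ × E => f₁ p.1 p.2) p := fun p hp => by
    have : Continuous (ContinuousLinearMap.toSpanSingleton ℝ : E → ℝ →L[ℝ] E) :=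
      (ContinuousLinearMap.toSpanSingletonCLE (𝕜 := ℝ) (E := E)).continuous
    exact this.continuousAt.comp (hcΦ p hp)
  have hcY : ∀ p ∈ Ioo (-ε) ε ×ˢ Metric.ball x₀ ρ,
      ContinuousAt (fun p : ℝ × E => Y p.1 p.2) p := fun p hp =>
    (hcontQ.continuousAt (hopen'.mem_nhds hp)).snd
  have hstrict : ∀ p ∈ Ioo (-ε) ε ×ˢ Metric.ball x₀ ρ,
      HasFDerivAt (fun p : ℝ × E => Φ p.1 p.2) ((f₁ p.1 p.2).coprod (Y p.1 p.2)) p := fun p hp =>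
    (hasStrictFDerivAt_uncurry_coprod (f := Φ) (f₁ := f₁) (f₂ := Y)
      (Filter.eventually_of_mem (hopen'.mem_nhds hp) fun q hq =>
        (hΦd q.2 hq.2 q.1 hq.1).hasFDerivAt)
      (Filter.eventually_of_mem (hopen'.mem_nhds hp) fun q hq => hder q.2 hq.2 q.1 hq.1)
      (hcf₁ p hp) (hcY p hp)).hasFDerivAt
  rw [show (1 : WithTop ℕ∞) = 0 + 1 by simp, contDiffOn_succ_iff_fderiv_of_isOpen hopen']
  refine ⟨fun p hp => (hstrict p hp).differentiableAt.differentiableWithinAt, by simp, ?_⟩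
  rw [contDiffOn_zero]
  refine ContinuousOn.congr (f := fun p : ℝ × E => (f₁ p.1 p.2).coprod (Y p.1 p.2)) ?_
    fun p hp => (hstrict p hp).fderiv
  intro p hp
  have hcop : Continuous (fun q : (ℝ →L[ℝ] E) × (E →L[ℝ] E) => q.1.coprod q.2) :=
    (ContinuousLinearMap.coprodEquivL (E := ℝ) (F := E) (G := E) ℝ).continuous
  exact (hcop.continuousAt.comp ((hcf₁ p hp).prodMk (hcY p hp))).continuousWithinAt

end Flow

/-! ### Charts and tangent vectors -/

section Charts

variable {E H N : Type*} [NormedAddCommGroup E] [NormedSpace ℝ E]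
  [TopologicalSpace H] (J : ModelWithCorners ℝ E H) [TopologicalSpace N] [ChartedSpace H N]
  [J.Boundaryless] [IsManifold J 1 N]

theorem hasMFDerivAt_extChartAt_symm (a : N) {u : E} (hu : u ∈ (extChartAt J a).target) :
    HasMFDerivAt 𝓘(ℝ, E) J (extChartAt J a).symm u
      (mfderiv 𝓘(ℝ, E) J (extChartAt J a).symm u) := by
  have := mdifferentiableWithinAt_extChartAt_symm (I := J) hu
  rw [J.range_eq_univ, mdifferentiableWithinAt_univ] at this
  exact this.hasMFDerivAt

theorem hasMFDerivAt_extChartAt' (a : N) {x : N} (hx : x ∈ (extChartAt J a).source) :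
    HasMFDerivAt J 𝓘(ℝ, E) (extChartAt J a) x (mfderiv J 𝓘(ℝ, E) (extChartAt J a) x) :=
  (mdifferentiableAt_extChartAt (I := J) (by rwa [extChartAt_source] at hx)).hasMFDerivAt

theorem mfderiv_extChartAt_symm_apply (a : N) {u : E} (hu : u ∈ (extChartAt J a).target)
    (z : E) :
    (mfderiv J 𝓘(ℝ, E) (extChartAt J a) ((extChartAt J a).symm u)
      (mfderiv 𝓘(ℝ, E) J (extChartAt J a).symm u z) : E) = z := by
  have := mfderiv_extChartAt_comp_mfderivWithin_extChartAt_symm (I := J) hu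
  rw [J.range_eq_univ, mfderivWithin_univ] at this
  exact congrArg (fun l => l z) this

theorem mfderiv_symm_extChartAt_apply (a : N) {x : N} (hx : x ∈ (extChartAt J a).source)
    (v : TangentSpace J x) :
    (mfderiv 𝓘(ℝ, E) J (extChartAt J a).symm (extChartAt J a x)
      (mfderiv J 𝓘(ℝ, E) (extChartAt J a) x v) : E) = v := by
  have := mfderivWithin_extChartAt_symm_comp_mfderiv_extChartAt' (I := J) hx
  rw [J.range_eq_univ, mfderivWithin_univ] at this
  exact congrArg (fun l => l v) this

theorem mfderiv_symm_chartField (X : ∀ x : N, TangentSpace J x) (a : N) {u : E}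
    (hu : u ∈ (extChartAt J a).target) :
    (mfderiv 𝓘(ℝ, E) J (extChartAt J a).symm u (chartField J X a u : E) : E) =
      X ((extChartAt J a).symm u) := by
  have h := mfderiv_symm_extChartAt_apply J a ((extChartAt J a).map_target hu)
    (X ((extChartAt J a).symm u))
  rwa [(extChartAt J a).right_inv hu] at h

theorem extChartAt_target_mem_nhds_center (a : N) :
    (extChartAt J a).target ∈ 𝓝 (extChartAt J a a) :=
  (isOpen_extChartAt_target a).mem_nhds (mem_extChartAt_target a)

end Charts

/-! ### Liouville's theorem -/

section Liouville

variable {E H N : Type*} [NormedAddCommGroup E] [NormedSpace ℝ E] [FiniteDimensional ℝ E]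
  [TopologicalSpace H] (J : ModelWithCorners ℝ E H) [TopologicalSpace N] [ChartedSpace H N]
  (g : ∀ x : N, TangentSpace J x → TangentSpace J x → ℝ) (X : ∀ x : N, TangentSpace J x)

/-- In the preferred chart at `a`, the field of forms `g` is given by the bilinear forms `B u`,
which are differentiable at the point corresponding to `a` and a scalar product there. -/
structure IsMetricInChart (a : N) (B : E → E →L[ℝ] E →L[ℝ] ℝ) : Prop where
  eq : ∀ᶠ u in 𝓝 (extChartAt J a a), ∀ z w : E,
    g ((extChartAt J a).symm u) (mfderiv 𝓘(ℝ, E) J (extChartAt J a).symm u z)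
      (mfderiv 𝓘(ℝ, E) J (extChartAt J a).symm u w) = B u z w
  differentiableAt : DifferentiableAt ℝ B (extChartAt J a a)
  symm : ∀ z w, B (extChartAt J a a) z w = B (extChartAt J a a) w z
  pos : ∀ z, z ≠ 0 → 0 < B (extChartAt J a a) z z

variable {J g X} {a : N} {B : E → E →L[ℝ] E →L[ℝ] ℝ}

theorem IsMetricInChart.det_pos (h : IsMetricInChart J g a B) :
    0 < (gramMatrix (Module.finBasis ℝ E) (B (extChartAt J a a))).det :=
  det_gramMatrix_pos _ h.symm h.pos

/-- The divergence is the trace of the derivative of the field plus its derivative of the logarithm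
of the volume density. -/
theorem divergence_eq (h : IsMetricInChart J g a B)
    {X' : E →L[ℝ] E} (hX : HasFDerivAt (chartField J X a) X' (extChartAt J a a)) {D : E →L[ℝ] ℝ}
    (hD : HasFDerivAt (fun u => (gramMatrix (Module.finBasis ℝ E) (B u)).det) D
      (extChartAt J a a)) :
    divergence J g X a = LinearMap.trace ℝ E X'.toLinearMap +
      D (chartField J X a (extChartAt J a a)) /
        (2 * (gramMatrix (Module.finBasis ℝ E) (B (extChartAt J a a))).det) := by
  set u₀ := extChartAt J a a with hu₀
  set d := (gramMatrix (Module.finBasis ℝ E) (B u₀)).det with hd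
  have hpos : 0 < d := h.det_pos
  have hev : volDensity J g a =ᶠ[𝓝 u₀]
      fun u => √((gramMatrix (Module.finBasis ℝ E) (B u)).det) := by
    filter_upwards [h.eq] with u hu
    simp only [volDensity, gramDet, gramMatrix, hu]
  have h1 : HasFDerivAt (volDensity J g a) ((1 / (2 * √d)) • D) u₀ :=
    (hD.sqrt hpos.ne').congr_of_eventuallyEq hev
  have h2 := (h1.fun_smul hX).fderiv
  have hs : 0 < √d := Real.sqrt_pos.2 hpos
  have hval : volDensity J g a u₀ = √d := hev.self_of_nhds
  rw [divergence, h2, hval]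
  simp only [ContinuousLinearMap.toLinearMap_add, ContinuousLinearMap.toLinearMap_smul, map_add,
    map_smul]
  have h3 : LinearMap.trace ℝ E ((((1 / (2 * √d)) • D).smulRight
      (chartField J X a u₀) : E →L[ℝ] E) : E →ₗ[ℝ] E) =
        (1 / (2 * √d)) * D (chartField J X a u₀) := by
    simp
  rw [h3, smul_eq_mul, mul_add, ← mul_assoc, inv_mul_cancel₀ hs.ne', one_mul, ← mul_assoc]
  congr 1
  have h4 : d = √d * √d := (Real.mul_self_sqrt hpos.le).symm
  conv_rhs => rw [h4]
  field_simp

variable [J.Boundaryless] [IsManifold J 1 N]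

/-- Liouville's formula: along a flow, the Gram determinant of the transported vectors changes at
the rate of twice the divergence. -/
theorem hasDerivAt_gramDet_flow {U : Set N} {t₁ t₂ : ℝ} {Φ : ℝ → N → N}
    (hΦ : IsLocalFlow J X U t₁ t₂ Φ) {t₀ : ℝ} (ht₀ : t₀ ∈ Ioo t₁ t₂) {x : N} (hx : x ∈ U)
    (hB : IsMetricInChart J g (Φ t₀ x) B)
    (hX : ContDiffAt ℝ 1 (chartField J X (Φ t₀ x))
      (extChartAt J (Φ t₀ x) (Φ t₀ x)))
    (v : Fin (Module.finrank ℝ E) → TangentSpace J x) :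
    HasDerivAt (fun t => gramDet J g (Φ t x) (fun i => mfderiv J J (Φ t) x (v i)))
      (2 * divergence J g X (Φ t₀ x) *
        gramDet J g (Φ t₀ x) (fun i => mfderiv J J (Φ t₀) x (v i))) t₀ := by
  set a := Φ t₀ x with ha
  set ψ₁ := extChartAt J x with hψ₁
  set ψ₂ := extChartAt J a with hψ₂
  set v₀ := ψ₁ x with hv₀
  set u₀ := ψ₂ a with hu₀
  set Xc := chartField J X a with hXc
  set e := Module.finBasis ℝ E with he
  have hsrc : x ∈ ψ₁.source := mem_extChartAt_source x
  have htgt : v₀ ∈ ψ₁.target := mem_extChartAt_target x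
  have hv₀x : ψ₁.symm v₀ = x := extChartAt_to_inv x
  have hsymm : ∀ᶠ v in 𝓝 v₀, v ∈ ψ₁.target := extChartAt_target_mem_nhds_center J x
  have hdom : Ioo t₁ t₂ ×ˢ U ∈ 𝓝 (t₀, x) := (isOpen_Ioo.prod hΦ.isOpen).mem_nhds ⟨ht₀, hx⟩
  -- the flow in the charts
  let Ψ : ℝ × E → E := fun p => ψ₂ (Φ p.1 (ψ₁.symm p.2))
  have hsm₁ : ContMDiffAt 𝓘(ℝ, E) J 1 ψ₁.symm v₀ :=
    (contMDiffOn_extChartAt_symm x).contMDiffAt hsymm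
  have hpair : ContMDiffAt 𝓘(ℝ, ℝ × E) (𝓘(ℝ, ℝ).prod J) 1
      (fun p : ℝ × E => (p.1, ψ₁.symm p.2)) (t₀, v₀) := by
    refine ContMDiffAt.prodMk contDiffAt_fst.contMDiffAt ?_
    exact ContMDiffAt.comp (t₀, v₀) (g := ψ₁.symm) hsm₁ contDiffAt_snd.contMDiffAt
  have hΦc : ContMDiffAt (𝓘(ℝ, ℝ).prod J) J 1 (fun p : ℝ × N => Φ p.1 p.2) (t₀, x) :=
    hΦ.contMDiffOn.contMDiffAt hdom
  have hcomp : ContMDiffAt 𝓘(ℝ, ℝ × E) J 1 (fun p : ℝ × E => Φ p.1 (ψ₁.symm p.2)) (t₀, v₀) := by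
    refine ContMDiffAt.comp (t₀, v₀) (g := fun p : ℝ × N => Φ p.1 p.2) ?_ hpair
    rwa [hv₀x]
  have ha' : Φ t₀ (ψ₁.symm v₀) = a := by rw [hv₀x]
  have hΨ : ContDiffAt ℝ 1 Ψ (t₀, v₀) := by
    rw [← contMDiffAt_iff_contDiffAt]
    refine ContMDiffAt.comp (t₀, v₀) (g := ψ₂) ?_ hcomp
    rw [ha']
    exact contMDiffAt_extChartAt
  have hΨ0 : Ψ (t₀, v₀) = u₀ := by simp only [Ψ, hv₀x]; rfl
  -- nearby points are in the domain of all maps involved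
  have hE1 : ∀ᶠ p in 𝓝 (t₀, v₀), (p.1, ψ₁.symm p.2) ∈ Ioo t₁ t₂ ×ˢ U := by
    refine hpair.continuousAt.eventually_mem ?_
    rwa [hv₀x]
  have hE2 : ∀ᶠ p in 𝓝 (t₀, v₀), Φ p.1 (ψ₁.symm p.2) ∈ ψ₂.source := by
    refine hcomp.continuousAt.eventually_mem ?_
    rw [ha']
    exact extChartAt_source_mem_nhds a
  have hXd : ∀ᶠ u in 𝓝 u₀, ContDiffAt ℝ 1 Xc u := hX.eventually (by simp)
  have hE3 : ∀ᶠ p in 𝓝 (t₀, v₀), ContDiffAt ℝ 1 Xc (Ψ p) := by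
    refine hΨ.continuousAt.eventually ?_
    rwa [hΨ0]
  have hE4 : ∀ᶠ p in 𝓝 (t₀, v₀), ContDiffAt ℝ 1 Ψ p := hΨ.eventually (by simp)
  have hE5 : ∀ᶠ p in 𝓝 (t₀, v₀), p.2 ∈ ψ₁.target :=
    continuousAt_snd.eventually hsymm
  -- the flow equation in the charts
  have hflow : ∀ᶠ p in 𝓝 (t₀, v₀), HasDerivAt (fun t => Ψ (t, p.2)) (Xc (Ψ p)) p.1 := by
    filter_upwards [hE1, hE2] with p h1 h2
    have h3 := hΦ.integralCurve (ψ₁.symm p.2) h1.2 p.1 h1.1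
    have h3' := h3.hasMFDerivAt (isOpen_Ioo.mem_nhds h1.1)
    have h4 := (hasMFDerivAt_extChartAt' J a h2).comp p.1 h3'
    have h5 : HasFDerivAt (fun t => Ψ (t, p.2)) _ p.1 := hasMFDerivAt_iff_hasFDerivAt.1 h4
    refine hasDerivAt_iff_hasFDerivAt.2 (h5.congr_fderiv ?_)
    ext
    simp only [Xc, chartField, Ψ]
    change mfderiv J 𝓘(ℝ, E) ψ₂ (Φ p.1 (ψ₁.symm p.2)) ((1 : ℝ) • X (Φ p.1 (ψ₁.symm p.2))) =
      (1 : ℝ) • mfderiv J 𝓘(ℝ, E) ψ₂ (ψ₂.symm (ψ₂ (Φ p.1 (ψ₁.symm p.2))))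
      (X (ψ₂.symm (ψ₂ (Φ p.1 (ψ₁.symm p.2)))))
    rw [one_smul, one_smul, ψ₂.left_inv h2]
  -- the transported vectors in the chart
  let w : Fin (Module.finrank ℝ E) → E := fun i => mfderiv J 𝓘(ℝ, E) ψ₁ x (v i)
  let y : Fin (Module.finrank ℝ E) → ℝ → E := fun i t => fderiv ℝ Ψ (t, v₀) (0, w i)
  have hyd : ∀ i, HasDerivAt (y i) (fderiv ℝ Xc u₀ (y i t₀)) t₀ := by
    intro i
    have hline : Filter.Tendsto (fun p : ℝ × ℝ => (p.1, v₀ + p.2 • w i)) (𝓝 (t₀, 0))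
        (𝓝 (t₀, v₀)) := by
      have : Continuous (fun p : ℝ × ℝ => (p.1, v₀ + p.2 • w i)) := by fun_prop
      simpa using this.tendsto (t₀, (0 : ℝ))
    have hls : ∀ t s : ℝ, HasDerivAt (fun s : ℝ => (t, v₀ + s • w i)) ((0 : ℝ), w i) s := by
      intro t s
      have h1 : HasDerivAt (fun s : ℝ => v₀ + s • w i) (w i) s := by
        simpa using ((hasDerivAt_id s).smul_const (w i)).const_add v₀
      exact (hasDerivAt_const s t).prodMk h1
    have := hasDerivAt_partial_of_mixed
      (f := fun t s => Ψ (t, v₀ + s • w i)) (ft := fun t s => Xc (Ψ (t, v₀ + s • w i)))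
      (fts := fun t s => fderiv ℝ Xc (Ψ (t, v₀ + s • w i))
        (fderiv ℝ Ψ (t, v₀ + s • w i) (0, w i)))
      (fs := y i) (t₀ := t₀) (hline.eventually hflow)
      (by
        filter_upwards [hline.eventually hE3, hline.eventually hE4] with p h3 h4
        have h5 := ((h4.differentiableAt (by norm_num)).hasFDerivAt).comp_hasDerivAt p.2
          (hls p.1 p.2)
        exact ((h3.differentiableAt (by norm_num)).hasFDerivAt).comp_hasDerivAt p.2 h5)
      (by
        have c1 : ContinuousAt (fderiv ℝ Ψ) (t₀, v₀) :=
          (hΨ.fderiv_right (m := 0) (by norm_num)).continuousAt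
        have c2 : ContinuousAt (fderiv ℝ Xc) (Ψ (t₀, v₀)) := by
          rw [hΨ0]
          exact (hX.fderiv_right (m := 0) (by norm_num)).continuousAt
        have c3 : ContinuousAt (fun q => fderiv ℝ Xc (Ψ q) (fderiv ℝ Ψ q (0, w i))) (t₀, v₀) :=
          (ContinuousAt.comp (g := fderiv ℝ Xc) c2 hΨ.continuousAt).clm_apply
            (c1.clm_apply continuousAt_const)
        have c4 : ContinuousAt (fun p : ℝ × ℝ => (p.1, v₀ + p.2 • w i)) (t₀, 0) := by fun_prop
        refine ContinuousAt.comp (g := fun q => fderiv ℝ Xc (Ψ q) (fderiv ℝ Ψ q (0, w i))) ?_ c4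
        simpa using c3)
      (by
        have hl0 : Filter.Tendsto (fun t : ℝ => (t, v₀)) (𝓝 t₀) (𝓝 (t₀, v₀)) :=
          (by fun_prop : Continuous (fun t : ℝ => (t, v₀))).tendsto t₀
        filter_upwards [hl0.eventually hE4] with t h4
        have h5 : HasFDerivAt Ψ (fderiv ℝ Ψ (t, v₀)) (t, v₀ + (0 : ℝ) • w i) := by
          simpa using (h4.differentiableAt (by norm_num)).hasFDerivAt
        exact h5.comp_hasDerivAt 0 (hls t 0))
    simpa [hΨ0, y] using this
  have hl0 : Filter.Tendsto (fun t : ℝ => (t, v₀)) (𝓝 t₀) (𝓝 (t₀, v₀)) :=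
    (by fun_prop : Continuous (fun t : ℝ => (t, v₀))).tendsto t₀
  have htrans : ∀ᶠ t in 𝓝 t₀, ∀ i, (mfderiv J J (Φ t) x (v i) : E) =
      mfderiv 𝓘(ℝ, E) J ψ₂.symm (Ψ (t, v₀)) (y i t) := by
    filter_upwards [hl0.eventually (hE1.and (hE2.and hE4)).eventually_nhds] with t hall i
    have hpt := hall.self_of_nhds
    have hx' : HasMFDerivAt J 𝓘(ℝ, E) ψ₁ x (mfderiv J 𝓘(ℝ, E) ψ₁ x) :=
      hasMFDerivAt_extChartAt' J x hsrc
    have hΨt : HasFDerivAt (fun z => Ψ (t, z)) (fderiv ℝ Ψ (t, v₀) ∘L ContinuousLinearMap.inr ℝ ℝ E)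
        v₀ := by
      have h6 : HasFDerivAt (fun z : E => (t, z)) (ContinuousLinearMap.inr ℝ ℝ E) v₀ :=
        hasFDerivAt_prodMk_right t v₀
      exact ((hpt.2.2.differentiableAt (by norm_num)).hasFDerivAt).comp v₀ h6
    have hmem : Ψ (t, v₀) ∈ ψ₂.target := ψ₂.map_source hpt.2.1
    have h7 := (hasMFDerivAt_extChartAt_symm J a hmem).comp v₀
      (hasMFDerivAt_iff_hasFDerivAt.2 hΨt)
    have h8 := h7.comp x hx'
    have hev : Φ t =ᶠ[𝓝 x] (ψ₂.symm ∘ fun z => Ψ (t, z)) ∘ ψ₁ := by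
      have hc : Filter.Tendsto (fun z => (t, ψ₁ z)) (𝓝 x) (𝓝 (t, v₀)) :=
        ((continuousAt_const).prodMk (continuousAt_extChartAt x)).tendsto
      filter_upwards [hc.eventually hall, extChartAt_source_mem_nhds (I := J) x] with z hz hzs
      have h9 : ψ₁.symm (ψ₁ z) = z := ψ₁.left_inv hzs
      have h10 := hz.2.1
      simp only [h9] at h10
      simp only [Function.comp, Ψ, h9]
      exact (ψ₂.left_inv h10).symm
    have h11 := (h8.congr_of_eventuallyEq hev).mfderiv
    have h12 := congrArg (fun l => l (v i)) h11
    exact h12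
  have hgram : (fun t => gramDet J g (Φ t x) (fun i => mfderiv J J (Φ t) x (v i))) =ᶠ[𝓝 t₀]
      fun t => (Matrix.of fun i j => e.repr (y j t) i).det ^ 2 *
        (gramMatrix e (B (Ψ (t, v₀)))).det := by
    have hΨc : Filter.Tendsto (fun t => Ψ (t, v₀)) (𝓝 t₀) (𝓝 u₀) := by
      have := hΨ.continuousAt.tendsto.comp hl0
      rwa [hΨ0] at this
    filter_upwards [htrans, hΨc.eventually hB.eq, hl0.eventually hE2] with t h1 h2 h3
    rw [← det_gram_family e, gramDet]
    congr 2
    ext i j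
    have h4 : ψ₂.symm (Ψ (t, v₀)) = Φ t x := by
      simp only [Ψ]
      rw [ψ₂.left_inv h3, hv₀x]
    have h5 := h2 (y i t) (y j t)
    rw [h4] at h5
    rw [← h5]
    exact congrArg₂ (g (Φ t x)) (h1 i) (h1 j)
  have hdetY : HasDerivAt (fun t => (Matrix.of fun i j => e.repr (y j t) i).det)
      (LinearMap.trace ℝ E (fderiv ℝ Xc u₀).toLinearMap *
        (Matrix.of fun i j => e.repr (y j t₀) i).det) t₀ := by
    have h1 := hasDerivAt_det (P := fun t => Matrix.of fun i j => e.repr (y j t) i)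
      (P' := LinearMap.toMatrix e e (fderiv ℝ Xc u₀).toLinearMap *
        Matrix.of fun i j => e.repr (y j t₀) i) (t := t₀) (fun i j => by
        have h2 := ((LinearMap.toContinuousLinearMap (e.coord i)).hasFDerivAt
          (x := y j t₀)).comp_hasDerivAt t₀ (hyd j)
        convert! h2 using 1
        have h3 := congrFun (LinearMap.toMatrix_mulVec_repr e e (fderiv ℝ Xc u₀).toLinearMap
          (y j t₀)) i
        exact h3)
    convert! h1 using 1
    rw [← Matrix.mul_assoc, Matrix.trace_mul_cycle, Matrix.mul_adjugate, Matrix.smul_mul,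
      Matrix.one_mul, Matrix.trace_smul, LinearMap.trace_eq_matrix_trace ℝ e, smul_eq_mul, mul_comm]
  obtain ⟨D, hD, -⟩ := hasFDerivAt_det_gramMatrix e hB.differentiableAt.hasFDerivAt
  have hdetB : HasDerivAt (fun t => (gramMatrix e (B (Ψ (t, v₀)))).det) (D (Xc u₀)) t₀ := by
    have h1 := hflow.self_of_nhds
    rw [hΨ0] at h1
    have hD' : HasFDerivAt (fun u => (gramMatrix e (B u)).det) D (Ψ (t₀, v₀)) := by
      rw [hΨ0]
      exact hD
    exact hD'.comp_hasDerivAt t₀ h1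
  have hdiv := divergence_eq hB ((hX.differentiableAt (by norm_num)).hasFDerivAt) hD
  have hpos := hB.det_pos
  refine HasDerivAt.congr_of_eventuallyEq ?_ hgram
  have hgram₀ : gramDet J g a (fun i => mfderiv J J (Φ t₀) x (v i)) =
      (Matrix.of fun i j => e.repr (y j t₀) i).det ^ 2 * (gramMatrix e (B (Ψ (t₀, v₀)))).det :=
    hgram.self_of_nhds
  rw [hgram₀, hdiv]
  convert! (hdetY.pow 2).mul hdetB using 1
  simp only [hΨ0]
  rw [← hu₀, ← he, ← hXc] at *
  simp only [Pi.pow_apply]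
  field_simp
  ring

/-- Existence of local flows of class `C¹` on a manifold without boundary. -/
theorem exists_isLocalFlow (a : N) (hX : ContDiffAt ℝ 2 (chartField J X a) (extChartAt J a a)) :
    ∃ (U : Set N) (ε : ℝ) (Φ : ℝ → N → N), a ∈ U ∧ IsLocalFlow J X U (-ε) ε Φ := by
  set ψ := extChartAt J a with hψ
  obtain ⟨U, ε, Φ, hU, haU, hε, hΦ, hprop⟩ := exists_contDiffOn_flow hX
    (extChartAt_target_mem_nhds_center J a)
  have hmaps : MapsTo (fun p : ℝ × N => (p.1, ψ p.2)) (Ioo (-ε) ε ×ˢ (ψ.source ∩ ψ ⁻¹' U))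
      (Ioo (-ε) ε ×ˢ U) := fun p hp => ⟨hp.1, hp.2.2⟩
  refine ⟨ψ.source ∩ ψ ⁻¹' U, ε, fun t x => ψ.symm (Φ t (ψ x)), ⟨mem_extChartAt_source a, haU⟩,
    (continuousOn_extChartAt a).isOpen_inter_preimage (isOpen_extChartAt_source a) hU,
    by linarith, hε, ?_, ?_, ?_⟩
  · have h1 : ContMDiffOn (𝓘(ℝ, ℝ).prod J) 𝓘(ℝ, ℝ × E) 1 (fun p : ℝ × N => (p.1, ψ p.2))
        (Ioo (-ε) ε ×ˢ (ψ.source ∩ ψ ⁻¹' U)) := by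
      have h2 : ContMDiffOn (𝓘(ℝ, ℝ).prod J) 𝓘(ℝ, E) 1 (fun p : ℝ × N => ψ p.2)
          (Ioo (-ε) ε ×ˢ (ψ.source ∩ ψ ⁻¹' U)) :=
        (contMDiffOn_extChartAt (x := a)).comp contMDiffOn_snd
          fun p hp => by simpa [ψ] using hp.2.1
      exact contMDiffOn_fst.prodMk_space h2
    have h3 : ContMDiffOn (𝓘(ℝ, ℝ).prod J) 𝓘(ℝ, E) 1 (fun p : ℝ × N => Φ p.1 (ψ p.2))
        (Ioo (-ε) ε ×ˢ (ψ.source ∩ ψ ⁻¹' U)) := hΦ.contMDiffOn.comp h1 hmaps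
    exact (contMDiffOn_extChartAt_symm a).comp h3
      fun p hp => ((hprop _ hp.2.2).2 _ hp.1).2
  · intro x hx
    simp only [(hprop _ hx.2).1]
    exact ψ.left_inv hx.1
  · intro x hx t ht
    obtain ⟨h1, h2⟩ := (hprop _ hx.2).2 t ht
    have h3 := (hasMFDerivAt_extChartAt_symm J a h2).comp t
      (hasMFDerivAt_iff_hasFDerivAt.2 h1.hasFDerivAt)
    have h4 := mfderiv_symm_chartField J X a h2
    refine (HasMFDerivAt.congr_mfderiv h3 ?_).hasMFDerivWithinAt
    ext
    change mfderiv 𝓘(ℝ, E) J ψ.symm (Φ t (ψ x)) ((1 : ℝ) • chartField J X a (Φ t (ψ x))) =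
      (1 : ℝ) • X (ψ.symm (Φ t (ψ x)))
    rw [one_smul, one_smul]
    exact h4

/-- Liouville's theorem: the flow of a vector field preserves the Riemannian volume if and only if
the divergence of the field vanishes. -/
theorem flowPreservesVolume_iff (hg : ∀ a, ∃ B, IsMetricInChart J g a B)
    (hX : ∀ a, ContDiffAt ℝ 2 (chartField J X a) (extChartAt J a a)) :
    FlowPreservesVolume J g X ↔ ∀ a, divergence J g X a = 0 := by
  constructor
  · intro h a
    obtain ⟨U, ε, Φ, haU, hΦ⟩ := exists_isLocalFlow a (hX a)
    have h0 : (0 : ℝ) ∈ Ioo (-ε) ε := ⟨hΦ.neg, hΦ.pos⟩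
    have hΦ0 : Φ 0 a = a := hΦ.init a haU
    obtain ⟨B, hB⟩ := hg (Φ 0 a)
    let v : Fin (Module.finrank ℝ E) → TangentSpace J a := fun i =>
      mfderiv 𝓘(ℝ, E) J (extChartAt J a).symm (extChartAt J a a) (Module.finBasis ℝ E i)
    have h1 := hasDerivAt_gramDet_flow hΦ h0 haU hB ((hX _).of_le (by norm_num)) v
    have h2 : (fun t => gramDet J g (Φ t a) (fun i => mfderiv J J (Φ t) a (v i))) =ᶠ[𝓝 0]
        fun _ => gramDet J g a v := by
      filter_upwards [isOpen_Ioo.mem_nhds h0] with t ht using h U _ _ Φ hΦ t ht a haU v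
    have h3 := (h1.congr_of_eventuallyEq h2.symm).unique (hasDerivAt_const 0 _)
    have h2' : gramDet J g (Φ 0 a) (fun i => mfderiv J J (Φ 0) a (v i)) = gramDet J g a v :=
      h2.self_of_nhds
    rw [h2', hΦ0] at h3
    obtain ⟨B', hB'⟩ := hg a
    have h4 : gramDet J g a v ≠ 0 := by
      have h5 := hB'.eq.self_of_nhds
      rw [extChartAt_to_inv a] at h5
      have h6 : gramDet J g a v =
          (gramMatrix (Module.finBasis ℝ E) (B' (extChartAt J a a))).det := by
        unfold gramDet gramMatrix
        congr 2
        ext i j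
        exact h5 _ _
      rw [h6]
      exact hB'.det_pos.ne'
    simpa [h4] using h3
  · intro h U t₁ t₂ Φ hΦ t ht x hx v
    have h0 : (0 : ℝ) ∈ Ioo t₁ t₂ := ⟨hΦ.neg, hΦ.pos⟩
    have hd : ∀ s ∈ Ioo t₁ t₂, HasDerivAt
        (fun t => gramDet J g (Φ t x) (fun i => mfderiv J J (Φ t) x (v i))) 0 s := by
      intro s hs
      obtain ⟨B, hB⟩ := hg (Φ s x)
      have h1 := hasDerivAt_gramDet_flow hΦ hs hx hB ((hX _).of_le (by norm_num)) v
      simpa [h] using h1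
    have hconst := (convex_Ioo t₁ t₂).is_const_of_fderivWithin_eq_zero (𝕜 := ℝ)
      (f := fun t => gramDet J g (Φ t x) (fun i => mfderiv J J (Φ t) x (v i)))
      (fun s hs => (hd s hs).differentiableAt.differentiableWithinAt)
      (fun s hs => by
        rw [fderivWithin_of_isOpen isOpen_Ioo hs]
        have := (hd s hs).hasFDerivAt.fderiv
        rw [this]
        ext
        simp) ht h0
    refine hconst.trans ?_
    -- at time zero the flow is the identity near `x`
    have hid : Φ 0 =ᶠ[𝓝 x] id := by
      filter_upwards [hΦ.isOpen.mem_nhds hx] with z hz using hΦ.init z hz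
    have h5 : mfderiv J J (Φ 0) x = mfderiv J J id x := hid.mfderiv_eq
    have h6 : ∀ i, (mfderiv J J (Φ 0) x (v i) : E) = v i := by
      intro i
      have h7 : (mfderiv J J (Φ 0) x (v i) : E) = mfderiv J J id x (v i) :=
        congrArg (fun l : E →L[ℝ] E => l (v i)) h5
      rw [h7, mfderiv_id]
      rfl
    have h8 : Φ 0 x = x := hΦ.init x hx
    unfold gramDet
    congr 2
    ext i j
    have key : ∀ (z : N) (hz : z = x) (p q p' q' : E), p = p' → q = q' →
        g z (p : TangentSpace J z) (q : TangentSpace J z) = g x p' q' := by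
      rintro z rfl p q p' q' rfl rfl
      rfl
    exact key _ h8 _ _ _ _ (h6 i) (h6 j)

end Liouville

/-! ### Smooth families of linear maps and bilinear forms -/

section Families

variable {X E F : Type*} [NormedAddCommGroup X] [NormedSpace ℝ X]
  [NormedAddCommGroup E] [NormedSpace ℝ E] [FiniteDimensional ℝ E]
  [NormedAddCommGroup F] [NormedSpace ℝ F] [FiniteDimensional ℝ F]

theorem exists_equiv_of_injective {E₁ E₂ : Type*} [NormedAddCommGroup E₁] [NormedSpace ℝ E₁]
    [FiniteDimensional ℝ E₁] [NormedAddCommGroup E₂] [NormedSpace ℝ E₂] [FiniteDimensional ℝ E₂]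
    (f : E₁ →L[ℝ] E₂) (hf : Function.Injective f)
    (h : Module.finrank ℝ E₁ = Module.finrank ℝ E₂) :
    ∃ e : E₁ ≃L[ℝ] E₂, (e : E₁ →L[ℝ] E₂) = f := by
  refine ⟨(LinearEquiv.ofInjectiveOfFinrankEq f.toLinearMap hf h).toContinuousLinearEquiv, ?_⟩
  ext x
  rfl

theorem finrank_dual_eq : Module.finrank ℝ (E →L[ℝ] ℝ) = Module.finrank ℝ E := by
  rw [← (LinearMap.toContinuousLinearMap (𝕜 := ℝ) (E := E) (F' := ℝ)).finrank_eq]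
  exact Subspace.dual_finrank_eq

theorem exists_equiv_of_pos {B : F →L[ℝ] F →L[ℝ] ℝ} (hp : ∀ v, v ≠ 0 → 0 < B v v) :
    ∃ e : F ≃L[ℝ] (F →L[ℝ] ℝ), (e : F →L[ℝ] F →L[ℝ] ℝ) = B := by
  refine exists_equiv_of_injective B ?_ finrank_dual_eq.symm
  refine (injective_iff_map_eq_zero B).2 fun v hv => ?_
  by_contra h0
  have := hp v h0
  simp [hv] at this

theorem apply_inverse_of_pos {B : F →L[ℝ] F →L[ℝ] ℝ} (hp : ∀ v, v ≠ 0 → 0 < B v v)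
    (l : F →L[ℝ] ℝ) : B (B.inverse l) = l := by
  obtain ⟨e, rfl⟩ := exists_equiv_of_pos hp
  simp

variable {U : Set X} {G : X → F →L[ℝ] F →L[ℝ] ℝ}

theorem contDiffOn_inverse {E₁ E₂ : Type*} [NormedAddCommGroup E₁] [NormedSpace ℝ E₁]
    [FiniteDimensional ℝ E₁] [NormedAddCommGroup E₂] [NormedSpace ℝ E₂]
    {f : X → E₁ →L[ℝ] E₂} (hf : ContDiffOn ℝ ∞ f U)
    (he : ∀ q ∈ U, ∃ e : E₁ ≃L[ℝ] E₂, (e : E₁ →L[ℝ] E₂) = f q) :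
    ContDiffOn ℝ ∞ (fun q => (f q).inverse) U := by
  have : CompleteSpace E₁ := FiniteDimensional.complete ℝ E₁
  intro q hq
  obtain ⟨e, he⟩ := he q hq
  have h := contDiffAt_map_inverse (𝕜 := ℝ) (n := ∞) e
  rw [he] at h
  exact h.comp_contDiffWithinAt q (hf q hq)

/-- A surjective family of maps has a right inverse orthogonal to the kernels, depending smoothly
on the parameter. -/
theorem exists_horizontal_lift (hG : ContDiffOn ℝ ∞ G U)
    (hp : ∀ q ∈ U, ∀ v, v ≠ 0 → 0 < G q v v) {ρ : X → F →L[ℝ] E} (hρ : ContDiffOn ℝ ∞ ρ U)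
    (hsurj : ∀ q ∈ U, Function.Surjective (ρ q)) :
    ∃ h : X → E →L[ℝ] F, ContDiffOn ℝ ∞ h U ∧ (∀ q ∈ U, ∀ u, ρ q (h q u) = u) ∧
      ∀ q ∈ U, ∀ u w, ρ q w = 0 → G q (h q u) w = 0 := by
  let S : X → (E →L[ℝ] ℝ) →L[ℝ] F := fun q =>
    (G q).inverse ∘L ((ContinuousLinearMap.compL ℝ F E ℝ).flip (ρ q))
  have hSapp : ∀ q l, S q l = (G q).inverse (l ∘L ρ q) := fun q l => rfl
  have hGS : ∀ q ∈ U, ∀ l, G q (S q l) = l ∘L ρ q := fun q hq l => by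
    rw [hSapp, apply_inverse_of_pos (hp q hq)]
  have hS : ContDiffOn ℝ ∞ S U := by
    rw [contDiffOn_clm_apply]
    intro l
    exact ContDiffOn.clm_apply (f := fun q => (G q).inverse)
      (contDiffOn_inverse hG fun q hq => exists_equiv_of_pos (hp q hq))
      (contDiffOn_const.clm_comp hρ)
  have hM : ∀ q ∈ U, ∃ e : (E →L[ℝ] ℝ) ≃L[ℝ] E, (e : (E →L[ℝ] ℝ) →L[ℝ] E) = ρ q ∘L S q := by
    intro q hq
    refine exists_equiv_of_injective _ ?_ finrank_dual_eq
    refine (injective_iff_map_eq_zero _).2 fun l hl => ?_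
    have h1 : S q l = 0 := by
      by_contra h0
      have h2 := hp q hq _ h0
      rw [hGS q hq] at h2
      have h3 : ρ q (S q l) = 0 := hl
      simp [h3] at h2
    have h2 := hGS q hq l
    rw [h1, map_zero] at h2
    ext u
    obtain ⟨w, rfl⟩ := hsurj q hq u
    exact (congrArg (fun l => l w) h2).symm
  refine ⟨fun q => S q ∘L (ρ q ∘L S q).inverse,
    hS.clm_comp (contDiffOn_inverse (hρ.clm_comp hS) hM), ?_, ?_⟩
  · intro q hq u
    obtain ⟨e, he⟩ := hM q hq
    have h1 : ∀ l, ρ q (S q l) = e l := fun l => by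
      rw [← ContinuousLinearEquiv.coe_coe e, he]
      rfl
    simp [← he, h1]
  · intro q hq u w hw
    change G q (S q _) w = 0
    rw [hGS q hq]
    simp [hw]

/-- The Koszul formula in coordinates: the Christoffel symbols of the metric, torsion-free
connection for the bracket with structure functions `c`. -/
theorem exists_christoffel (hU : IsOpen U) (hG : ContDiffOn ℝ ∞ G U)
    (hp : ∀ q ∈ U, ∀ v, v ≠ 0 → 0 < G q v v) {ρ : X → F →L[ℝ] X} (hρ : ContDiffOn ℝ ∞ ρ U)
    {c : X → F →L[ℝ] F →L[ℝ] F} (hc : ContDiffOn ℝ ∞ c U) :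
    ∃ Γ : X → F →L[ℝ] F →L[ℝ] F, ContDiffOn ℝ ∞ Γ U ∧ ∀ q ∈ U, ∀ ξ η ζ,
      2 * G q (Γ q ξ η) ζ = fderiv ℝ G q (ρ q ξ) η ζ + fderiv ℝ G q (ρ q η) ξ ζ
        - fderiv ℝ G q (ρ q ζ) ξ η + G q (c q ζ ξ) η + G q (c q ζ η) ξ + G q (c q ξ η) ζ := by
  let T : X → F →L[ℝ] F →L[ℝ] F →L[ℝ] ℝ := fun q => fderiv ℝ G q ∘L ρ q
  let S : X → F →L[ℝ] F →L[ℝ] F →L[ℝ] ℝ := fun q =>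
    ContinuousLinearMap.compL ℝ F F (F →L[ℝ] ℝ) (G q) ∘L c q
  let c₂₃ : (F →L[ℝ] F →L[ℝ] ℝ) →L[ℝ] F →L[ℝ] F →L[ℝ] ℝ :=
    (ContinuousLinearMap.flipₗᵢ ℝ F F ℝ).toContinuousLinearEquiv.toContinuousLinearMap
  let W : X → F →L[ℝ] F →L[ℝ] F →L[ℝ] ℝ := fun q => c₂₃ ∘L (S q).flip
  let T₁ : X → F →L[ℝ] F →L[ℝ] F →L[ℝ] ℝ := fun q => (T q).flip
  let T₂ : X → F →L[ℝ] F →L[ℝ] F →L[ℝ] ℝ := fun q => c₂₃ ∘L T₁ q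
  let W₁ : X → F →L[ℝ] F →L[ℝ] F →L[ℝ] ℝ := fun q => (W q).flip
  let I : X → (F →L[ℝ] F →L[ℝ] ℝ) →L[ℝ] F →L[ℝ] F := fun q =>
    ContinuousLinearMap.compL ℝ F (F →L[ℝ] ℝ) F (G q).inverse
  let Γ : X → F →L[ℝ] F →L[ℝ] F := fun q => (1 / 2 : ℝ) •
    (I q ∘L T q + I q ∘L T₁ q - I q ∘L T₂ q + I q ∘L W q + I q ∘L W₁ q + I q ∘L S q)
  have hΓ : ∀ q ξ η, Γ q ξ η = (1 / 2 : ℝ) • ((G q).inverse (T q ξ η) + (G q).inverse (T₁ q ξ η) -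
    (G q).inverse (T₂ q ξ η) + (G q).inverse (W q ξ η) + (G q).inverse (W₁ q ξ η) +
    (G q).inverse (S q ξ η)) := fun q ξ η => rfl
  have hG' : ContDiffOn ℝ ∞ (fderiv ℝ G) U := hG.fderiv_of_isOpen hU (by simp)
  refine ⟨Γ, ?_, ?_⟩
  · rw [contDiffOn_clm_apply]
    intro ξ
    rw [contDiffOn_clm_apply]
    intro η
    have h0 : ∀ l : X → F →L[ℝ] ℝ, (∀ ζ, ContDiffOn ℝ ∞ (fun q => l q ζ) U) →
        ContDiffOn ℝ ∞ (fun q => (G q).inverse (l q)) U := fun l hl =>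
      ContDiffOn.clm_apply (f := fun q => (G q).inverse)
        (contDiffOn_inverse hG fun q hq => exists_equiv_of_pos (hp q hq))
        (contDiffOn_clm_apply.2 hl)
    have h1 : ∀ x y z : F, ContDiffOn ℝ ∞ (fun q => fderiv ℝ G q (ρ q x) y z) U := fun x y z =>
      ((hG'.clm_apply (hρ.clm_apply contDiffOn_const)).clm_apply contDiffOn_const).clm_apply
        contDiffOn_const
    have h2 : ∀ x y z : F, ContDiffOn ℝ ∞ (fun q => G q (c q x y) z) U := fun x y z =>
      (hG.clm_apply ((hc.clm_apply contDiffOn_const).clm_apply contDiffOn_const)).clm_apply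
        contDiffOn_const
    simp only [hΓ]
    exact ((((((h0 _ fun ζ => h1 ξ η ζ).add (h0 _ fun ζ => h1 η ξ ζ)).sub
      (h0 _ fun ζ => h1 ζ ξ η)).add (h0 _ fun ζ => h2 ζ ξ η)).add (h0 _ fun ζ => h2 ζ η ξ)).add
      (h0 _ fun ζ => h2 ξ η ζ)).const_smul _
  · intro q hq ξ η ζ
    have hI := apply_inverse_of_pos (hp q hq)
    rw [hΓ, map_smul]
    simp only [map_add, map_sub, hI]
    change 2 * ((1 / 2 : ℝ) * (fderiv ℝ G q (ρ q ξ) η ζ + fderiv ℝ G q (ρ q η) ξ ζ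
      - fderiv ℝ G q (ρ q ζ) ξ η + G q (c q ζ ξ) η + G q (c q ζ η) ξ + G q (c q ξ η) ζ)) = _
    ring

end Families

/-! ### Transitive Riemannian Lie algebroids in coordinates -/

/-- A transitive Riemannian Lie algebroid with fibre `F` over an open set of `E`, in a
trivialization: the metric `G`, the anchor `ρ`, the structure functions `c` (the brackets of the
constant sections), the Christoffel symbols `Γ` of the Levi-Civita connection and the horizontal
lift `h`. -/
structure AlgebroidChart (E F : Type*) [NormedAddCommGroup E] [NormedSpace ℝ E]
    [NormedAddCommGroup F] [NormedSpace ℝ F] where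
  U : Set E
  isOpen : IsOpen U
  G : E → F →L[ℝ] F →L[ℝ] ℝ
  ρ : E → F →L[ℝ] E
  c : E → F →L[ℝ] F →L[ℝ] F
  Γ : E → F →L[ℝ] F →L[ℝ] F
  h : E → E →L[ℝ] F
  contDiffOn_G : ContDiffOn ℝ ∞ G U
  contDiffOn_ρ : ContDiffOn ℝ ∞ ρ U
  contDiffOn_c : ContDiffOn ℝ ∞ c U
  contDiffOn_Γ : ContDiffOn ℝ ∞ Γ U
  contDiffOn_h : ContDiffOn ℝ ∞ h U
  G_symm : ∀ q ∈ U, ∀ v w, G q v w = G q w v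
  G_pos : ∀ q ∈ U, ∀ v, v ≠ 0 → 0 < G q v v
  c_skew : ∀ q ∈ U, ∀ ξ η, c q ξ η = - c q η ξ
  anchor_c : ∀ q ∈ U, ∀ ξ η, ρ q (c q ξ η) = fderiv ℝ ρ q (ρ q ξ) η - fderiv ℝ ρ q (ρ q η) ξ
  jacobi : ∀ q ∈ U, ∀ ξ η ζ,
    c q ξ (c q η ζ) + c q η (c q ζ ξ) + c q ζ (c q ξ η) + fderiv ℝ c q (ρ q ξ) η ζ
      + fderiv ℝ c q (ρ q η) ζ ξ + fderiv ℝ c q (ρ q ζ) ξ η = 0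
  metric : ∀ q ∈ U, ∀ ξ η ζ, fderiv ℝ G q (ρ q ξ) η ζ = G q (Γ q ξ η) ζ + G q η (Γ q ξ ζ)
  torsion : ∀ q ∈ U, ∀ ξ η, Γ q ξ η - Γ q η ξ = c q ξ η
  ρ_h : ∀ q ∈ U, ∀ u, ρ q (h q u) = u
  G_h : ∀ q ∈ U, ∀ u w, ρ q w = 0 → G q (h q u) w = 0

namespace AlgebroidChart

variable {E F : Type*} [NormedAddCommGroup E] [NormedSpace ℝ E] [FiniteDimensional ℝ E]
  [NormedAddCommGroup F] [NormedSpace ℝ F] [FiniteDimensional ℝ F] (𝒞 : AlgebroidChart E F)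

variable {𝒞} {q : E}

theorem hasFDerivAt_G (hq : q ∈ 𝒞.U) : HasFDerivAt 𝒞.G (fderiv ℝ 𝒞.G q) q :=
  (((𝒞.contDiffOn_G).contDiffAt (𝒞.isOpen.mem_nhds hq)).differentiableAt (by simp)).hasFDerivAt

theorem hasFDerivAt_ρ (hq : q ∈ 𝒞.U) : HasFDerivAt 𝒞.ρ (fderiv ℝ 𝒞.ρ q) q :=
  (((𝒞.contDiffOn_ρ).contDiffAt (𝒞.isOpen.mem_nhds hq)).differentiableAt (by simp)).hasFDerivAt

theorem hasFDerivAt_c (hq : q ∈ 𝒞.U) : HasFDerivAt 𝒞.c (fderiv ℝ 𝒞.c q) q :=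
  (((𝒞.contDiffOn_c).contDiffAt (𝒞.isOpen.mem_nhds hq)).differentiableAt (by simp)).hasFDerivAt

theorem hasFDerivAt_Γ (hq : q ∈ 𝒞.U) : HasFDerivAt 𝒞.Γ (fderiv ℝ 𝒞.Γ q) q :=
  (((𝒞.contDiffOn_Γ).contDiffAt (𝒞.isOpen.mem_nhds hq)).differentiableAt (by simp)).hasFDerivAt

theorem hasFDerivAt_h (hq : q ∈ 𝒞.U) : HasFDerivAt 𝒞.h (fderiv ℝ 𝒞.h q) q :=
  (((𝒞.contDiffOn_h).contDiffAt (𝒞.isOpen.mem_nhds hq)).differentiableAt (by simp)).hasFDerivAt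

theorem hasFDerivAt_fderiv_ρ (hq : q ∈ 𝒞.U) :
    HasFDerivAt (fderiv ℝ 𝒞.ρ) (fderiv ℝ (fderiv ℝ 𝒞.ρ) q) q :=
  (((𝒞.contDiffOn_ρ).fderiv_of_isOpen (m := ∞) 𝒞.isOpen (by simp)).contDiffAt
    (𝒞.isOpen.mem_nhds hq) |>.differentiableAt (by simp)).hasFDerivAt

/-- Differentiating `ρ h = 1`. -/
theorem fderiv_ρ_h (hq : q ∈ 𝒞.U) (v u : E) :
    fderiv ℝ 𝒞.ρ q v (𝒞.h q u) + 𝒞.ρ q (fderiv ℝ 𝒞.h q v u) = 0 := by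
  have h1 : HasFDerivAt (fun p => 𝒞.ρ p (𝒞.h p u))
      (0 : E →L[ℝ] E) q := by
    refine (hasFDerivAt_const u q).congr_of_eventuallyEq ?_
    filter_upwards [𝒞.isOpen.mem_nhds hq] with p hp using 𝒞.ρ_h p hp u
  have h2 := (hasFDerivAt_ρ hq).clm_apply ((hasFDerivAt_h hq).clm_apply (hasFDerivAt_const u q))
  have h3 := congrArg (fun l : E →L[ℝ] E => l v) (h2.unique h1)
  simpa [add_comm] using h3

/-- Differentiating the anchor identity. -/
theorem fderiv_anchor_c (hq : q ∈ 𝒞.U) (u : E) (ζ η : F) :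
    fderiv ℝ 𝒞.ρ q u (𝒞.c q ζ η) + 𝒞.ρ q (fderiv ℝ 𝒞.c q u ζ η) =
      fderiv ℝ (fderiv ℝ 𝒞.ρ) q u (𝒞.ρ q ζ) η + fderiv ℝ 𝒞.ρ q (fderiv ℝ 𝒞.ρ q u ζ) η
      - (fderiv ℝ (fderiv ℝ 𝒞.ρ) q u (𝒞.ρ q η) ζ + fderiv ℝ 𝒞.ρ q (fderiv ℝ 𝒞.ρ q u η) ζ) := by
  have h1 := (hasFDerivAt_ρ hq).clm_apply
    (((hasFDerivAt_c hq).clm_apply (hasFDerivAt_const ζ q)).clm_apply (hasFDerivAt_const η q))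
  have h2 : ∀ ζ η : F, HasFDerivAt (fun p => fderiv ℝ 𝒞.ρ p (𝒞.ρ p ζ) η) _ q := fun ζ η =>
    ((hasFDerivAt_fderiv_ρ hq).clm_apply ((hasFDerivAt_ρ hq).clm_apply
      (hasFDerivAt_const ζ q))).clm_apply (hasFDerivAt_const η q)
  have h3 := h1.congr_of_eventuallyEq (f₁ := fun p => fderiv ℝ 𝒞.ρ p (𝒞.ρ p ζ) η -
    fderiv ℝ 𝒞.ρ p (𝒞.ρ p η) ζ) (by
      filter_upwards [𝒞.isOpen.mem_nhds hq] with p hp using (𝒞.anchor_c p hp ζ η).symm)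
  have h4 := congrArg (fun l : E →L[ℝ] E => l u) (h3.unique ((h2 ζ η).fun_sub (h2 η ζ)))
  simp at h4
  rw [← add_comm (𝒞.ρ q _), h4]
  abel

theorem fderiv_fderiv_ρ_symm (hq : q ∈ 𝒞.U) (u v : E) :
    fderiv ℝ (fderiv ℝ 𝒞.ρ) q u v = fderiv ℝ (fderiv ℝ 𝒞.ρ) q v u :=
  ((𝒞.contDiffOn_ρ).contDiffAt (𝒞.isOpen.mem_nhds hq)).isSymmSndFDerivAt (by
    rw [minSmoothness_of_isRCLikeNormedField]
    exact WithTop.coe_le_coe.2 (le_top (a := (2 : ℕ∞)))) u v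

/-! #### The Sasaki metric and the geodesic field -/

variable (𝒞) in
/-- The connection map `(u, w) ↦ w + Γ(h u, ξ)`. -/
def connMap (p : E × F) : E × F →L[ℝ] F :=
  ContinuousLinearMap.snd ℝ E F + ((𝒞.Γ p.1).flip p.2) ∘L 𝒞.h p.1 ∘L ContinuousLinearMap.fst ℝ E F

variable (𝒞) in
/-- The product metric `G(h u, h u') + G(w, w')`. -/
def productForm (q : E) : E × F →L[ℝ] E × F →L[ℝ] ℝ :=
  (𝒞.G q).bilinearComp (𝒞.h q ∘L ContinuousLinearMap.fst ℝ E F)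
    (𝒞.h q ∘L ContinuousLinearMap.fst ℝ E F) +
  (𝒞.G q).bilinearComp (ContinuousLinearMap.snd ℝ E F) (ContinuousLinearMap.snd ℝ E F)

theorem productForm_apply (q : E) (z w : E × F) :
    𝒞.productForm q z w = 𝒞.G q (𝒞.h q z.1) (𝒞.h q w.1) + 𝒞.G q z.2 w.2 := rfl

variable (𝒞) in
/-- The Sasaki metric `G(h u, h u') + G(w + Γ(h u, ξ), w' + Γ(h u', ξ))`. -/
def sasakiForm (p : E × F) : E × F →L[ℝ] E × F →L[ℝ] ℝ :=
  (𝒞.G p.1).bilinearComp (𝒞.h p.1 ∘L ContinuousLinearMap.fst ℝ E F)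
    (𝒞.h p.1 ∘L ContinuousLinearMap.fst ℝ E F) +
  (𝒞.G p.1).bilinearComp (𝒞.connMap p) (𝒞.connMap p)

theorem sasakiForm_apply (p z w : E × F) :
    𝒞.sasakiForm p z w = 𝒞.G p.1 (𝒞.h p.1 z.1) (𝒞.h p.1 w.1) +
      𝒞.G p.1 (z.2 + 𝒞.Γ p.1 (𝒞.h p.1 z.1) p.2) (w.2 + 𝒞.Γ p.1 (𝒞.h p.1 w.1) p.2) := rfl

theorem differentiableAt_sasakiForm (hq : q ∈ 𝒞.U) (ξ : F) :
    DifferentiableAt ℝ 𝒞.sasakiForm (q, ξ) := by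
  have hU : IsOpen (𝒞.U ×ˢ (univ : Set F)) := 𝒞.isOpen.prod isOpen_univ
  have hf : MapsTo (Prod.fst : E × F → E) (𝒞.U ×ˢ (univ : Set F)) 𝒞.U := fun p hp => hp.1
  have hG : ContDiffOn ℝ ∞ (fun p : E × F => 𝒞.G p.1) (𝒞.U ×ˢ univ) :=
    𝒞.contDiffOn_G.comp contDiff_fst.contDiffOn hf
  have hh : ContDiffOn ℝ ∞ (fun p : E × F => 𝒞.h p.1) (𝒞.U ×ˢ univ) :=
    𝒞.contDiffOn_h.comp contDiff_fst.contDiffOn hf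
  have hΓ : ContDiffOn ℝ ∞ (fun p : E × F => 𝒞.Γ p.1) (𝒞.U ×ˢ univ) :=
    𝒞.contDiffOn_Γ.comp contDiff_fst.contDiffOn hf
  have h1 : ContDiffOn ℝ ∞ 𝒞.sasakiForm (𝒞.U ×ˢ univ) := by
    rw [contDiffOn_clm_apply]
    intro z
    rw [contDiffOn_clm_apply]
    intro w
    simp only [sasakiForm_apply]
    have h2 : ∀ z : E × F, ContDiffOn ℝ ∞ (fun p : E × F => z.2 + 𝒞.Γ p.1 (𝒞.h p.1 z.1) p.2)
        (𝒞.U ×ˢ univ) := fun z => contDiffOn_const.add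
      ((hΓ.clm_apply (hh.clm_apply contDiffOn_const)).clm_apply contDiff_snd.contDiffOn)
    exact ((hG.clm_apply (hh.clm_apply contDiffOn_const)).clm_apply
      (hh.clm_apply contDiffOn_const)).add ((hG.clm_apply (h2 z)).clm_apply (h2 w))
  exact (h1.contDiffAt (hU.mem_nhds ⟨hq, mem_univ _⟩)).differentiableAt (by simp)

theorem sasakiForm_symm (hq : q ∈ 𝒞.U) (ξ : F) (z w : E × F) :
    𝒞.sasakiForm (q, ξ) z w = 𝒞.sasakiForm (q, ξ) w z := by
  rw [sasakiForm_apply, sasakiForm_apply, 𝒞.G_symm q hq (𝒞.h q z.1)]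
  congr 1
  exact 𝒞.G_symm q hq _ _

theorem sasakiForm_pos (hq : q ∈ 𝒞.U) (ξ : F) (z : E × F) (hz : z ≠ 0) :
    0 < 𝒞.sasakiForm (q, ξ) z z := by
  have hnn : ∀ v, 0 ≤ 𝒞.G q v v := fun v => by
    by_cases h : v = 0
    · simp [h]
    · exact (𝒞.G_pos q hq v h).le
  rw [sasakiForm_apply]
  by_cases h1 : z.1 = 0
  · have h2 : z.2 ≠ 0 := fun h2 => hz (Prod.ext h1 h2)
    simpa [h1] using 𝒞.G_pos q hq _ h2
  · refine add_pos_of_pos_of_nonneg (𝒞.G_pos q hq _ fun h0 => h1 ?_) (hnn _)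
    rw [← 𝒞.ρ_h q hq z.1]
    simp only at h0
    rw [h0, map_zero]

/-- The Sasaki metric is the pullback of the product metric by a shear, which has
determinant one. -/
theorem det_sasakiForm {n : Type*} [Fintype n] [DecidableEq n] (e : Module.Basis n ℝ (E × F))
    (p : E × F) :
    (gramMatrix e (𝒞.sasakiForm p)).det = (gramMatrix e (𝒞.productForm p.1)).det := by
  have h1 := det_gram_comp e (𝒞.productForm p.1) ((LinearMap.fst ℝ E F).prod
    (LinearMap.snd ℝ E F + (((𝒞.Γ p.1).flip p.2) ∘L 𝒞.h p.1).toLinearMap ∘ₗ LinearMap.fst ℝ E F))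
  rw [det_shear_sq, one_mul] at h1
  rw [← h1]
  rfl

variable (𝒞) in
/-- The geodesic vector field `(ρ ξ, -Γ(ξ, ξ))`. -/
def geodesicField (p : E × F) : E × F := (𝒞.ρ p.1 p.2, - 𝒞.Γ p.1 p.2 p.2)

theorem contDiffAt_geodesicField (hq : q ∈ 𝒞.U) (ξ : F) :
    ContDiffAt ℝ ∞ 𝒞.geodesicField (q, ξ) := by
  have hU := 𝒞.isOpen.mem_nhds hq
  have hρ : ContDiffAt ℝ ∞ (fun p : E × F => 𝒞.ρ p.1) (q, ξ) :=
    (𝒞.contDiffOn_ρ.contDiffAt hU).comp (q, ξ) contDiffAt_fst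
  have hΓ : ContDiffAt ℝ ∞ (fun p : E × F => 𝒞.Γ p.1) (q, ξ) :=
    (𝒞.contDiffOn_Γ.contDiffAt hU).comp (q, ξ) contDiffAt_fst
  exact (hρ.clm_apply contDiffAt_snd).prodMk
    ((hΓ.clm_apply contDiffAt_snd).clm_apply contDiffAt_snd).neg

theorem hasFDerivAt_geodesicField (hq : q ∈ 𝒞.U) (ξ : F) :
    ∃ X' : E × F →L[ℝ] E × F, HasFDerivAt 𝒞.geodesicField X' (q, ξ) ∧ ∀ z, X' z =
      (fderiv ℝ 𝒞.ρ q z.1 ξ + 𝒞.ρ q z.2,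
        -(fderiv ℝ 𝒞.Γ q z.1 ξ ξ + 𝒞.Γ q z.2 ξ + 𝒞.Γ q ξ z.2)) := by
  have h1 : HasFDerivAt (Prod.fst : E × F → E) (ContinuousLinearMap.fst ℝ E F) (q, ξ) :=
    hasFDerivAt_fst
  have h2 : HasFDerivAt (Prod.snd : E × F → F) (ContinuousLinearMap.snd ℝ E F) (q, ξ) :=
    hasFDerivAt_snd
  have hρ : HasFDerivAt (fun p : E × F => 𝒞.ρ p.1) (fderiv ℝ 𝒞.ρ q ∘L .fst ℝ E F) (q, ξ) :=
    HasFDerivAt.comp (q, ξ) (hasFDerivAt_ρ (q := (q, ξ).1) hq) h1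
  have hΓ : HasFDerivAt (fun p : E × F => 𝒞.Γ p.1) (fderiv ℝ 𝒞.Γ q ∘L .fst ℝ E F) (q, ξ) :=
    HasFDerivAt.comp (q, ξ) (hasFDerivAt_Γ (q := (q, ξ).1) hq) h1
  refine ⟨_, (hρ.clm_apply h2).prodMk ((hΓ.clm_apply h2).clm_apply h2).neg, fun z => ?_⟩
  ext <;> simp
  · abel
  · abel

theorem differentiableAt_productForm (hq : q ∈ 𝒞.U) : DifferentiableAt ℝ 𝒞.productForm q := by
  have h1 : ContDiffOn ℝ ∞ 𝒞.productForm 𝒞.U := by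
    rw [contDiffOn_clm_apply]
    intro z
    rw [contDiffOn_clm_apply]
    intro w
    have hG := 𝒞.contDiffOn_G
    have hh := 𝒞.contDiffOn_h
    exact ((hG.clm_apply (hh.clm_apply contDiffOn_const)).clm_apply
      (hh.clm_apply contDiffOn_const)).add
      ((hG.clm_apply contDiffOn_const).clm_apply contDiffOn_const)
  exact (h1.contDiffAt (𝒞.isOpen.mem_nhds hq)).differentiableAt (by simp)

/-- Since the vector `v - h ρ v` is vertical, `G(v, h u) = G(h ρ v, h u)`. -/
theorem G_horizontal (hq : q ∈ 𝒞.U) (v : F) (u : E) :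
    𝒞.G q v (𝒞.h q u) = 𝒞.G q (𝒞.h q (𝒞.ρ q v)) (𝒞.h q u) := by
  have h1 := 𝒞.G_h q hq u (v - 𝒞.h q (𝒞.ρ q v)) (by rw [map_sub, 𝒞.ρ_h q hq, sub_self])
  rw [map_sub, sub_eq_zero] at h1
  rw [𝒞.G_symm q hq v, h1, 𝒞.G_symm q hq]

/-- The derivative of the product metric along the anchor of `ξ`. -/
theorem fderiv_productForm (hq : q ∈ 𝒞.U) (ξ : F) (z w : E × F) :
    fderiv ℝ 𝒞.productForm q (𝒞.ρ q ξ) z w =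
      𝒞.productForm q (𝒞.ρ q (𝒞.Γ q ξ (𝒞.h q z.1) + fderiv ℝ 𝒞.h q (𝒞.ρ q ξ) z.1), 𝒞.Γ q ξ z.2) w
      + 𝒞.productForm q z
        (𝒞.ρ q (𝒞.Γ q ξ (𝒞.h q w.1) + fderiv ℝ 𝒞.h q (𝒞.ρ q ξ) w.1), 𝒞.Γ q ξ w.2) := by
  have h1 := ((differentiableAt_productForm hq).hasFDerivAt.clm_apply
    (hasFDerivAt_const z q)).clm_apply (hasFDerivAt_const w q)
  have hG := hasFDerivAt_G hq
  have hh := hasFDerivAt_h hq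
  have h2 := ((hG.clm_apply (hh.clm_apply (hasFDerivAt_const z.1 q))).clm_apply
      (hh.clm_apply (hasFDerivAt_const w.1 q))).fun_add
      ((hG.clm_apply (hasFDerivAt_const z.2 q)).clm_apply (hasFDerivAt_const w.2 q))
  have h3 := congrArg (fun l : E →L[ℝ] ℝ => l (𝒞.ρ q ξ)) (h1.unique h2)
  simp [𝒞.metric q hq] at h3
  rw [h3, productForm_apply, productForm_apply]
  simp only
  rw [← G_horizontal hq, 𝒞.G_symm q hq (𝒞.h q z.1) (𝒞.h q _), ← G_horizontal hq,
    𝒞.G_symm q hq _ (𝒞.h q z.1)]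
  simp only [map_add, add_apply]
  ring

/-- The divergence of the geodesic field is minus the trace of the covariant derivative of `ξ`
in the vertical directions: the horizontal contributions cancel. -/
theorem trace_geodesicField_add (hq : q ∈ 𝒞.U) (ξ : F) :
    ∃ (X' : E × F →L[ℝ] E × F) (D : E × F →L[ℝ] ℝ),
      HasFDerivAt 𝒞.geodesicField X' (q, ξ) ∧
      HasFDerivAt (fun p => (gramMatrix (Module.finBasis ℝ (E × F)) (𝒞.sasakiForm p)).det) D
        (q, ξ) ∧
      LinearMap.trace ℝ (E × F) X'.toLinearMap + D (𝒞.geodesicField (q, ξ)) /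
        (2 * (gramMatrix (Module.finBasis ℝ (E × F)) (𝒞.sasakiForm (q, ξ))).det) =
      - LinearMap.trace ℝ F (((𝒞.Γ q).flip ξ).toLinearMap ∘ₗ
          (LinearMap.id - (𝒞.h q).toLinearMap ∘ₗ (𝒞.ρ q).toLinearMap)) := by
  obtain ⟨X', hX', hX'z⟩ := hasFDerivAt_geodesicField hq ξ
  obtain ⟨D, hD, hDS⟩ := hasFDerivAt_det_gramMatrix (Module.finBasis ℝ (E × F))
    (differentiableAt_productForm hq).hasFDerivAt
  have h1 : HasFDerivAt (Prod.fst : E × F → E) (ContinuousLinearMap.fst ℝ E F) (q, ξ) :=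
    hasFDerivAt_fst
  refine ⟨X', D ∘L .fst ℝ E F, hX', ?_, ?_⟩
  · simp only [det_sasakiForm]
    exact HasFDerivAt.comp (q, ξ) (f := Prod.fst) (g := fun q =>
      (gramMatrix (Module.finBasis ℝ (E × F)) (𝒞.productForm q)).det) hD h1
  · have hdet : 0 < (gramMatrix (Module.finBasis ℝ (E × F)) (𝒞.sasakiForm (q, ξ))).det :=
      det_gramMatrix_pos _ (sasakiForm_symm hq ξ) (sasakiForm_pos hq ξ)
    rw [det_sasakiForm] at hdet ⊢
    -- `S₁` and `V` are half the logarithmic derivatives of the metrics of the leaf and of the fibre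
    let R : E →ₗ[ℝ] E := ((fderiv ℝ 𝒞.ρ q).flip ξ).toLinearMap
    let W : F →ₗ[ℝ] F := ((𝒞.Γ q).flip ξ).toLinearMap
    let V : F →ₗ[ℝ] F := (𝒞.Γ q ξ).toLinearMap
    let S₁ : E →ₗ[ℝ] E := (𝒞.ρ q).toLinearMap ∘ₗ W ∘ₗ (𝒞.h q).toLinearMap - R
    have hS₁ : ∀ u, 𝒞.ρ q (𝒞.Γ q ξ (𝒞.h q u) + fderiv ℝ 𝒞.h q (𝒞.ρ q ξ) u) = S₁ u := by
      intro u
      have e1 := fderiv_ρ_h hq (𝒞.ρ q ξ) u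
      have e2 := congrArg (𝒞.ρ q) (𝒞.torsion q hq ξ (𝒞.h q u))
      rw [𝒞.anchor_c q hq, 𝒞.ρ_h q hq, map_sub] at e2
      change _ = 𝒞.ρ q (𝒞.Γ q (𝒞.h q u) ξ) - fderiv ℝ 𝒞.ρ q u ξ
      rw [map_add, eq_neg_of_add_eq_zero_right e1, sub_eq_iff_eq_add.1 e2]
      abel
    have hDX := hDS (𝒞.ρ q ξ) (S₁.prodMap V) (by
      intro z w
      rw [fderiv_productForm hq, hS₁, hS₁]
      rfl)
    have htr : LinearMap.trace ℝ (E × F) (S₁.prodMap V) =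
        LinearMap.trace ℝ E S₁ + LinearMap.trace ℝ F V := by
      rw [trace_prod_eq]
      rfl
    have htX : LinearMap.trace ℝ (E × F) X'.toLinearMap =
        LinearMap.trace ℝ E R - (LinearMap.trace ℝ F W + LinearMap.trace ℝ F V) := by
      rw [trace_prod_eq, sub_eq_add_neg, ← map_add, ← map_neg]
      congr 2
      · ext x
        simp [hX'z, R]
      · ext x
        simp [hX'z, W, V]
    -- the traces of `R` and `V` cancel, and that of `S₁` leaves the horizontal part of
    -- the trace of `W`
    have hc : LinearMap.trace ℝ F (W ∘ₗ (𝒞.h q).toLinearMap ∘ₗ (𝒞.ρ q).toLinearMap) =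
        LinearMap.trace ℝ E ((𝒞.ρ q).toLinearMap ∘ₗ W ∘ₗ (𝒞.h q).toLinearMap) := by
      rw [← LinearMap.comp_assoc, LinearMap.trace_comp_comm']
    have hDX' : (D ∘L .fst ℝ E F) (𝒞.geodesicField (q, ξ)) = D (𝒞.ρ q ξ) := rfl
    rw [hDX', hDX, htr, htX, mul_div_mul_right _ _ hdet.ne', mul_div_cancel_left₀ _ two_ne_zero,
      LinearMap.comp_sub, LinearMap.comp_id, map_sub, map_sub]
    change _ = -(_ - LinearMap.trace ℝ F (W ∘ₗ (𝒞.h q).toLinearMap ∘ₗ (𝒞.ρ q).toLinearMap))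
    rw [hc]
    ring

/-! #### The modular form -/

variable (E) in
/-- The trace as a continuous linear form. -/
def traceCLM : (E →L[ℝ] E) →L[ℝ] ℝ :=
  LinearMap.toContinuousLinearMap (LinearMap.trace ℝ E ∘ₗ ContinuousLinearMap.coeLM ℝ)

theorem traceCLM_apply (f : E →L[ℝ] E) : traceCLM E f = LinearMap.trace ℝ E f.toLinearMap := rfl

theorem traceCLM_comp_comm {E' : Type*} [NormedAddCommGroup E'] [NormedSpace ℝ E']
    [FiniteDimensional ℝ E'] (f : E →L[ℝ] E') (g : E' →L[ℝ] E) :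
    traceCLM E (g ∘L f) = traceCLM E' (f ∘L g) :=
  LinearMap.trace_comp_comm' f.toLinearMap g.toLinearMap

variable (𝒞) in
/-- The modular form `ξ ↦ Tr c(ξ, ·) + Tr ∂ρ(·)ξ`. -/
def modularForm (q : E) : F →L[ℝ] ℝ :=
  traceCLM F ∘L 𝒞.c q + traceCLM E ∘L (fderiv ℝ 𝒞.ρ q).flip

theorem modularForm_apply (q : E) (ξ : F) :
    𝒞.modularForm q ξ = traceCLM F (𝒞.c q ξ) + traceCLM E ((fderiv ℝ 𝒞.ρ q).flip ξ) := rfl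

/-- On vertical vectors the modular form is the trace of the adjoint representation. -/
theorem modularForm_eq_trace_restrict (hq : q ∈ 𝒞.U) (η : F) (hη : 𝒞.ρ q η = 0)
    (hf : ∀ w ∈ LinearMap.ker (𝒞.ρ q).toLinearMap,
      (𝒞.c q η).toLinearMap w ∈ LinearMap.ker (𝒞.ρ q).toLinearMap) :
    𝒞.modularForm q η = LinearMap.trace ℝ _ ((𝒞.c q η).toLinearMap.restrict hf) := by
  have h := trace_eq_trace_restrict_add (r := (𝒞.ρ q).toLinearMap) (h := (𝒞.h q).toLinearMap)
    (f := (𝒞.c q η).toLinearMap) (g := -((fderiv ℝ 𝒞.ρ q).flip η).toLinearMap)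
    (𝒞.ρ_h q hq) (fun w => by
      have := 𝒞.anchor_c q hq η w
      rw [hη] at this
      simpa using this) hf
  rw [modularForm_apply, traceCLM_apply, traceCLM_apply, h, map_neg]
  ring

/-- The modular form is closed. -/
theorem hasFDerivAt_modularForm (hq : q ∈ 𝒞.U) :
    ∃ M' : E →L[ℝ] F →L[ℝ] ℝ, HasFDerivAt 𝒞.modularForm M' q ∧ ∀ ζ η,
      M' (𝒞.ρ q ζ) η - M' (𝒞.ρ q η) ζ = 𝒞.modularForm q (𝒞.c q ζ η) := by
  have hd : DifferentiableAt ℝ 𝒞.modularForm q := by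
    have h1 : ContDiffOn ℝ ∞ 𝒞.modularForm 𝒞.U := by
      rw [contDiffOn_clm_apply]
      intro ξ
      simp only [modularForm_apply]
      have h2 : ContDiffOn ℝ ∞ (fun p => (fderiv ℝ 𝒞.ρ p).flip ξ) 𝒞.U := by
        rw [contDiffOn_clm_apply]
        intro u
        exact ((𝒞.contDiffOn_ρ.fderiv_of_isOpen (m := ∞) 𝒞.isOpen (by simp)).clm_apply
          contDiffOn_const).clm_apply contDiffOn_const
      exact (contDiffOn_const.clm_apply (𝒞.contDiffOn_c.clm_apply contDiffOn_const)).add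
        (contDiffOn_const.clm_apply h2)
    exact (h1.contDiffAt (𝒞.isOpen.mem_nhds hq)).differentiableAt (by simp)
  let Q : E → F → E →L[ℝ] E := fun v η => (fderiv ℝ (fderiv ℝ 𝒞.ρ) q v).flip η
  have hM : ∀ v η, fderiv ℝ 𝒞.modularForm q v η =
      traceCLM F (fderiv ℝ 𝒞.c q v η) + traceCLM E (Q v η) := by
    intro v η
    have h1 := hd.hasFDerivAt.clm_apply (hasFDerivAt_const η q)
    have h2 : HasFDerivAt (fun p => (fderiv ℝ 𝒞.ρ p).flip η)
        (((ContinuousLinearMap.flipₗᵢ ℝ E F E).toContinuousLinearEquiv.toContinuousLinearMap ∘L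
          fderiv ℝ (fderiv ℝ 𝒞.ρ) q).flip η) q :=
      (((ContinuousLinearMap.flipₗᵢ ℝ E F E).toContinuousLinearEquiv.hasFDerivAt.comp q
        (hasFDerivAt_fderiv_ρ hq)).clm_apply (hasFDerivAt_const η q)).congr_fderiv (by ext; simp)
    have h3 := ((hasFDerivAt_const (traceCLM F) q).clm_apply
      ((hasFDerivAt_c hq).clm_apply (hasFDerivAt_const η q))).fun_add
      ((hasFDerivAt_const (traceCLM E) q).clm_apply h2)
    have h4 := congrArg (fun l : E →L[ℝ] ℝ => l v) (h1.unique h3)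
    simpa [Q] using! h4
  refine ⟨_, hd.hasFDerivAt, fun ζ η => ?_⟩
  rw [hM, hM, modularForm_apply]
  let Cw : E →L[ℝ] F := ((fderiv ℝ 𝒞.c q).flip ζ).flip η
  let R : F → E →L[ℝ] E := fun ξ => (fderiv ℝ 𝒞.ρ q).flip ξ
  -- the trace of the Jacobi identity
  have e1 : 𝒞.c q ζ ∘L 𝒞.c q η - 𝒞.c q η ∘L 𝒞.c q ζ - 𝒞.c q (𝒞.c q ζ η)
      + fderiv ℝ 𝒞.c q (𝒞.ρ q ζ) η - fderiv ℝ 𝒞.c q (𝒞.ρ q η) ζ + Cw ∘L 𝒞.ρ q = 0 := by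
    ext x
    have h1 := 𝒞.jacobi q hq ζ η x
    have h2 : ∀ v, fderiv ℝ 𝒞.c q v x ζ = - fderiv ℝ 𝒞.c q v ζ x := by
      intro v
      have h3 := ((hasFDerivAt_c hq).clm_apply (hasFDerivAt_const x q)).clm_apply
        (hasFDerivAt_const ζ q)
      have h4 := (((hasFDerivAt_c hq).clm_apply (hasFDerivAt_const ζ q)).clm_apply
        (hasFDerivAt_const x q)).fun_neg
      have h5 := h3.unique (h4.congr_of_eventuallyEq (by
        filter_upwards [𝒞.isOpen.mem_nhds hq] with p hp using 𝒞.c_skew p hp x ζ))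
      simpa using! congrArg (fun l : E →L[ℝ] F => l v) h5
    rw [𝒞.c_skew q hq x ζ, 𝒞.c_skew q hq x, h2, map_neg] at h1
    simp only [add_apply, sub_apply, ContinuousLinearMap.comp_apply, zero_apply]
    rw [← h1]
    change _ + fderiv ℝ 𝒞.c q (𝒞.ρ q x) ζ η = _
    abel
  -- the trace of the derivative of the anchor identity
  have e2 : R (𝒞.c q ζ η) + 𝒞.ρ q ∘L Cw = Q (𝒞.ρ q ζ) η + R η ∘L R ζ
      - (Q (𝒞.ρ q η) ζ + R ζ ∘L R η) := by
    ext u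
    have h1 := fderiv_anchor_c hq u ζ η
    rw [fderiv_fderiv_ρ_symm hq u, fderiv_fderiv_ρ_symm hq u] at h1
    exact h1
  have t1 := congrArg (traceCLM F) e1
  have t2 := congrArg (traceCLM E) e2
  simp only [map_add, map_sub, map_zero] at t1 t2
  rw [traceCLM_comp_comm (𝒞.c q η) (𝒞.c q ζ), traceCLM_comp_comm (𝒞.ρ q) Cw] at t1
  rw [traceCLM_comp_comm (R η) (R ζ)] at t2
  change _ = _ + traceCLM E (R (𝒞.c q ζ η))
  linarith

variable (𝒞) in
/-- The projection `1 - h ρ` to the kernel of the anchor. -/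
def vertProj (q : E) : F →L[ℝ] F := ContinuousLinearMap.id ℝ F - 𝒞.h q ∘L 𝒞.ρ q

theorem vertProj_apply (q : E) (w : F) : 𝒞.vertProj q w = w - 𝒞.h q (𝒞.ρ q w) := rfl

theorem ρ_vertProj (hq : q ∈ 𝒞.U) (w : F) : 𝒞.ρ q (𝒞.vertProj q w) = 0 := by
  rw [vertProj_apply, map_sub, 𝒞.ρ_h q hq, sub_self]

theorem vertProj_of_ρ_eq_zero {w : F} (hw : 𝒞.ρ q w = 0) : 𝒞.vertProj q w = w := by
  rw [vertProj_apply, hw, map_zero, sub_zero]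

theorem contDiffOn_vertProj : ContDiffOn ℝ ∞ 𝒞.vertProj 𝒞.U :=
  contDiffOn_const.sub (𝒞.contDiffOn_h.clm_comp 𝒞.contDiffOn_ρ)

variable (𝒞) in
/-- The modular form of the isotropy: the form `w ↦ Tr ad_w` on the kernel of the anchor,
extended by zero to its orthogonal. -/
def isotropyModularForm (q : E) : F →L[ℝ] ℝ := 𝒞.modularForm q ∘L 𝒞.vertProj q

variable (𝒞) in
/-- The covariant derivative of the vertical component of the constant section `η`, as an
endomorphism depending on the direction `u`. -/
def vertTransport (q : E) : E →L[ℝ] F →L[ℝ] F :=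
  (ContinuousLinearMap.compL ℝ F F F).flip (𝒞.vertProj q) ∘L 𝒞.c q ∘L 𝒞.h q +
    fderiv ℝ 𝒞.vertProj q

theorem vertTransport_apply (q u : E) (η : F) : 𝒞.vertTransport q u η =
    𝒞.c q (𝒞.h q u) (𝒞.vertProj q η) + fderiv ℝ 𝒞.vertProj q u η := rfl

/-- The modular form of the isotropy is parallel for the connection induced by the brackets with
horizontal sections. -/
theorem hasFDerivAt_isotropyModularForm (hq : q ∈ 𝒞.U) :
    ∃ M' : E →L[ℝ] F →L[ℝ] ℝ, HasFDerivAt 𝒞.isotropyModularForm M' q ∧ ∀ u,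
      M' u = 𝒞.isotropyModularForm q ∘L 𝒞.vertTransport q u := by
  obtain ⟨M', hM', hclosed⟩ := hasFDerivAt_modularForm hq
  have hP : HasFDerivAt 𝒞.vertProj (fderiv ℝ 𝒞.vertProj q) q :=
    ((contDiffOn_vertProj.contDiffAt (𝒞.isOpen.mem_nhds hq)).differentiableAt
      (by simp)).hasFDerivAt
  refine ⟨_, hM'.clm_comp hP, fun u => ?_⟩
  ext η
  have hρη := ρ_vertProj hq η
  have h1 := hclosed (𝒞.h q u) (𝒞.vertProj q η)
  rw [𝒞.ρ_h q hq, hρη, map_zero] at h1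
  have h2 : 𝒞.ρ q (fderiv ℝ 𝒞.vertProj q u η) = - fderiv ℝ 𝒞.ρ q u (𝒞.vertProj q η) := by
    have h3 : HasFDerivAt (fun p => 𝒞.ρ p (𝒞.vertProj p η)) (0 : E →L[ℝ] E) q := by
      refine (hasFDerivAt_const (0 : E) q).congr_of_eventuallyEq ?_
      filter_upwards [𝒞.isOpen.mem_nhds hq] with p hp using ρ_vertProj hp η
    have h4 := (hasFDerivAt_ρ hq).clm_apply (hP.clm_apply (hasFDerivAt_const η q))
    have h5 := congrArg (fun l : E →L[ℝ] E => l u) (h4.unique h3)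
    simp at h5
    exact eq_neg_of_add_eq_zero_left h5
  have h3 : 𝒞.ρ q (𝒞.vertTransport q u η) = 0 := by
    rw [vertTransport_apply, map_add, h2, 𝒞.anchor_c q hq, 𝒞.ρ_h q hq, hρη]
    simp
  change _ = 𝒞.modularForm q (𝒞.vertProj q (𝒞.vertTransport q u η))
  rw [vertProj_of_ρ_eq_zero h3, vertTransport_apply, map_add, ← h1]
  simp [add_comm]

/-- Locally, the isotropy algebras are either all unimodular or none is. -/
theorem eventually_isotropyModularForm (hq : q ∈ 𝒞.U) :
    ∃ V ∈ 𝓝 q, ∀ q₁ ∈ V, ∀ q₂ ∈ V,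
      𝒞.isotropyModularForm q₁ = 0 → 𝒞.isotropyModularForm q₂ = 0 := by
  have hcont : ContinuousAt 𝒞.vertTransport q := by
    have h1 : ContDiffOn ℝ ∞ 𝒞.vertTransport 𝒞.U := by
      rw [contDiffOn_clm_apply]
      intro u
      rw [contDiffOn_clm_apply]
      intro η
      simp only [vertTransport_apply]
      exact ((𝒞.contDiffOn_c.clm_apply (𝒞.contDiffOn_h.clm_apply contDiffOn_const)).clm_apply
        (contDiffOn_vertProj.clm_apply contDiffOn_const)).add
        (((contDiffOn_vertProj.fderiv_of_isOpen (m := ∞) 𝒞.isOpen (by simp)).clm_apply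
          contDiffOn_const).clm_apply contDiffOn_const)
    exact h1.continuousOn.continuousAt (𝒞.isOpen.mem_nhds hq)
  obtain ⟨C, hC⟩ : ∃ C, ∀ᶠ p in 𝓝 q, ‖𝒞.vertTransport p‖ ≤ C :=
    ⟨‖𝒞.vertTransport q‖ + 1, (hcont.norm.eventually_lt continuousAt_const
      (lt_add_one ‖𝒞.vertTransport q‖)).mono fun _ h => h.le⟩
  obtain ⟨r, hr, hball⟩ := Metric.mem_nhds_iff.1 (Filter.inter_mem (𝒞.isOpen.mem_nhds hq) hC)
  refine ⟨Metric.ball q r, Metric.ball_mem_nhds q hr, fun q₁ h₁ q₂ h₂ h0 => ?_⟩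
  -- Grönwall's inequality along the segment from `q₁` to `q₂`
  let γ : ℝ → E := fun t => q₁ + t • (q₂ - q₁)
  have hγ : ∀ t, HasDerivAt γ (q₂ - q₁) t := fun t => by
    have h := ((hasDerivAt_id t).smul_const (q₂ - q₁)).const_add q₁
    rw [one_smul] at h
    exact h
  have hmem : ∀ t ∈ Icc (0 : ℝ) 1, γ t ∈ Metric.ball q r := fun t ht =>
    (convex_ball q r).add_smul_sub_mem h₁ h₂ ht
  have hd : ∀ t ∈ Icc (0 : ℝ) 1, HasDerivAt (fun s => 𝒞.isotropyModularForm (γ s))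
      (𝒞.isotropyModularForm (γ t) ∘L 𝒞.vertTransport (γ t) (q₂ - q₁)) t := fun t ht => by
    obtain ⟨M', hM', hM⟩ := hasFDerivAt_isotropyModularForm (hball (hmem t ht)).1
    rw [← hM]
    exact hM'.comp_hasDerivAt t (hγ t)
  have key := eq_zero_of_abs_deriv_le_mul_abs_self_of_eq_zero_right
    (f := fun s => 𝒞.isotropyModularForm (γ s)) (K := C * ‖q₂ - q₁‖) (a := 0) (b := 1)
    (fun t ht => (hd t ht).continuousAt.continuousWithinAt)
    (fun t ht => (hd t ⟨ht.1, ht.2.le⟩).hasDerivWithinAt) (by simpa [γ] using h0) ?_ 1 (by simp)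
  · simpa [γ] using key
  · intro t ht
    have hC' : ‖𝒞.vertTransport (γ t)‖ ≤ C := (hball (hmem t ⟨ht.1, ht.2.le⟩)).2
    calc _ ≤ ‖𝒞.isotropyModularForm (γ t)‖ * ‖𝒞.vertTransport (γ t) (q₂ - q₁)‖ :=
          ContinuousLinearMap.opNorm_comp_le _ _
      _ ≤ ‖𝒞.isotropyModularForm (γ t)‖ * (C * ‖q₂ - q₁‖) := by
          gcongr
          exact ((𝒞.vertTransport (γ t)).le_opNorm _).trans (by gcongr)
      _ = _ := mul_comm _ _

end AlgebroidChart

/-! ### Charts of the total space of a vector bundle -/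

section BundleCharts

variable {EB F : Type*} {B : Type*} [NormedAddCommGroup EB] [NormedSpace ℝ EB]
  [NormedAddCommGroup F] [NormedSpace ℝ F] [TopologicalSpace B] [ChartedSpace EB B]
  {V : B → Type*} [TopologicalSpace (TotalSpace F V)]
  [∀ x, AddCommMonoid (V x)] [∀ x, Module ℝ (V x)] [∀ x, TopologicalSpace (V x)]
  [FiberBundle F V] [VectorBundle ℝ F V]

local notation "𝓙" => ModelWithCorners.prod 𝓘(ℝ, EB) 𝓘(ℝ, F)

variable (EB F V) in
/-- The domain, in the chart at `x`, over which the preferred trivialization at `x` is defined. -/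
def trivDomain (x : B) : Set EB :=
  (extChartAt 𝓘(ℝ, EB) x).target ∩
    (extChartAt 𝓘(ℝ, EB) x).symm ⁻¹' (trivializationAt F V x).baseSet

theorem isOpen_trivDomain (x : B) : IsOpen (trivDomain EB F V x) :=
  (continuousOn_extChartAt_symm x).isOpen_inter_preimage (isOpen_extChartAt_target x)
    (trivializationAt F V x).open_baseSet

theorem mem_trivDomain (x : B) : extChartAt 𝓘(ℝ, EB) x x ∈ trivDomain EB F V x :=
  ⟨mem_extChartAt_target x, by
    simpa using FiberBundle.mem_baseSet_trivializationAt' (F := F) (E := V) x⟩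

theorem extChartAt_totalSpace_target (a₀ : TotalSpace F V) :
    (extChartAt 𝓙 a₀).target = trivDomain EB F V a₀.proj ×ˢ univ :=
  FiberBundle.extChartAt_target _

theorem extChartAt_totalSpace_apply (a₀ a : TotalSpace F V) :
    extChartAt 𝓙 a₀ a = (extChartAt 𝓘(ℝ, EB) a₀.proj (trivializationAt F V a₀.proj a).1,
      (trivializationAt F V a₀.proj a).2) := by
  rw [FiberBundle.extChartAt]
  rfl

theorem extChartAt_totalSpace_symm_apply (a₀ : TotalSpace F V) {q : EB}
    (hq : q ∈ trivDomain EB F V a₀.proj) (ξ : F) :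
    (extChartAt 𝓙 a₀).symm (q, ξ) =
      ⟨(extChartAt 𝓘(ℝ, EB) a₀.proj).symm q,
        (trivializationAt F V a₀.proj).symm ((extChartAt 𝓘(ℝ, EB) a₀.proj).symm q) ξ⟩ := by
  rw [FiberBundle.extChartAt]
  exact ((trivializationAt F V a₀.proj).mk_symm hq.2 ξ).symm

theorem extChartAt_totalSpace_symm_proj (a₀ : TotalSpace F V) {p : EB × F}
    (hp : p.1 ∈ trivDomain EB F V a₀.proj) :
    ((extChartAt 𝓙 a₀).symm p).proj = (extChartAt 𝓘(ℝ, EB) a₀.proj).symm p.1 := by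
  rw [show p = (p.1, p.2) from rfl, extChartAt_totalSpace_symm_apply a₀ hp]

theorem trivializationAt_extChartAt_symm (a₀ : TotalSpace F V) {p : EB × F}
    (hp : p.1 ∈ trivDomain EB F V a₀.proj) :
    (trivializationAt F V a₀.proj ((extChartAt 𝓙 a₀).symm p)).2 = p.2 := by
  rw [show p = (p.1, p.2) from rfl, extChartAt_totalSpace_symm_apply a₀ hp,
    (trivializationAt F V a₀.proj).apply_mk_symm hp.2]

variable [FiniteDimensional ℝ EB] [FiniteDimensional ℝ F] [IsManifold 𝓘(ℝ, EB) ∞ B]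
  [ContMDiffVectorBundle ∞ F V 𝓘(ℝ, EB)]

theorem hasMFDerivAt_bundleChart (a₀ : TotalSpace F V) {p : EB × F}
    (hp : p.1 ∈ trivDomain EB F V a₀.proj) :
    HasMFDerivAt 𝓘(ℝ, EB × F) 𝓙 (extChartAt 𝓙 a₀).symm p
      (mfderiv 𝓘(ℝ, EB × F) 𝓙 (extChartAt 𝓙 a₀).symm p) := by
  have : IsManifold 𝓙 1 (TotalSpace F V) := by
    have : IsManifold 𝓙 ∞ (TotalSpace F V) := inferInstance
    exact IsManifold.of_le (n := ∞) (by simp)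
  exact hasMFDerivAt_extChartAt_symm 𝓙 a₀ (by
    rw [extChartAt_totalSpace_target]; exact ⟨hp, mem_univ _⟩)

variable (a₀ : TotalSpace F V)

theorem eventually_mem_trivDomain {p : EB × F} (hp : p.1 ∈ trivDomain EB F V a₀.proj) :
    ∀ᶠ p' in 𝓝 p, p'.1 ∈ trivDomain EB F V a₀.proj :=
  continuous_fst.continuousAt ((isOpen_trivDomain a₀.proj).mem_nhds hp)

/-- In charts the differential of the projection is the first projection. -/
theorem mfderiv_proj_bundleChart {p : EB × F} (hp : p.1 ∈ trivDomain EB F V a₀.proj) (z : EB × F) :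
    (mfderiv 𝓙 𝓘(ℝ, EB) (TotalSpace.proj : TotalSpace F V → B) ((extChartAt 𝓙 a₀).symm p)
      (mfderiv 𝓘(ℝ, EB × F) 𝓙 (extChartAt 𝓙 a₀).symm p z) : EB) =
    mfderiv 𝓘(ℝ, EB) 𝓘(ℝ, EB) (extChartAt 𝓘(ℝ, EB) a₀.proj).symm p.1 z.1 := by
  have h1 : HasMFDerivAt 𝓙 𝓘(ℝ, EB) (TotalSpace.proj : TotalSpace F V → B)
      ((extChartAt 𝓙 a₀).symm p) _ := (mdifferentiableAt_proj V).hasMFDerivAt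
  have h2 := HasMFDerivAt.comp p h1 (hasMFDerivAt_bundleChart a₀ hp)
  have h3 : HasMFDerivAt 𝓘(ℝ, EB × F) 𝓘(ℝ, EB) (Prod.fst : EB × F → EB) p
      (ContinuousLinearMap.fst ℝ EB F) := hasFDerivAt_fst.hasMFDerivAt
  have h4 := HasMFDerivAt.comp p (hasMFDerivAt_extChartAt_symm 𝓘(ℝ, EB) a₀.proj
    (u := p.1) hp.1) h3
  have h5 := h2.congr_of_eventuallyEq (f₁ := (extChartAt 𝓘(ℝ, EB) a₀.proj).symm ∘ Prod.fst) (by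
    filter_upwards [eventually_mem_trivDomain a₀ hp] with p' hp'
    exact (extChartAt_totalSpace_symm_proj a₀ hp').symm)
  exact congrArg (fun l : EB × F →L[ℝ] EB => l z) (hasMFDerivAt_unique h5 h4)

/-- In charts the vertical lift is the inclusion of the second factor. -/
theorem vlift_bundleChart {p : EB × F} (hp : p.1 ∈ trivDomain EB F V a₀.proj)
    (w : V ((extChartAt 𝓙 a₀).symm p).proj) :
    (vlift EB F ((extChartAt 𝓙 a₀).symm p) w : EB × F) =
      mfderiv 𝓘(ℝ, EB × F) 𝓙 (extChartAt 𝓙 a₀).symm p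
        ((0, (trivializationAt F V a₀.proj ⟨_, w⟩).2) : EB × F) := by
  set e := trivializationAt F V a₀.proj
  let a := (extChartAt 𝓙 a₀).symm p
  have hproj : a.proj = _ := extChartAt_totalSpace_symm_proj a₀ hp
  have hmem : a.proj ∈ e.baseSet := by rw [hproj]; exact hp.2
  set ŵ : F := (e ⟨a.proj, w⟩).2 with hw
  have hcurve : ∀ t : ℝ, (⟨a.proj, a.2 + t • w⟩ : TotalSpace F V) =
      (extChartAt 𝓙 a₀).symm (p + t • ((0, ŵ) : EB × F)) := by
    intro t
    have hq : (p + t • ((0, ŵ) : EB × F)) = (p.1, p.2 + t • ŵ) := by ext <;> simp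
    refine Eq.trans ?_ (congrArg _ hq).symm
    refine Eq.trans ?_ (extChartAt_totalSpace_symm_apply a₀ hp _).symm
    have key : ∀ x, a.proj = x → (⟨a.proj, a.2 + t • w⟩ : TotalSpace F V) =
        ⟨x, e.symm x (p.2 + t • ŵ)⟩ := by
      rintro _ rfl
      congr 1
      have h1 : e.linearMapAt ℝ a.proj (a.2 + t • w) = p.2 + t • ŵ := by
        rw [map_add, map_smul, e.coe_linearMapAt_of_mem hmem]
        congr 1
        exact trivializationAt_extChartAt_symm a₀ hp
      rw [← h1, ← e.symmₗ_apply (R := ℝ), e.symmₗ_linearMapAt hmem]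
      exact hmem
    exact key _ hproj
  have h1 : HasMFDerivAt 𝓘(ℝ, ℝ) 𝓘(ℝ, EB × F) (fun t : ℝ => p + t • ((0, ŵ) : EB × F)) 0
      (ContinuousLinearMap.toSpanSingleton ℝ ((0, ŵ) : EB × F)) := by
    have h := ((hasDerivAt_id (0 : ℝ)).smul_const ((0, ŵ) : EB × F)).const_add p
    rw [one_smul] at h
    exact h.hasFDerivAt.hasMFDerivAt
  have h2 : HasMFDerivAt 𝓘(ℝ, EB × F) 𝓙 (extChartAt 𝓙 a₀).symm (p + (0 : ℝ) • ((0, ŵ) : EB × F))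
      (mfderiv 𝓘(ℝ, EB × F) 𝓙 (extChartAt 𝓙 a₀).symm p) := by
    rw [zero_smul, add_zero]
    exact hasMFDerivAt_bundleChart a₀ hp
  have h3 := HasMFDerivAt.comp (0 : ℝ) h2 h1
  have h4 : (fun t : ℝ => (⟨a.proj, a.2 + t • w⟩ : TotalSpace F V)) =
      (extChartAt 𝓙 a₀).symm ∘ (fun t : ℝ => p + t • ((0, ŵ) : EB × F)) := funext hcurve
  rw [← h4] at h3
  have h6 := congrArg (fun l : ℝ →L[ℝ] EB × F => l 1) h3.mfderiv
  refine Eq.trans h6 ?_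
  change mfderiv 𝓘(ℝ, EB × F) 𝓙 (extChartAt 𝓙 a₀).symm p (((1 : ℝ) • ((0, ŵ) : EB × F))) = _
  rw [one_smul]

/-- The differential of a section in charts. -/
theorem dsection_bundleChart {p : EB × F} (hp : p.1 ∈ trivDomain EB F V a₀.proj)
    {s : ∀ x, V x} (hs : s ((extChartAt 𝓙 a₀).symm p).proj = ((extChartAt 𝓙 a₀).symm p).2)
    {S : EB →L[ℝ] F} (hS : HasFDerivAt (fun q => (trivializationAt F V a₀.proj
      ⟨(extChartAt 𝓘(ℝ, EB) a₀.proj).symm q, s ((extChartAt 𝓘(ℝ, EB) a₀.proj).symm q)⟩).2) S p.1)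
    (u : EB) :
    (dsection EB F ((extChartAt 𝓙 a₀).symm p) s
      (mfderiv 𝓘(ℝ, EB) 𝓘(ℝ, EB) (extChartAt 𝓘(ℝ, EB) a₀.proj).symm p.1 u : EB) : EB × F) =
      mfderiv 𝓘(ℝ, EB × F) 𝓙 (extChartAt 𝓙 a₀).symm p ((u, S u) : EB × F) := by
  set e := trivializationAt F V a₀.proj
  set φ := extChartAt 𝓘(ℝ, EB) a₀.proj
  set a := (extChartAt 𝓙 a₀).symm p with ha
  have hproj : a.proj = φ.symm p.1 := extChartAt_totalSpace_symm_proj a₀ hp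
  have hφa : φ a.proj = p.1 := by rw [hproj]; exact φ.right_inv hp.1
  have hsrc : a.proj ∈ φ.source := by rw [hproj]; exact φ.map_target hp.1
  let ŝ : EB → F := fun q => (e ⟨φ.symm q, s (φ.symm q)⟩).2
  have hŝ : ŝ p.1 = p.2 := by
    change (e ⟨φ.symm p.1, s (φ.symm p.1)⟩).2 = p.2
    rw [← hproj, hs]
    exact trivializationAt_extChartAt_symm a₀ hp
  have h1 : HasMFDerivAt 𝓘(ℝ, EB) 𝓘(ℝ, EB × F) (fun q => (q, ŝ q)) (φ a.proj)
      ((ContinuousLinearMap.id ℝ EB).prod S) := by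
    rw [hφa]
    exact ((hasFDerivAt_id p.1).prodMk hS).hasMFDerivAt
  have h2 : HasMFDerivAt 𝓘(ℝ, EB × F) 𝓙 (extChartAt 𝓙 a₀).symm (φ a.proj, ŝ (φ a.proj))
      (mfderiv 𝓘(ℝ, EB × F) 𝓙 (extChartAt 𝓙 a₀).symm p) := by
    rw [hφa, hŝ]
    exact hasMFDerivAt_bundleChart a₀ hp
  have h3 : HasMFDerivAt 𝓘(ℝ, EB) 𝓘(ℝ, EB) φ a.proj _ :=
    hasMFDerivAt_extChartAt' 𝓘(ℝ, EB) a₀.proj hsrc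
  have h4 := HasMFDerivAt.comp a.proj (HasMFDerivAt.comp (φ a.proj) h2 h1) h3
  have h5 : (fun x => (⟨x, s x⟩ : TotalSpace F V)) =ᶠ[𝓝 a.proj]
      ((extChartAt 𝓙 a₀).symm ∘ (fun q => (q, ŝ q))) ∘ φ := by
    have hb : e.baseSet ∈ 𝓝 a.proj := e.open_baseSet.mem_nhds (by rw [hproj]; exact hp.2)
    filter_upwards [hb, (isOpen_extChartAt_source (I := 𝓘(ℝ, EB)) a₀.proj).mem_nhds hsrc]
      with x hx hx'
    have hxq : φ.symm (φ x) = x := φ.left_inv hx'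
    have hxT : φ x ∈ trivDomain EB F V a₀.proj :=
      ⟨φ.map_source hx', by change φ.symm (φ x) ∈ e.baseSet; rwa [hxq]⟩
    change _ = (extChartAt 𝓙 a₀).symm (φ x, (e ⟨φ.symm (φ x), s (φ.symm (φ x))⟩).2)
    rw [extChartAt_totalSpace_symm_apply a₀ hxT]
    change _ = (⟨φ.symm (φ x), e.symm (φ.symm (φ x)) _⟩ : TotalSpace F V)
    rw [hxq]
    congr 1
    exact (e.symm_proj_apply ⟨x, s x⟩ hx).symm
  have h6 := congrArg (fun l : EB →L[ℝ] EB × F =>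
    l (mfderiv 𝓘(ℝ, EB) 𝓘(ℝ, EB) φ.symm p.1 u)) (h4.congr_of_eventuallyEq h5).mfderiv
  refine h6.trans ?_
  have h7 := mfderiv_extChartAt_symm_apply 𝓘(ℝ, EB) a₀.proj hp.1 u
  rw [← hproj] at h7
  change mfderiv 𝓘(ℝ, EB × F) 𝓙 (extChartAt 𝓙 a₀).symm p
    (((ContinuousLinearMap.id ℝ EB).prod S) (mfderiv 𝓘(ℝ, EB) 𝓘(ℝ, EB) φ a.proj
      (mfderiv 𝓘(ℝ, EB) 𝓘(ℝ, EB) φ.symm p.1 u)) : EB × F) = _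
  erw [h7]
  rfl

theorem mfderiv_bundleChart_injective {p : EB × F} (hp : p.1 ∈ trivDomain EB F V a₀.proj) :
    Function.Injective (mfderiv 𝓘(ℝ, EB × F) 𝓙 (extChartAt 𝓙 a₀).symm p) := by
  have : IsManifold 𝓙 1 (TotalSpace F V) := by
    have : IsManifold 𝓙 ∞ (TotalSpace F V) := inferInstance
    exact IsManifold.of_le (n := ∞) (by simp)
  refine Function.LeftInverse.injective (g := mfderiv 𝓙 𝓘(ℝ, EB × F) (extChartAt 𝓙 a₀)
    ((extChartAt 𝓙 a₀).symm p)) fun z => ?_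
  exact mfderiv_extChartAt_symm_apply 𝓙 a₀ (by
    rw [extChartAt_totalSpace_target]; exact ⟨hp, mem_univ _⟩) z

theorem mfderiv_bundleChart_surjective {p : EB × F} (hp : p.1 ∈ trivDomain EB F V a₀.proj)
    (Z : EB × F) : ∃ z : EB × F, (mfderiv 𝓘(ℝ, EB × F) 𝓙 (extChartAt 𝓙 a₀).symm p z : EB × F) = Z :=
  let l : EB × F →L[ℝ] EB × F := mfderiv 𝓘(ℝ, EB × F) 𝓙 (extChartAt 𝓙 a₀).symm p
  LinearMap.injective_iff_surjective (f := l.toLinearMap).1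
    (mfderiv_bundleChart_injective a₀ hp) Z

theorem center_mem_trivDomain : (extChartAt 𝓙 a₀ a₀).1 ∈ trivDomain EB F V a₀.proj := by
  rw [extChartAt_totalSpace_apply]
  have : (trivializationAt F V a₀.proj a₀).1 = a₀.proj :=
    (trivializationAt F V a₀.proj).coe_fst (by
      rw [Trivialization.mem_source]; exact FiberBundle.mem_baseSet_trivializationAt' a₀.proj)
  simp only [this]
  exact mem_trivDomain _

theorem vlift_injective (a : TotalSpace F V) : Function.Injective (vlift EB F a) := by
  have hp := center_mem_trivDomain (EB := EB) a
  have ha : (extChartAt 𝓙 a).symm (extChartAt 𝓙 a a) = a := extChartAt_to_inv a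
  suffices H : ∀ b, (extChartAt 𝓙 a).symm (extChartAt 𝓙 a a) = b →
      Function.Injective (vlift EB F b) from H a ha
  rintro b rfl w w' h
  have h1 := (vlift_bundleChart a hp w).symm.trans (h.trans (vlift_bundleChart a hp w'))
  have h2 := mfderiv_bundleChart_injective a hp h1
  have h3 : (trivializationAt F V a.proj ⟨_, w⟩).2 = (trivializationAt F V a.proj ⟨_, w'⟩).2 :=
    (Prod.ext_iff.1 h2).2
  have hb : ((extChartAt 𝓙 a).symm (extChartAt 𝓙 a a)).proj ∈
      (trivializationAt F V a.proj).baseSet := by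
    rw [extChartAt_totalSpace_symm_proj a hp]; exact hp.2
  rw [← (trivializationAt F V a.proj).symm_apply_apply_mk hb w, h3,
    (trivializationAt F V a.proj).symm_apply_apply_mk hb w']

end BundleCharts

/-! ### Local frames and the locality of the bracket -/

section Frames

variable {EM F : Type*} [NormedAddCommGroup EM] [NormedSpace ℝ EM] [FiniteDimensional ℝ EM]
  [NormedAddCommGroup F] [NormedSpace ℝ F] {M : Type*} [TopologicalSpace M] [T2Space M]
  [ChartedSpace EM M] [IsManifold 𝓘(ℝ, EM) ∞ M]

theorem exists_bump {x : M} {s : Set M} (hs : s ∈ 𝓝 x) :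
    ∃ f : C^∞⟮𝓘(ℝ, EM), M; ℝ⟯, (∀ᶠ y in 𝓝 x, f y = 1) ∧ tsupport f ⊆ s := by
  obtain ⟨ψ, -, hψ⟩ := (SmoothBumpFunction.nhds_basis_tsupport (I := 𝓘(ℝ, EM)) x).mem_iff.1 hs
  exact ⟨⟨ψ, ψ.contMDiff⟩, ψ.eventuallyEq_one, hψ⟩

/-- A function that is smooth near `x` agrees near `x` with a globally smooth function. -/
theorem exists_smooth_extension {x : M} {s : Set M} (hs : s ∈ 𝓝 x) {g : M → ℝ}
    (hg : ContMDiffOn 𝓘(ℝ, EM) 𝓘(ℝ, ℝ) ∞ g s) :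
    ∃ f : C^∞⟮𝓘(ℝ, EM), M; ℝ⟯, ∀ᶠ y in 𝓝 x, f y = g y := by
  obtain ⟨ψ, hψ1, hψ⟩ := exists_bump (EM := EM) (interior_mem_nhds.2 hs)
  refine ⟨⟨fun y => ψ y * g y, contMDiff_of_tsupport fun y hy => ?_⟩, ?_⟩
  · have hy' : y ∈ interior s := hψ (tsupport_mul_subset_left hy)
    exact (ψ.contMDiff y).mul (hg.contMDiffAt (mem_interior_iff_mem_nhds.1 hy'))
  · filter_upwards [hψ1] with y hy
    change ψ y * g y = g y
    rw [hy, one_mul]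

variable {A : M → Type*} [TopologicalSpace (TotalSpace F A)]
  [∀ x, AddCommGroup (A x)] [∀ x, Module ℝ (A x)] [∀ x, TopologicalSpace (A x)]
  [FiberBundle F A] [VectorBundle ℝ F A]

theorem sum_section_apply {ι : Type*} (s : Finset ι) (f : ι → Cₛ^∞⟮𝓘(ℝ, EM); F, A⟯) (x : M) :
    (∑ i ∈ s, f i) x = ∑ i ∈ s, f i x := by
  have h := map_sum (ContMDiffSection.coeAddHom 𝓘(ℝ, EM) F ∞ A) f s
  have h2 := congrFun h x
  rw [Finset.sum_apply] at h2
  exact h2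

/-- The trivialization at `x₀` is spanned near `x₀` by global sections. -/
theorem exists_frame [ContMDiffVectorBundle ∞ F A 𝓘(ℝ, EM)] (x₀ : M) :
    ∃ T : F →ₗ[ℝ] Cₛ^∞⟮𝓘(ℝ, EM); F, A⟯, ∀ᶠ x in 𝓝 x₀, ∀ w,
      T w x = (trivializationAt F A x₀).symmL ℝ x w := by
  set t := trivializationAt F A x₀
  have hx : x₀ ∈ t.baseSet := FiberBundle.mem_baseSet_trivializationAt' x₀
  obtain ⟨ψ, hψ1, hψ⟩ := exists_bump (EM := EM) (t.open_baseSet.mem_nhds hx)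
  have hs : ∀ w : F, ContMDiff 𝓘(ℝ, EM) (𝓘(ℝ, EM).prod 𝓘(ℝ, F)) ∞
      (fun y => TotalSpace.mk' F y (ψ y • t.symmL ℝ y w)) := by
    intro w
    refine ContMDiffOn.smul_section_of_tsupport (u := t.baseSet)
      (s := fun y => t.symmL ℝ y w) ψ.contMDiff.contMDiffOn t.open_baseSet hψ ?_
    intro y hy
    rw [t.contMDiffWithinAt_section _ hy]
    refine (contMDiffOn_const (c := w) y hy).congr (fun z hz => ?_) ?_
    · simp [Trivialization.symmL_apply, Trivialization.apply_mk_symm, hz]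
    · simp [Trivialization.symmL_apply, Trivialization.apply_mk_symm, hy]
  refine ⟨⟨⟨fun w => ⟨fun y => ψ y • t.symmL ℝ y w, hs _⟩, ?_⟩, ?_⟩, ?_⟩
  · intro v w
    ext y
    simp
  · intro c v
    ext y
    simp [smul_comm c]
  · filter_upwards [hψ1] with y hy w
    change ψ y • t.symmL ℝ y w = _
    rw [hy, one_smul]

namespace LieAlgebroid

variable (𝒜 : LieAlgebroid EM F A)

theorem bracket_skew (a b : Cₛ^∞⟮𝓘(ℝ, EM); F, A⟯) : 𝒜.bracket a b = - 𝒜.bracket b a := by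
  have h := 𝒜.bracket_self (a + b)
  simp only [map_add, LinearMap.add_apply, 𝒜.bracket_self, zero_add, add_zero] at h
  exact eq_neg_of_add_eq_zero_right h

/-- The bracket is a local operator. -/
theorem bracket_congr_right (a : Cₛ^∞⟮𝓘(ℝ, EM); F, A⟯) {b b' : Cₛ^∞⟮𝓘(ℝ, EM); F, A⟯} {x : M}
    (h : ∀ᶠ y in 𝓝 x, b y = b' y) : 𝒜.bracket a b x = 𝒜.bracket a b' x := by
  obtain ⟨ψ, hψ1, hψ⟩ := exists_bump (EM := EM) h
  have hx : ψ x = 1 := hψ1.self_of_nhds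
  have hbx : b x = b' x := h.self_of_nhds
  -- the difference of the sections is the product with a function vanishing at `x`
  have hd : smulSection (1 - ψ) (b - b') = b - b' := by
    ext y
    change (1 - ψ y) • (b y - b' y) = b y - b' y
    by_cases hy : y ∈ tsupport ψ
    · have : b y = b' y := hψ hy
      rw [this, sub_self, smul_zero]
    · rw [image_eq_zero_of_notMem_tsupport hy, sub_zero, one_smul]
  have hl := 𝒜.leibniz a (b - b') (1 - ψ) x
  have h1 : (1 - ψ : C^∞⟮𝓘(ℝ, EM), M; ℝ⟯) x = 0 := by
    change 1 - ψ x = 0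
    rw [hx, sub_self]
  have h2 : (b - b' : Cₛ^∞⟮𝓘(ℝ, EM); F, A⟯) x = 0 := by
    change b x - b' x = 0
    rw [hbx, sub_self]
  rw [hd, h1, h2, zero_smul, smul_zero, add_zero, map_sub] at hl
  exact sub_eq_zero.1 hl

variable [FiniteDimensional ℝ F] [ContMDiffVectorBundle ∞ F A 𝓘(ℝ, EM)]

variable (F A) in
/-- The coordinates at `x` of an element of the fibre, in the trivialization at `x₀`. -/
abbrev triv (x₀ x : M) : A x →L[ℝ] F := (trivializationAt F A x₀).continuousLinearMapAt ℝ x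

theorem triv_apply {x₀ x : M} (hx : x ∈ (trivializationAt F A x₀).baseSet) (v : A x) :
    triv F A x₀ x v = (trivializationAt F A x₀ ⟨x, v⟩).2 := by
  rw [triv, Trivialization.continuousLinearMapAt_apply, Trivialization.coe_linearMapAt_of_mem _ hx]

theorem contMDiffOn_triv (x₀ : M) (b : Cₛ^∞⟮𝓘(ℝ, EM); F, A⟯) :
    ContMDiffOn 𝓘(ℝ, EM) 𝓘(ℝ, F) ∞ (fun x => triv F A x₀ x (b x))
      (trivializationAt F A x₀).baseSet :=
  (((trivializationAt F A x₀).contMDiffOn_section_baseSet_iff (IB := 𝓘(ℝ, EM))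
    (s := fun x => b x)).1 b.contMDiff.contMDiffOn).congr fun _ hx => triv_apply hx _

variable {x₀ x : M} {T : F →ₗ[ℝ] Cₛ^∞⟮𝓘(ℝ, EM); F, A⟯}

theorem triv_frame (hx : x ∈ (trivializationAt F A x₀).baseSet)
    (hT : ∀ᶠ y in 𝓝 x, ∀ w, T w y = (trivializationAt F A x₀).symmL ℝ y w) (w : F) :
    triv F A x₀ x (T w x) = w := by
  rw [hT.self_of_nhds, Trivialization.continuousLinearMapAt_symmL _ hx]

theorem frame_triv (hx : x ∈ (trivializationAt F A x₀).baseSet)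
    (hT : ∀ᶠ y in 𝓝 x, ∀ w, T w y = (trivializationAt F A x₀).symmL ℝ y w) (v : A x) :
    T (triv F A x₀ x v) x = v := by
  rw [hT.self_of_nhds, Trivialization.symmL_continuousLinearMapAt _ hx]

/-- The Leibniz rule for the coordinates of a section. -/
theorem triv_bracket_right (hx : x ∈ (trivializationAt F A x₀).baseSet)
    (hT : ∀ᶠ y in 𝓝 x, ∀ w, T w y = (trivializationAt F A x₀).symmL ℝ y w)
    (a b : Cₛ^∞⟮𝓘(ℝ, EM); F, A⟯) {β' : EM →L[ℝ] F}
    (hβ : HasMFDerivAt 𝓘(ℝ, EM) 𝓘(ℝ, F) (fun y => triv F A x₀ y (b y)) x β') :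
    triv F A x₀ x (𝒜.bracket a b x) =
      triv F A x₀ x (𝒜.bracket a (T (triv F A x₀ x (b x))) x) + β' (𝒜.anchor x (a x)) := by
  set e := trivializationAt F A x₀
  set B := Module.finBasis ℝ F
  have he : e.baseSet ∈ 𝓝 x := e.open_baseSet.mem_nhds hx
  let β : M → F := fun y => triv F A x₀ y (b y)
  have hf : ∀ i, ∃ f : C^∞⟮𝓘(ℝ, EM), M; ℝ⟯, ∀ᶠ y in 𝓝 x, f y = B.equivFunL (β y) i := by
    intro i
    refine exists_smooth_extension (EM := EM) he (g := fun y => B.equivFunL (β y) i) ?_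
    have h1 : ContMDiff 𝓘(ℝ, F) 𝓘(ℝ, ℝ) ∞ (fun w => B.equivFunL w i) :=
      (((ContinuousLinearMap.proj i : (Fin (Module.finrank ℝ F) → ℝ) →L[ℝ] ℝ) ∘L
        B.equivFunL.toContinuousLinearMap).contDiff).contMDiff
    exact h1.comp_contMDiffOn (contMDiffOn_triv x₀ b)
  choose f hf using hf
  have hsum : ∀ w : F, ∑ i, B.equivFunL w i • B i = w := fun w => B.sum_equivFun w
  have hb : ∀ᶠ y in 𝓝 x, b y = (∑ i, smulSection (f i) (T (B i))) y := by
    filter_upwards [he, hT, Filter.eventually_all.2 hf] with y hy hTy hfy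
    have h1 : (∑ i, smulSection (f i) (T (B i))) y = ∑ i, f i y • T (B i) y := by
      rw [sum_section_apply]
      rfl
    rw [h1]
    simp only [hTy, hfy, ← map_smul, ← map_sum, hsum]
    exact (e.symmL_continuousLinearMapAt hy _).symm
  rw [𝒜.bracket_congr_right a hb, map_sum, sum_section_apply]
  simp only [𝒜.leibniz, map_sum, map_add, map_smul, Finset.sum_add_distrib]
  have hTf := triv_frame hx hT
  congr 1
  · have h1 : T (β x) = ∑ i, f i x • T (B i) := by
      conv_lhs => rw [← hsum (β x)]
      rw [map_sum]
      refine Finset.sum_congr rfl fun i _ => ?_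
      have : f i x = B.equivFunL (β x) i := (hf i).self_of_nhds
      rw [map_smul, this]
    change _ = triv F A x₀ x (𝒜.bracket a (T (β x)) x)
    rw [h1, map_sum, sum_section_apply, map_sum]
    refine Finset.sum_congr rfl fun i _ => ?_
    rw [map_smul]
    exact ((triv F A x₀ x).map_smul _ _).symm
  · simp only [hTf]
    conv_rhs => rw [← hsum (β' (𝒜.anchor x (a x)))]
    refine Finset.sum_congr rfl fun i _ => ?_
    congr 1
    have h1 : HasMFDerivAt 𝓘(ℝ, F) 𝓘(ℝ, ℝ) (fun w => B.equivFunL w i) (β x)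
        ((ContinuousLinearMap.proj i : (Fin (Module.finrank ℝ F) → ℝ) →L[ℝ] ℝ) ∘L
          B.equivFunL.toContinuousLinearMap) :=
      ((ContinuousLinearMap.proj i : (Fin (Module.finrank ℝ F) → ℝ) →L[ℝ] ℝ) ∘L
        B.equivFunL.toContinuousLinearMap).hasMFDerivAt
    have h2 := (HasMFDerivAt.comp x h1 hβ).congr_of_eventuallyEq (hf i)
    unfold dirDeriv
    rw [h2.mfderiv]
    rfl

/-- The bracket in coordinates. -/
theorem triv_bracket (hx : x ∈ (trivializationAt F A x₀).baseSet)
    (hT : ∀ᶠ y in 𝓝 x, ∀ w, T w y = (trivializationAt F A x₀).symmL ℝ y w)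
    (a b : Cₛ^∞⟮𝓘(ℝ, EM); F, A⟯) {α' β' : EM →L[ℝ] F}
    (hα : HasMFDerivAt 𝓘(ℝ, EM) 𝓘(ℝ, F) (fun y => triv F A x₀ y (a y)) x α')
    (hβ : HasMFDerivAt 𝓘(ℝ, EM) 𝓘(ℝ, F) (fun y => triv F A x₀ y (b y)) x β') :
    triv F A x₀ x (𝒜.bracket a b x) =
      triv F A x₀ x (𝒜.bracket (T (triv F A x₀ x (a x))) (T (triv F A x₀ x (b x))) x) +
        β' (𝒜.anchor x (a x)) - α' (𝒜.anchor x (b x)) := by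
  have h1 := 𝒜.triv_bracket_right hx hT a b hβ
  have h2 := 𝒜.triv_bracket_right hx hT (T (triv F A x₀ x (b x))) a hα
  have h3 : ∀ c d : Cₛ^∞⟮𝓘(ℝ, EM); F, A⟯, triv F A x₀ x (𝒜.bracket c d x) =
      - triv F A x₀ x (𝒜.bracket d c x) := fun c d => by
    rw [𝒜.bracket_skew c d, ← ContinuousLinearMap.map_neg]
    rfl
  rw [h1, h3 a, h2, h3 _ (T (triv F A x₀ x (a x))), frame_triv hx hT]
  abel

end LieAlgebroid

end Frames

/-! ### The Lie bracket of fields related by a map -/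

section Related

variable {EL EM M : Type*} [NormedAddCommGroup EL] [NormedSpace ℝ EL]
  [NormedAddCommGroup EM] [NormedSpace ℝ EM] [FiniteDimensional ℝ EM] [TopologicalSpace M]
  [ChartedSpace EM M] [IsManifold 𝓘(ℝ, EM) ∞ M]

/-- The Lie bracket of vector fields which along a map `σ` are images of fields `v`, `w` is the
image
of the Lie bracket of `v` and `w`. -/
theorem mlieBracket_of_related {σ : EL → M} {q : EL}
    (hσ : ContMDiffAt 𝓘(ℝ, EL) 𝓘(ℝ, EM) ∞ σ q) {v w : EL → EL} {v' w' : EL →L[ℝ] EL}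
    (hv : HasFDerivAt v v' q) (hw : HasFDerivAt w w' q) {V W : ∀ x : M, TangentSpace 𝓘(ℝ, EM) x}
    (hV : MDifferentiableAt 𝓘(ℝ, EM) 𝓘(ℝ, EM).tangent
      (fun x => (⟨x, V x⟩ : TangentBundle 𝓘(ℝ, EM) M)) (σ q))
    (hW : MDifferentiableAt 𝓘(ℝ, EM) 𝓘(ℝ, EM).tangent
      (fun x => (⟨x, W x⟩ : TangentBundle 𝓘(ℝ, EM) M)) (σ q))
    (hvV : ∀ᶠ p in 𝓝 q, (mfderiv 𝓘(ℝ, EL) 𝓘(ℝ, EM) σ p (v p) : EM) = V (σ p))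
    (hwW : ∀ᶠ p in 𝓝 q, (mfderiv 𝓘(ℝ, EL) 𝓘(ℝ, EM) σ p (w p) : EM) = W (σ p)) :
    VectorField.mlieBracket 𝓘(ℝ, EM) V W (σ q) =
      mfderiv 𝓘(ℝ, EL) 𝓘(ℝ, EM) σ q (w' (v q) - v' (w q) : EL) := by
  have : IsManifold 𝓘(ℝ, EM) 1 M := IsManifold.of_le (n := ∞) (by simp)
  have : CompleteSpace EM := FiniteDimensional.complete ℝ EM
  set κ := extChartAt 𝓘(ℝ, EM) (σ q) with hκ
  let j : EL → EM := fun p => κ (σ p)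
  have hκq : σ q ∈ κ.source := mem_extChartAt_source _
  have hj : ContDiffAt ℝ ∞ j q := by
    rw [← contMDiffAt_iff_contDiffAt]
    exact (contMDiffAt_extChartAt (n := ∞)).comp q hσ
  have hsrc : ∀ᶠ p in 𝓝 q, σ p ∈ κ.source :=
    hσ.continuousAt ((isOpen_extChartAt_source (I := 𝓘(ℝ, EM)) (σ q)).mem_nhds hκq)
  have hσd : ∀ᶠ p in 𝓝 q, MDifferentiableAt 𝓘(ℝ, EL) 𝓘(ℝ, EM) σ p := by
    have h1 : ContMDiffAt 𝓘(ℝ, EL) 𝓘(ℝ, EM) 1 σ q := hσ.of_le (by simp)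
    filter_upwards [(contMDiffAt_iff_contMDiffAt_nhds (by simp)).1 h1] with p hp
      using hp.mdifferentiableAt (by simp)
  -- `σ` in the chart
  have hjd : ∀ᶠ p in 𝓝 q, ∀ z : EL, (fderiv ℝ j p z : EM) =
      mfderiv 𝓘(ℝ, EM) 𝓘(ℝ, EM) κ (σ p) (mfderiv 𝓘(ℝ, EL) 𝓘(ℝ, EM) σ p z) := by
    filter_upwards [hsrc, hσd] with p hp hp' z
    have h := HasMFDerivAt.comp p (hasMFDerivAt_extChartAt' 𝓘(ℝ, EM) (σ q) hp) hp'.hasMFDerivAt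
    have h2 : mfderiv 𝓘(ℝ, EL) 𝓘(ℝ, EM) j p = _ := h.mfderiv
    rw [mfderiv_eq_fderiv] at h2
    rw [h2]
    rfl
  let Vc : (∀ x : M, TangentSpace 𝓘(ℝ, EM) x) → EM → EM := fun V =>
    VectorField.mpullbackWithin 𝓘(ℝ, EM) 𝓘(ℝ, EM) κ.symm V (range 𝓘(ℝ, EM))
  have hVc : ∀ (v : EL → EL) (V : ∀ x : M, TangentSpace 𝓘(ℝ, EM) x),
      (∀ᶠ p in 𝓝 q, (mfderiv 𝓘(ℝ, EL) 𝓘(ℝ, EM) σ p (v p) : EM) = V (σ p)) →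
      ∀ᶠ p in 𝓝 q, Vc V (j p) = fderiv ℝ j p (v p) := by
    intro v V h
    filter_upwards [hsrc, hjd, h] with p hp hp' hpv
    have ht : j p ∈ κ.target := κ.map_source hp
    have hinv := isInvertible_mfderivWithin_extChartAt_symm (I := 𝓘(ℝ, EM)) ht
    have hs : κ.symm (j p) = σ p := κ.left_inv hp
    change (mfderivWithin 𝓘(ℝ, EM) 𝓘(ℝ, EM) κ.symm (range 𝓘(ℝ, EM)) (j p)).inverse
      (V (κ.symm (j p)) : EM) = _
    refine hinv.inverse_apply_eq.2 ?_
    have h3 := mfderiv_symm_extChartAt_apply 𝓘(ℝ, EM) (σ q) hp (V (σ p))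
    have h4 : (V (κ.symm (j p)) : EM) = V (σ p) := by rw [hs]
    have h5 : (mfderiv 𝓘(ℝ, EL) 𝓘(ℝ, EM) σ p (v p) : EM) = V (σ p) := hpv
    have h6 : mfderivWithin 𝓘(ℝ, EM) 𝓘(ℝ, EM) κ.symm (range 𝓘(ℝ, EM)) (j p) =
        mfderiv 𝓘(ℝ, EM) 𝓘(ℝ, EM) κ.symm (j p) := by
      rw [ModelWithCorners.range_eq_univ, mfderivWithin_univ]
    refine h4.trans (h3.symm.trans ?_)
    have h7 : (mfderiv 𝓘(ℝ, EM) 𝓘(ℝ, EM) κ (σ p) (V (σ p)) : EM) = fderiv ℝ j p (v p) := by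
      rw [hp' (v p)]
      exact congrArg (mfderiv 𝓘(ℝ, EM) 𝓘(ℝ, EM) κ (σ p)) h5.symm
    exact (congrArg (mfderiv 𝓘(ℝ, EM) 𝓘(ℝ, EM) κ.symm (j p)) h7).trans
      (congrArg (fun l : EM →L[ℝ] EM => l (fderiv ℝ j p (v p))) h6.symm)
  have hdiff : ∀ V : ∀ x : M, TangentSpace 𝓘(ℝ, EM) x,
      MDifferentiableAt 𝓘(ℝ, EM) 𝓘(ℝ, EM).tangent
        (fun x => (⟨x, V x⟩ : TangentBundle 𝓘(ℝ, EM) M)) (σ q) →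
      DifferentiableAt ℝ (Vc V) (j q) := by
    intro V h
    have h1 := (mdifferentiableWithinAt_univ.2 h).differentiableWithinAt_mpullbackWithin_vectorField
    have h2 : DifferentiableWithinAt ℝ (Vc V) (κ.symm ⁻¹' univ ∩ range 𝓘(ℝ, EM)) (j q) := h1
    rwa [ModelWithCorners.range_eq_univ, preimage_univ, univ_inter,
      differentiableWithinAt_univ] at h2
  have hder : ∀ (v : EL → EL) (v' : EL →L[ℝ] EL) (V : ∀ x : M, TangentSpace 𝓘(ℝ, EM) x),
      HasFDerivAt v v' q → DifferentiableAt ℝ (Vc V) (j q) →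
      (∀ᶠ p in 𝓝 q, Vc V (j p) = fderiv ℝ j p (v p)) → ∀ z, fderiv ℝ (Vc V) (j q) (fderiv ℝ j q z) =
        fderiv ℝ (fderiv ℝ j) q z (v q) + fderiv ℝ j q (v' z) := by
    intro v v' V hv hV h z
    have hj1 : HasFDerivAt j (fderiv ℝ j q) q := (hj.differentiableAt (by simp)).hasFDerivAt
    have hj2 : HasFDerivAt (fderiv ℝ j) (fderiv ℝ (fderiv ℝ j) q) q :=
      ((hj.fderiv_right (m := ∞) (by simp)).differentiableAt (by simp)).hasFDerivAt
    have h1 := hV.hasFDerivAt.comp q hj1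
    have h2 := (hj2.clm_apply hv).congr_of_eventuallyEq h
    have h3 := congrArg (fun l : EL →L[ℝ] EM => l z) (h1.unique h2)
    simpa [add_comm] using h3
  have e1 := hder v v' V hv (hdiff V hV) (hVc v V hvV) (w q)
  have e2 := hder w w' W hw (hdiff W hW) (hVc w W hwW) (v q)
  have e3 : Vc V (j q) = fderiv ℝ j q (v q) := (hVc v V hvV).self_of_nhds
  have e4 : Vc W (j q) = fderiv ℝ j q (w q) := (hVc w W hwW).self_of_nhds
  have hsym : fderiv ℝ (fderiv ℝ j) q (v q) (w q) = fderiv ℝ (fderiv ℝ j) q (w q) (v q) :=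
    (hj.isSymmSndFDerivAt (by
      rw [minSmoothness_of_isRCLikeNormedField]
      exact WithTop.coe_le_coe.2 (le_top (a := (2 : ℕ∞))))) _ _
  have hinv : (mfderiv 𝓘(ℝ, EM) 𝓘(ℝ, EM) κ (σ q)).IsInvertible :=
    isInvertible_mfderiv_extChartAt hκq
  have hmain : VectorField.lieBracket ℝ (Vc V) (Vc W) (j q) =
      (mfderiv 𝓘(ℝ, EM) 𝓘(ℝ, EM) κ (σ q)
        (mfderiv 𝓘(ℝ, EL) 𝓘(ℝ, EM) σ q (w' (v q) - v' (w q) : EL)) : EM) := by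
    rw [VectorField.lieBracket, e3, e4, e1, e2, hsym, ← hjd.self_of_nhds, map_sub]
    abel
  unfold VectorField.mlieBracket
  rw [VectorField.mlieBracketWithin_apply, preimage_univ, univ_inter]
  refine hinv.inverse_apply_eq.2 (Eq.trans ?_ hmain)
  change VectorField.lieBracketWithin ℝ (Vc V) (Vc W) (range 𝓘(ℝ, EM)) (j q) = _
  rw [ModelWithCorners.range_eq_univ, VectorField.lieBracketWithin_univ]

end Related

/-! ### The restriction of a Lie algebroid to a leaf, in coordinates -/

namespace LieAlgebroid

section LeafCoordinates

variable {EM F EL M L : Type*}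
  [NormedAddCommGroup EM] [NormedSpace ℝ EM] [FiniteDimensional ℝ EM]
  [NormedAddCommGroup F] [NormedSpace ℝ F] [FiniteDimensional ℝ F]
  [NormedAddCommGroup EL] [NormedSpace ℝ EL] [FiniteDimensional ℝ EL]
  [TopologicalSpace M] [T2Space M] [ChartedSpace EM M] [IsManifold 𝓘(ℝ, EM) ∞ M]
  {A : M → Type*} [TopologicalSpace (TotalSpace F A)]
  [∀ x, AddCommGroup (A x)] [∀ x, Module ℝ (A x)] [∀ x, TopologicalSpace (A x)]
  [FiberBundle F A] [VectorBundle ℝ F A] [ContMDiffVectorBundle ∞ F A 𝓘(ℝ, EM)]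
  (𝒜 : LieAlgebroid EM F A)
  [TopologicalSpace L] [ChartedSpace EL L] [IsManifold 𝓘(ℝ, EL) ∞ L]
  (ι : C^∞⟮𝓘(ℝ, EL), L; 𝓘(ℝ, EM), M⟯)

/-- The immersion of the leaf in the chart at `y₀`. -/
def leafMap (y₀ : L) (q : EL) : M := ι ((extChartAt 𝓘(ℝ, EL) y₀).symm q)

/-- The coordinates of a section along the leaf. -/
def leafCoord (y₀ : L) (s : Cₛ^∞⟮𝓘(ℝ, EM); F, A⟯) (q : EL) : F :=
  triv F A (ι y₀) (leafMap ι y₀ q) (s (leafMap ι y₀ q))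

theorem contMDiffOn_leafMap (y₀ : L) :
    ContMDiffOn 𝓘(ℝ, EL) 𝓘(ℝ, EM) ∞ (leafMap ι y₀) (extChartAt 𝓘(ℝ, EL) y₀).target :=
  ι.contMDiff.comp_contMDiffOn (contMDiffOn_extChartAt_symm y₀)

theorem leafMap_extChartAt {y₀ y : L} (hy : y ∈ (extChartAt 𝓘(ℝ, EL) y₀).source) :
    leafMap ι y₀ (extChartAt 𝓘(ℝ, EL) y₀ y) = ι y := by
  rw [leafMap, (extChartAt 𝓘(ℝ, EL) y₀).left_inv hy]

/-- A coordinate domain `U` of the leaf, over which the sections `T w` are constant in the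
trivialization at `y₀` and `ρ` is the anchor. -/
structure IsLeafDomain (y₀ : L) (T : F →ₗ[ℝ] Cₛ^∞⟮𝓘(ℝ, EM); F, A⟯) (ρ : EL → F →L[ℝ] EL)
    (U : Set EL) : Prop where
  isOpen : IsOpen U
  mem : extChartAt 𝓘(ℝ, EL) y₀ y₀ ∈ U
  subset : U ⊆ (extChartAt 𝓘(ℝ, EL) y₀).target
  mem_baseSet : ∀ q ∈ U, leafMap ι y₀ q ∈ (trivializationAt F A (ι y₀)).baseSet
  frame : ∀ q ∈ U, ∀ᶠ x in 𝓝 (leafMap ι y₀ q), ∀ w,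
    T w x = (trivializationAt F A (ι y₀)).symmL ℝ x w
  contDiffOn_ρ : ContDiffOn ℝ ∞ ρ U
  anchor_eq : ∀ q ∈ U, ∀ w, (mfderiv 𝓘(ℝ, EL) 𝓘(ℝ, EM) (leafMap ι y₀) q (ρ q w) : EM) =
    𝒜.anchor (leafMap ι y₀ q) (T w (leafMap ι y₀ q))
  injective : ∀ q ∈ U, Function.Injective (mfderiv 𝓘(ℝ, EL) 𝓘(ℝ, EM) (leafMap ι y₀) q)
  surjective : ∀ q ∈ U, Function.Surjective (ρ q)

theorem hasMFDerivAt_leafMap {y₀ : L} {q : EL} (hq : q ∈ (extChartAt 𝓘(ℝ, EL) y₀).target) :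
    HasMFDerivAt 𝓘(ℝ, EL) 𝓘(ℝ, EM) (leafMap ι y₀) q
      (mfderiv 𝓘(ℝ, EL) 𝓘(ℝ, EM) (leafMap ι y₀) q) :=
  (((contMDiffOn_leafMap ι y₀).contMDiffAt ((isOpen_extChartAt_target y₀).mem_nhds hq)
    ).mdifferentiableAt (by simp)).hasMFDerivAt

theorem mfderiv_leafMap {y₀ : L} {q : EL} (hq : q ∈ (extChartAt 𝓘(ℝ, EL) y₀).target) (u : EL) :
    (mfderiv 𝓘(ℝ, EL) 𝓘(ℝ, EM) (leafMap ι y₀) q u : EM) =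
      mfderiv 𝓘(ℝ, EL) 𝓘(ℝ, EM) ι ((extChartAt 𝓘(ℝ, EL) y₀).symm q)
        (mfderiv 𝓘(ℝ, EL) 𝓘(ℝ, EL) (extChartAt 𝓘(ℝ, EL) y₀).symm q u) := by
  have : IsManifold 𝓘(ℝ, EL) 1 L := IsManifold.of_le (n := ∞) (by simp)
  have h := HasMFDerivAt.comp q
    ((ι.contMDiff.mdifferentiable (by simp) ((extChartAt 𝓘(ℝ, EL) y₀).symm q)).hasMFDerivAt)
    (hasMFDerivAt_extChartAt_symm 𝓘(ℝ, EL) y₀ hq)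
  exact congrArg (fun l : EL →L[ℝ] EM => l u) h.mfderiv

/-- The anchor of a smooth section is smooth in charts. -/
theorem contMDiffOn_anchor_chart (x₀ : M) (s : Cₛ^∞⟮𝓘(ℝ, EM); F, A⟯) :
    ContMDiffOn 𝓘(ℝ, EM) 𝓘(ℝ, EM) ∞
      (fun x => (mfderiv 𝓘(ℝ, EM) 𝓘(ℝ, EM) (extChartAt 𝓘(ℝ, EM) x₀) x (𝒜.anchor x (s x)) : EM))
      (extChartAt 𝓘(ℝ, EM) x₀).source := by
  have : IsManifold 𝓘(ℝ, EM) 1 M := IsManifold.of_le (n := ∞) (by simp)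
  have hV : ContMDiff 𝓘(ℝ, EM) 𝓘(ℝ, EM).tangent ∞
      (fun x => (⟨x, 𝒜.anchor x (s x)⟩ : TangentBundle 𝓘(ℝ, EM) M)) :=
    𝒜.contMDiff_anchor.comp s.contMDiff
  rw [extChartAt_source]
  refine (((trivializationAt EM (TangentSpace 𝓘(ℝ, EM)) x₀).contMDiffOn_section_baseSet_iff
    (IB := 𝓘(ℝ, EM)) (n := ∞) (s := fun x => 𝒜.anchor x (s x))).1 hV.contMDiffOn).congr
    fun x hx => ?_
  have h1 : ((trivializationAt EM (TangentSpace 𝓘(ℝ, EM)) x₀).continuousLinearMapAt ℝ x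
      (𝒜.anchor x (s x)) : EM) =
      (trivializationAt EM (TangentSpace 𝓘(ℝ, EM)) x₀ ⟨x, 𝒜.anchor x (s x)⟩).2 := by
    rw [Trivialization.continuousLinearMapAt_apply, Trivialization.coe_linearMapAt_of_mem _ hx]
  exact (congrArg (fun l : EM →L[ℝ] EM => l (𝒜.anchor x (s x)))
    (TangentBundle.continuousLinearMapAt_trivializationAt hx)).symm.trans h1

variable {𝒜 ι} in
/-- Every point of a leaf has such a coordinate domain. The differential of the immersion of the
leaf is injective and has the image of the anchor as its image, so the anchor lifts to `ρ`. The
lift is smooth, because a left inverse of the differential at `y₀` composes to an invertible map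
with the differentials at nearby points. -/
theorem exists_isLeafDomain (hL : 𝒜.IsLeaf ι) (y₀ : L) :
    ∃ T ρ U, IsLeafDomain 𝒜 ι y₀ T ρ U := by
  have : IsManifold 𝓘(ℝ, EL) 1 L := IsManifold.of_le (n := ∞) (by simp)
  have : IsManifold 𝓘(ℝ, EM) 1 M := IsManifold.of_le (n := ∞) (by simp)
  have : CompleteSpace EL := FiniteDimensional.complete ℝ EL
  obtain ⟨T, hT⟩ := exists_frame (EM := EM) (F := F) (A := A) (ι y₀)
  set e := trivializationAt F A (ι y₀)
  set φ := extChartAt 𝓘(ℝ, EL) y₀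
  set κ := extChartAt 𝓘(ℝ, EM) (ι y₀)
  set q₀ := φ y₀
  set σ := leafMap ι y₀
  have hσq₀ : σ q₀ = ι y₀ := leafMap_extChartAt ι (mem_extChartAt_source y₀)
  obtain ⟨W, hW, hWo, hWx⟩ :
      ∃ W ⊆ {x | (∀ w, T w x = e.symmL ℝ x w) ∧ x ∈ e.baseSet ∧ x ∈ κ.source},
      IsOpen W ∧ ι y₀ ∈ W := by
    refine mem_nhds_iff.1 ?_
    filter_upwards [hT, e.open_baseSet.mem_nhds (FiberBundle.mem_baseSet_trivializationAt' (ι y₀)),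
      extChartAt_source_mem_nhds (I := 𝓘(ℝ, EM)) (ι y₀)] with x h1 h2 h3 using ⟨h1, h2, h3⟩
  have hσ := contMDiffOn_leafMap ι y₀
  have hφo : IsOpen φ.target := isOpen_extChartAt_target y₀
  let U₀ : Set EL := φ.target ∩ σ ⁻¹' W
  have hU₀ : IsOpen U₀ := hσ.continuousOn.isOpen_inter_preimage hφo hWo
  have hq₀ : q₀ ∈ U₀ := ⟨mem_extChartAt_target y₀, by change σ q₀ ∈ W; rwa [hσq₀]⟩
  -- the differential of the immersion has the same image as the anchor
  have hinj : ∀ q ∈ U₀, Function.Injective (mfderiv 𝓘(ℝ, EL) 𝓘(ℝ, EM) σ q) := by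
    intro q hq z w hzw
    have h1 := (mfderiv_leafMap ι hq.1 z).symm.trans (hzw.trans (mfderiv_leafMap ι hq.1 w))
    have h2 := hL.immersion _ h1
    have h3 := congrArg (mfderiv 𝓘(ℝ, EL) 𝓘(ℝ, EL) φ (φ.symm q)) h2
    exact (mfderiv_extChartAt_symm_apply 𝓘(ℝ, EL) y₀ hq.1 z).symm.trans
      (h3.trans (mfderiv_extChartAt_symm_apply 𝓘(ℝ, EL) y₀ hq.1 w))
  have hrange : ∀ q ∈ U₀, ∀ v : A (σ q), ∃ z : EL,
      (mfderiv 𝓘(ℝ, EL) 𝓘(ℝ, EM) σ q z : EM) = 𝒜.anchor (σ q) v := by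
    intro q hq v
    have h1 : 𝒜.anchor (σ q) v ∈ range (mfderiv 𝓘(ℝ, EL) 𝓘(ℝ, EM) ι (φ.symm q)) := by
      rw [hL.tangent]
      exact ⟨v, rfl⟩
    obtain ⟨z, hz⟩ := h1
    refine ⟨mfderiv 𝓘(ℝ, EL) 𝓘(ℝ, EL) φ (φ.symm q) z, ?_⟩
    rw [← hz]
    refine (mfderiv_leafMap ι hq.1 _).trans ?_
    have h2 := mfderiv_symm_extChartAt_apply 𝓘(ℝ, EL) y₀ (φ.map_target hq.1) z
    have h3 : φ (φ.symm q) = q := φ.right_inv hq.1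
    rw [h3] at h2
    exact congrArg (mfderiv 𝓘(ℝ, EL) 𝓘(ℝ, EM) ι (φ.symm q)) h2
  have hrange' : ∀ q ∈ U₀, ∀ z : EL, ∃ v : A (σ q),
      𝒜.anchor (σ q) v = (mfderiv 𝓘(ℝ, EL) 𝓘(ℝ, EM) σ q z : EM) := by
    intro q hq z
    have h1 : (mfderiv 𝓘(ℝ, EL) 𝓘(ℝ, EM) ι (φ.symm q)
        (mfderiv 𝓘(ℝ, EL) 𝓘(ℝ, EL) φ.symm q z) : EM) ∈ range (𝒜.anchor (σ q)) := by
      have := hL.tangent (φ.symm q)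
      exact this ▸ ⟨_, rfl⟩
    obtain ⟨v, hv⟩ := h1
    exact ⟨v, hv.trans (mfderiv_leafMap ι hq.1 z).symm⟩
  -- the anchor and the immersion in the charts
  let ev : ∀ q, F →ₗ[ℝ] A (σ q) := fun q =>
    ⟨⟨fun w => T w (σ q), fun v w => by simp⟩, fun c w => by simp⟩
  let R : EL → F →L[ℝ] EM := fun q => LinearMap.toContinuousLinearMap
    (((mfderiv 𝓘(ℝ, EM) 𝓘(ℝ, EM) κ (σ q)).toLinearMap ∘ₗ (𝒜.anchor (σ q)).toLinearMap ∘ₗ ev q :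
      F →ₗ[ℝ] EM))
  have hR : ContDiffOn ℝ ∞ R U₀ := by
    rw [contDiffOn_clm_apply]
    intro w
    rw [← contMDiffOn_iff_contDiffOn]
    exact (contMDiffOn_anchor_chart 𝒜 (ι y₀) (T w)).comp (hσ.mono inter_subset_left)
      fun q hq => (hW hq.2).2.2
  let j : EL → EM := fun q => κ (σ q)
  have hj : ContDiffOn ℝ ∞ j U₀ := by
    rw [← contMDiffOn_iff_contDiffOn]
    exact (contMDiffOn_extChartAt (n := ∞)).comp (hσ.mono inter_subset_left)
      fun q hq => by have := (hW hq.2).2.2; rwa [extChartAt_source] at this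
  have hj' : ContDiffOn ℝ ∞ (fderiv ℝ j) U₀ := hj.fderiv_of_isOpen hU₀ (by simp)
  have hjd : ∀ q ∈ U₀, ∀ z : EL, (fderiv ℝ j q z : EM) =
      mfderiv 𝓘(ℝ, EM) 𝓘(ℝ, EM) κ (σ q) (mfderiv 𝓘(ℝ, EL) 𝓘(ℝ, EM) σ q z) := by
    intro q hq z
    have h := HasMFDerivAt.comp q (hasMFDerivAt_extChartAt' 𝓘(ℝ, EM) (ι y₀) (hW hq.2).2.2)
      (hasMFDerivAt_leafMap ι hq.1)
    have h2 : mfderiv 𝓘(ℝ, EL) 𝓘(ℝ, EM) j q = _ := h.mfderiv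
    rw [mfderiv_eq_fderiv] at h2
    rw [h2]
    rfl
  obtain ⟨l, hl⟩ : ∃ l : EM →L[ℝ] EL, ∀ z, l (fderiv ℝ j q₀ z) = z := by
    have hker : LinearMap.ker (fderiv ℝ j q₀).toLinearMap = ⊥ := by
      rw [LinearMap.ker_eq_bot]
      intro z w hzw
      refine hinj q₀ hq₀ ((isInvertible_mfderiv_extChartAt (hW hq₀.2).2.2).injective ?_)
      exact (hjd q₀ hq₀ z).symm.trans (hzw.trans (hjd q₀ hq₀ w))
    obtain ⟨g, hg⟩ := LinearMap.exists_leftInverse_of_injective _ hker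
    exact ⟨LinearMap.toContinuousLinearMap g, fun z => congrArg (fun f : EL →ₗ[ℝ] EL => f z) hg⟩
  -- where `l ∘ dj` is invertible, `(l ∘ dj)⁻¹ ∘ l` inverts `dj` on its image
  let P : EL → EL →L[ℝ] EL := fun q => l ∘L fderiv ℝ j q
  have hP : ContDiffOn ℝ ∞ P U₀ := contDiffOn_const.clm_comp hj'
  let U : Set EL := U₀ ∩ P ⁻¹' {f | IsUnit f}
  have hU : IsOpen U := hP.continuousOn.isOpen_inter_preimage hU₀ Units.isOpen
  have hPU : ∀ q ∈ U, ∃ f : EL ≃L[ℝ] EL, (f : EL →L[ℝ] EL) = P q := by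
    intro q hq
    obtain ⟨f, hf⟩ := hq.2
    exact ⟨ContinuousLinearEquiv.unitsEquiv ℝ EL f, hf⟩
  let ρ : EL → F →L[ℝ] EL := fun q => (P q).inverse ∘L l ∘L R q
  have hρ : ∀ q ∈ U, ∀ (w : F) (z : EL), (mfderiv 𝓘(ℝ, EL) 𝓘(ℝ, EM) σ q z : EM) =
      𝒜.anchor (σ q) (T w (σ q)) → ρ q w = z := by
    intro q hq w z hz
    obtain ⟨f, hf⟩ := hPU q hq
    have h1 : R q w = fderiv ℝ j q z := by
      rw [hjd q hq.1 z]
      exact congrArg (mfderiv 𝓘(ℝ, EM) 𝓘(ℝ, EM) κ (σ q)) hz.symm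
    change (P q).inverse (l (R q w)) = z
    rw [h1]
    change (P q).inverse (P q z) = z
    rw [← hf]
    simp
  refine ⟨T, ρ, U, hU, ⟨hq₀, ?_⟩, fun q hq => hq.1.1, fun q hq => (hW hq.1.2).2.1,
    fun q hq => ?_, ?_, fun q hq w => ?_, fun q hq => hinj q hq.1, fun q hq z => ?_⟩
  · have : P q₀ = 1 := by
      ext z
      exact hl z
    change IsUnit (P q₀)
    rw [this]
    exact isUnit_one
  · filter_upwards [hWo.mem_nhds hq.1.2] with x hx using (hW hx).1
  · exact (contDiffOn_inverse (hP.mono inter_subset_left) hPU).clm_comp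
      (contDiffOn_const.clm_comp (hR.mono inter_subset_left))
  · obtain ⟨z, hz⟩ := hrange q hq.1 (T w (σ q))
    rw [hρ q hq w z hz]
    exact hz
  · obtain ⟨v, hv⟩ := hrange' q hq.1 z
    refine ⟨triv F A (ι y₀) (σ q) v, hρ q hq _ z ?_⟩
    rw [frame_triv (hW hq.1.2).2.1 (by
      filter_upwards [hWo.mem_nhds hq.1.2] with x hx using (hW hx).1)]
    exact hv.symm

end LeafCoordinates

end LieAlgebroid

/-! ### The bracket along a leaf -/

namespace LieAlgebroid

section LeafBracket

variable {EM F EL M L : Type*}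
  [NormedAddCommGroup EM] [NormedSpace ℝ EM] [FiniteDimensional ℝ EM]
  [NormedAddCommGroup F] [NormedSpace ℝ F] [FiniteDimensional ℝ F]
  [NormedAddCommGroup EL] [NormedSpace ℝ EL] [FiniteDimensional ℝ EL]
  [TopologicalSpace M] [T2Space M] [ChartedSpace EM M] [IsManifold 𝓘(ℝ, EM) ∞ M]
  {A : M → Type*} [TopologicalSpace (TotalSpace F A)]
  [∀ x, AddCommGroup (A x)] [∀ x, Module ℝ (A x)] [∀ x, TopologicalSpace (A x)]
  [FiberBundle F A] [VectorBundle ℝ F A] [ContMDiffVectorBundle ∞ F A 𝓘(ℝ, EM)]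
  (𝒜 : LieAlgebroid EM F A)
  [TopologicalSpace L] [ChartedSpace EL L] [IsManifold 𝓘(ℝ, EL) ∞ L]
  (ι : C^∞⟮𝓘(ℝ, EL), L; 𝓘(ℝ, EM), M⟯)

variable {𝒜 ι} {y₀ : L} {T : F →ₗ[ℝ] Cₛ^∞⟮𝓘(ℝ, EM); F, A⟯} {ρ : EL → F →L[ℝ] EL} {U : Set EL}
  {q : EL}

theorem IsLeafDomain.triv_frame (hD : IsLeafDomain 𝒜 ι y₀ T ρ U) (hq : q ∈ U) (w : F) :
    triv F A (ι y₀) (leafMap ι y₀ q) (T w (leafMap ι y₀ q)) = w :=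
  LieAlgebroid.triv_frame (hD.mem_baseSet q hq) (hD.frame q hq) w

theorem IsLeafDomain.frame_triv (hD : IsLeafDomain 𝒜 ι y₀ T ρ U) (hq : q ∈ U)
    (v : A (leafMap ι y₀ q)) : T (triv F A (ι y₀) (leafMap ι y₀ q) v) (leafMap ι y₀ q) = v :=
  LieAlgebroid.frame_triv (hD.mem_baseSet q hq) (hD.frame q hq) v

theorem IsLeafDomain.mfderiv_ρ (hD : IsLeafDomain 𝒜 ι y₀ T ρ U) (hq : q ∈ U)
    (v : A (leafMap ι y₀ q)) :
    (mfderiv 𝓘(ℝ, EL) 𝓘(ℝ, EM) (leafMap ι y₀) q (ρ q (triv F A (ι y₀) (leafMap ι y₀ q) v)) : EM) =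
      𝒜.anchor (leafMap ι y₀ q) v :=
  (hD.anchor_eq q hq _).trans (by rw [hD.frame_triv hq])

theorem IsLeafDomain.contDiffOn_leafCoord (hD : IsLeafDomain 𝒜 ι y₀ T ρ U)
    (s : Cₛ^∞⟮𝓘(ℝ, EM); F, A⟯) : ContDiffOn ℝ ∞ (leafCoord ι y₀ s) U := by
  rw [← contMDiffOn_iff_contDiffOn]
  exact (contMDiffOn_triv (ι y₀) s).comp ((contMDiffOn_leafMap ι y₀).mono hD.subset) hD.mem_baseSet

theorem IsLeafDomain.leafCoord_frame (hD : IsLeafDomain 𝒜 ι y₀ T ρ U) (hq : q ∈ U) (w : F) :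
    leafCoord ι y₀ (T w) q = w := hD.triv_frame hq w

theorem IsLeafDomain.fderiv_leafCoord_frame (hD : IsLeafDomain 𝒜 ι y₀ T ρ U) (hq : q ∈ U) (w : F) :
    fderiv ℝ (leafCoord ι y₀ (T w)) q = 0 := by
  have h : leafCoord ι y₀ (T w) =ᶠ[𝓝 q] fun _ => w := by
    filter_upwards [hD.isOpen.mem_nhds hq] with p hp using hD.leafCoord_frame hp w
  rw [h.fderiv_eq]
  simp

theorem IsLeafDomain.hasFDerivAt_leafCoord (hD : IsLeafDomain 𝒜 ι y₀ T ρ U) (hq : q ∈ U)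
    (s : Cₛ^∞⟮𝓘(ℝ, EM); F, A⟯) :
    HasFDerivAt (leafCoord ι y₀ s) (fderiv ℝ (leafCoord ι y₀ s) q) q :=
  (((hD.contDiffOn_leafCoord s).contDiffAt (hD.isOpen.mem_nhds hq)).differentiableAt
    (by simp)).hasFDerivAt

/-- The derivative of a function on `M` along the leaf. -/
theorem mfderiv_comp_leafMap {G : Type*} [NormedAddCommGroup G] [NormedSpace ℝ G]
    (hD : IsLeafDomain 𝒜 ι y₀ T ρ U) (hq : q ∈ U) {f : M → G}
    (hf : MDifferentiableAt 𝓘(ℝ, EM) 𝓘(ℝ, G) f (leafMap ι y₀ q)) {f' : EL →L[ℝ] G}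
    (hf' : HasFDerivAt (fun p => f (leafMap ι y₀ p)) f' q) (v : A (leafMap ι y₀ q)) :
    (mfderiv 𝓘(ℝ, EM) 𝓘(ℝ, G) f (leafMap ι y₀ q) (𝒜.anchor (leafMap ι y₀ q) v) : G) =
      f' (ρ q (triv F A (ι y₀) (leafMap ι y₀ q) v)) := by
  have h1 := HasMFDerivAt.comp q hf.hasMFDerivAt (hasMFDerivAt_leafMap ι (hD.subset hq))
  have h2 := hasMFDerivAt_unique hf'.hasMFDerivAt h1
  rw [← hD.mfderiv_ρ hq v]
  exact (congrArg (fun l : EL →L[ℝ] G => l (ρ q (triv F A (ι y₀) (leafMap ι y₀ q) v))) h2).symm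

variable (𝒜 ι y₀ T) in
/-- The structure functions of the bracket in the frame `T`. -/
def leafBracket (q : EL) : F →L[ℝ] F →L[ℝ] F :=
  LinearMap.toContinuousBilinearMap (LinearMap.mk₂ ℝ
    (fun ξ η => triv F A (ι y₀) (leafMap ι y₀ q) (𝒜.bracket (T ξ) (T η) (leafMap ι y₀ q)))
    (fun ξ ξ' η => by simp) (fun c ξ η => by simp) (fun ξ η η' => by simp) (fun c ξ η => by simp))

theorem leafBracket_apply (q : EL) (ξ η : F) : leafBracket 𝒜 ι y₀ T q ξ η =
    leafCoord ι y₀ (𝒜.bracket (T ξ) (T η)) q := rfl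

theorem IsLeafDomain.contDiffOn_leafBracket (hD : IsLeafDomain 𝒜 ι y₀ T ρ U) :
    ContDiffOn ℝ ∞ (leafBracket 𝒜 ι y₀ T) U := by
  rw [contDiffOn_clm_apply]
  intro ξ
  rw [contDiffOn_clm_apply]
  intro η
  exact hD.contDiffOn_leafCoord _

theorem leafBracket_skew (q : EL) (ξ η : F) :
    leafBracket 𝒜 ι y₀ T q ξ η = - leafBracket 𝒜 ι y₀ T q η ξ := by
  rw [leafBracket_apply, leafBracket_apply, 𝒜.bracket_skew (T ξ)]
  exact (triv F A (ι y₀) (leafMap ι y₀ q)).map_neg _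

/-- The bracket of sections along the leaf. -/
theorem IsLeafDomain.leafCoord_bracket (hD : IsLeafDomain 𝒜 ι y₀ T ρ U) (hq : q ∈ U)
    (a b : Cₛ^∞⟮𝓘(ℝ, EM); F, A⟯) :
    leafCoord ι y₀ (𝒜.bracket a b) q =
      leafBracket 𝒜 ι y₀ T q (leafCoord ι y₀ a q) (leafCoord ι y₀ b q)
      + fderiv ℝ (leafCoord ι y₀ b) q (ρ q (leafCoord ι y₀ a q))
      - fderiv ℝ (leafCoord ι y₀ a) q (ρ q (leafCoord ι y₀ b q)) := by
  have hd : ∀ s : Cₛ^∞⟮𝓘(ℝ, EM); F, A⟯, MDifferentiableAt 𝓘(ℝ, EM) 𝓘(ℝ, F)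
      (fun x => triv F A (ι y₀) x (s x)) (leafMap ι y₀ q) := fun s =>
    ((contMDiffOn_triv (ι y₀) s).contMDiffAt ((trivializationAt F A (ι y₀)).open_baseSet.mem_nhds
      (hD.mem_baseSet q hq))).mdifferentiableAt (by simp)
  have h := 𝒜.triv_bracket (hD.mem_baseSet q hq) (hD.frame q hq) a b (hd a).hasMFDerivAt
    (hd b).hasMFDerivAt
  refine h.trans ?_
  have h1 := mfderiv_comp_leafMap hD hq (hd b) (hD.hasFDerivAt_leafCoord hq b)
    (a (leafMap ι y₀ q))
  have h2 := mfderiv_comp_leafMap hD hq (hd a) (hD.hasFDerivAt_leafCoord hq a)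
    (b (leafMap ι y₀ q))
  exact congrArg₂ (· - ·) (congrArg₂ (· + ·) rfl h1) h2

theorem IsLeafDomain.anchor_leafBracket (hD : IsLeafDomain 𝒜 ι y₀ T ρ U) (hq : q ∈ U) (ξ η : F) :
    ρ q (leafBracket 𝒜 ι y₀ T q ξ η) =
      fderiv ℝ ρ q (ρ q ξ) η - fderiv ℝ ρ q (ρ q η) ξ := by
  have hρ : HasFDerivAt ρ (fderiv ℝ ρ q) q :=
    ((hD.contDiffOn_ρ.contDiffAt (hD.isOpen.mem_nhds hq)).differentiableAt (by simp)).hasFDerivAt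
  have hρw : ∀ w : F, HasFDerivAt (fun p => ρ p w) ((fderiv ℝ ρ q).flip w) q := fun w =>
    (hρ.clm_apply (hasFDerivAt_const w q)).congr_fderiv (by ext; simp)
  have hV : ∀ w : F, MDifferentiableAt 𝓘(ℝ, EM) 𝓘(ℝ, EM).tangent
      (fun x => (⟨x, 𝒜.anchor x (T w x)⟩ : TangentBundle 𝓘(ℝ, EM) M)) (leafMap ι y₀ q) := fun w =>
    (𝒜.contMDiff_anchor.comp (T w).contMDiff).mdifferentiable (by simp) _
  have hr : ∀ w : F, ∀ᶠ p in 𝓝 q, (mfderiv 𝓘(ℝ, EL) 𝓘(ℝ, EM) (leafMap ι y₀) p (ρ p w) : EM) =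
      𝒜.anchor (leafMap ι y₀ p) (T w (leafMap ι y₀ p)) := fun w => by
    filter_upwards [hD.isOpen.mem_nhds hq] with p hp using hD.anchor_eq p hp w
  have h := mlieBracket_of_related ((contMDiffOn_leafMap ι y₀).contMDiffAt
    ((isOpen_extChartAt_target y₀).mem_nhds (hD.subset hq))) (hρw ξ) (hρw η) (hV ξ) (hV η)
    (hr ξ) (hr η)
  rw [← 𝒜.anchor_bracket] at h
  refine hD.injective q hq (Eq.trans ?_ h)
  exact hD.mfderiv_ρ hq _

theorem IsLeafDomain.jacobi_leafBracket (hD : IsLeafDomain 𝒜 ι y₀ T ρ U) (hq : q ∈ U)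
    (ξ η ζ : F) : leafBracket 𝒜 ι y₀ T q ξ (leafBracket 𝒜 ι y₀ T q η ζ) +
      leafBracket 𝒜 ι y₀ T q η (leafBracket 𝒜 ι y₀ T q ζ ξ) +
      leafBracket 𝒜 ι y₀ T q ζ (leafBracket 𝒜 ι y₀ T q ξ η) +
      fderiv ℝ (leafBracket 𝒜 ι y₀ T) q (ρ q ξ) η ζ +
      fderiv ℝ (leafBracket 𝒜 ι y₀ T) q (ρ q η) ζ ξ +
      fderiv ℝ (leafBracket 𝒜 ι y₀ T) q (ρ q ζ) ξ η = 0 := by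
  have hc : HasFDerivAt (leafBracket 𝒜 ι y₀ T) (fderiv ℝ (leafBracket 𝒜 ι y₀ T) q) q :=
    ((hD.contDiffOn_leafBracket.contDiffAt (hD.isOpen.mem_nhds hq)).differentiableAt
      (by simp)).hasFDerivAt
  have key : ∀ x y z : F, leafCoord ι y₀ (𝒜.bracket (T x) (𝒜.bracket (T y) (T z))) q =
      leafBracket 𝒜 ι y₀ T q x (leafBracket 𝒜 ι y₀ T q y z) +
        fderiv ℝ (leafBracket 𝒜 ι y₀ T) q (ρ q x) y z := by
    intro x y z
    rw [hD.leafCoord_bracket hq, hD.leafCoord_frame hq, hD.fderiv_leafCoord_frame hq,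
      ← leafBracket_apply]
    have h1 := (hc.clm_apply (hasFDerivAt_const y q)).clm_apply (hasFDerivAt_const z q)
    have h2 := congrArg (fun l : EL →L[ℝ] F => l (ρ q x)) h1.fderiv
    have h3 : (fun p => leafBracket 𝒜 ι y₀ T p y z) = leafCoord ι y₀ (𝒜.bracket (T y) (T z)) := rfl
    rw [h3] at h2
    rw [h2]
    simp
  have h := congrArg (fun s : Cₛ^∞⟮𝓘(ℝ, EM); F, A⟯ => leafCoord ι y₀ s q)
    (𝒜.jacobi (T ξ) (T η) (T ζ))
  have hadd : ∀ s t : Cₛ^∞⟮𝓘(ℝ, EM); F, A⟯,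
      leafCoord ι y₀ (s + t) q = leafCoord ι y₀ s q + leafCoord ι y₀ t q := fun s t =>
    (triv F A (ι y₀) (leafMap ι y₀ q)).map_add _ _
  have hzero : leafCoord ι y₀ (0 : Cₛ^∞⟮𝓘(ℝ, EM); F, A⟯) q = 0 :=
    (triv F A (ι y₀) (leafMap ι y₀ q)).map_zero
  simp only [hadd, hzero, key] at h
  rw [← h]
  abel

end LeafBracket

end LieAlgebroid

/-! ### The metric and the Levi-Civita connection along a leaf -/

namespace LieAlgebroid

section LeafMetric

variable {EM F EL M L : Type*}
  [NormedAddCommGroup EM] [NormedSpace ℝ EM] [FiniteDimensional ℝ EM]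
  [NormedAddCommGroup F] [NormedSpace ℝ F] [FiniteDimensional ℝ F]
  [NormedAddCommGroup EL] [NormedSpace ℝ EL] [FiniteDimensional ℝ EL]
  [TopologicalSpace M] [T2Space M] [ChartedSpace EM M] [IsManifold 𝓘(ℝ, EM) ∞ M]
  {A : M → Type*} [TopologicalSpace (TotalSpace F A)]
  [∀ x, NormedAddCommGroup (A x)] [∀ x, InnerProductSpace ℝ (A x)]
  [FiberBundle F A] [VectorBundle ℝ F A] [ContMDiffVectorBundle ∞ F A 𝓘(ℝ, EM)]
  [IsContMDiffRiemannianBundle 𝓘(ℝ, EM) ∞ F A]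
  {𝒜 : LieAlgebroid EM F A}
  [TopologicalSpace L] [ChartedSpace EL L] [IsManifold 𝓘(ℝ, EL) ∞ L]
  {ι : C^∞⟮𝓘(ℝ, EL), L; 𝓘(ℝ, EM), M⟯}
  {y₀ : L} {T : F →ₗ[ℝ] Cₛ^∞⟮𝓘(ℝ, EM); F, A⟯} {ρ : EL → F →L[ℝ] EL} {U : Set EL} {q : EL}

variable (ι y₀ T) in
/-- The metric in the frame `T`. -/
def leafForm (q : EL) : F →L[ℝ] F →L[ℝ] ℝ :=
  LinearMap.toContinuousBilinearMap (LinearMap.mk₂ ℝ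
    (fun ξ η => inner ℝ (T ξ (leafMap ι y₀ q)) (T η (leafMap ι y₀ q)))
    (fun ξ ξ' η => by simp [inner_add_left]) (fun c ξ η => by simp [inner_smul_left])
    (fun ξ η η' => by simp [inner_add_right]) (fun c ξ η => by simp [inner_smul_right]))

theorem leafForm_apply (q : EL) (ξ η : F) : leafForm ι y₀ T q ξ η =
    inner ℝ (T ξ (leafMap ι y₀ q)) (T η (leafMap ι y₀ q)) := rfl

theorem contMDiff_inner (a b : Cₛ^∞⟮𝓘(ℝ, EM); F, A⟯) :
    ContMDiff 𝓘(ℝ, EM) 𝓘(ℝ, ℝ) ∞ (fun x => (inner ℝ (a x) (b x) : ℝ)) :=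
  a.contMDiff.inner_bundle b.contMDiff

theorem IsLeafDomain.contDiffOn_leafForm (hD : IsLeafDomain 𝒜 ι y₀ T ρ U) :
    ContDiffOn ℝ ∞ (leafForm ι y₀ T) U := by
  rw [contDiffOn_clm_apply]
  intro ξ
  rw [contDiffOn_clm_apply]
  intro η
  rw [← contMDiffOn_iff_contDiffOn]
  exact (contMDiff_inner (T ξ) (T η)).comp_contMDiffOn
    ((contMDiffOn_leafMap ι y₀).mono hD.subset)

theorem IsLeafDomain.inner_eq (hD : IsLeafDomain 𝒜 ι y₀ T ρ U) (hq : q ∈ U)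
    (v w : A (leafMap ι y₀ q)) : inner ℝ v w = leafForm ι y₀ T q
      (triv F A (ι y₀) (leafMap ι y₀ q) v) (triv F A (ι y₀) (leafMap ι y₀ q) w) := by
  rw [leafForm_apply, hD.frame_triv hq, hD.frame_triv hq]

theorem leafForm_symm (q : EL) (ξ η : F) : leafForm ι y₀ T q ξ η = leafForm ι y₀ T q η ξ :=
  real_inner_comm _ _

theorem IsLeafDomain.leafForm_pos (hD : IsLeafDomain 𝒜 ι y₀ T ρ U) (hq : q ∈ U) (ξ : F)
    (hξ : ξ ≠ 0) : 0 < leafForm ι y₀ T q ξ ξ := by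
  rw [leafForm_apply]
  refine real_inner_self_pos.2 fun h0 => hξ ?_
  rw [← hD.triv_frame hq ξ, h0, map_zero]

theorem IsLeafDomain.hasFDerivAt_leafForm (hD : IsLeafDomain 𝒜 ι y₀ T ρ U) (hq : q ∈ U) :
    HasFDerivAt (leafForm ι y₀ T) (fderiv ℝ (leafForm ι y₀ T) q) q :=
  ((hD.contDiffOn_leafForm.contDiffAt (hD.isOpen.mem_nhds hq)).differentiableAt
    (by simp)).hasFDerivAt

/-- The right hand side of the Koszul formula for constant sections. -/
def koszulForm (G : EL → F →L[ℝ] F →L[ℝ] ℝ) (ρ : EL → F →L[ℝ] EL) (c : EL → F →L[ℝ] F →L[ℝ] F)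
    (q : EL) (ξ η ζ : F) : ℝ :=
  fderiv ℝ G q (ρ q ξ) η ζ + fderiv ℝ G q (ρ q η) ξ ζ
    - fderiv ℝ G q (ρ q ζ) ξ η + G q (c q ζ ξ) η + G q (c q ζ η) ξ + G q (c q ξ η) ζ

theorem IsLeafDomain.anchorDeriv_inner (hD : IsLeafDomain 𝒜 ι y₀ T ρ U) (hq : q ∈ U)
    (a b c : Cₛ^∞⟮𝓘(ℝ, EM); F, A⟯) :
    𝒜.anchorDeriv (a (leafMap ι y₀ q)) (fun x => inner ℝ (b x) (c x)) =
      fderiv ℝ (leafForm ι y₀ T) q (ρ q (leafCoord ι y₀ a q)) (leafCoord ι y₀ b q)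
        (leafCoord ι y₀ c q) +
      leafForm ι y₀ T q (fderiv ℝ (leafCoord ι y₀ b) q (ρ q (leafCoord ι y₀ a q)))
        (leafCoord ι y₀ c q) +
      leafForm ι y₀ T q (leafCoord ι y₀ b q)
        (fderiv ℝ (leafCoord ι y₀ c) q (ρ q (leafCoord ι y₀ a q))) := by
  have h1 := ((hD.hasFDerivAt_leafForm hq).clm_apply (hD.hasFDerivAt_leafCoord hq b)).clm_apply
    (hD.hasFDerivAt_leafCoord hq c)
  have h2 := h1.congr_of_eventuallyEq
    (f₁ := fun p => (inner ℝ (b (leafMap ι y₀ p)) (c (leafMap ι y₀ p)) : ℝ)) (by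
      filter_upwards [hD.isOpen.mem_nhds hq] with p hp using hD.inner_eq hp _ _)
  have h3 := mfderiv_comp_leafMap hD hq (f := fun x => (inner ℝ (b x) (c x) : ℝ))
    ((contMDiff_inner b c).mdifferentiable (by simp) _) h2 (a (leafMap ι y₀ q))
  refine Eq.trans h3 ?_
  simp [leafCoord]
  ring

/-- The Koszul formula along the leaf. -/
theorem IsLeafDomain.koszul_eq (hD : IsLeafDomain 𝒜 ι y₀ T ρ U) (hq : q ∈ U)
    (a b c : Cₛ^∞⟮𝓘(ℝ, EM); F, A⟯) :
    𝒜.koszul a b c (leafMap ι y₀ q) =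
      koszulForm (leafForm ι y₀ T) ρ (leafBracket 𝒜 ι y₀ T) q (leafCoord ι y₀ a q)
        (leafCoord ι y₀ b q) (leafCoord ι y₀ c q) +
      2 * leafForm ι y₀ T q (fderiv ℝ (leafCoord ι y₀ b) q (ρ q (leafCoord ι y₀ a q)))
        (leafCoord ι y₀ c q) := by
  have hin : ∀ u v w : Cₛ^∞⟮𝓘(ℝ, EM); F, A⟯, (inner ℝ (𝒜.bracket u v (leafMap ι y₀ q))
      (w (leafMap ι y₀ q)) : ℝ) = leafForm ι y₀ T q (leafCoord ι y₀ (𝒜.bracket u v) q)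
        (leafCoord ι y₀ w q) := fun u v w => hD.inner_eq hq _ _
  unfold koszul
  rw [hD.anchorDeriv_inner hq, hD.anchorDeriv_inner hq, hD.anchorDeriv_inner hq, hin, hin, hin,
    hD.leafCoord_bracket hq, hD.leafCoord_bracket hq, hD.leafCoord_bracket hq, koszulForm]
  simp only [map_add, map_sub, add_apply, sub_apply]
  have hs := leafForm_symm (ι := ι) (y₀ := y₀) (T := T) q
  rw [hs (leafCoord ι y₀ b q) (fderiv ℝ (leafCoord ι y₀ c) q _),
    hs (leafCoord ι y₀ a q) (fderiv ℝ (leafCoord ι y₀ c) q _),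
    hs (leafCoord ι y₀ a q) (fderiv ℝ (leafCoord ι y₀ b) q _)]
  ring

variable [∀ x, FiniteDimensional ℝ (A x)]

/-- The Levi-Civita connection along the leaf, in terms of the Christoffel symbols. -/
theorem IsLeafDomain.triv_leviCivita (hD : IsLeafDomain 𝒜 ι y₀ T ρ U) (hq : q ∈ U)
    {Γ : F →L[ℝ] F →L[ℝ] F} (hΓ : ∀ ξ η ζ, 2 * leafForm ι y₀ T q (Γ ξ η) ζ =
      koszulForm (leafForm ι y₀ T) ρ (leafBracket 𝒜 ι y₀ T) q ξ η ζ)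
    (a b : Cₛ^∞⟮𝓘(ℝ, EM); F, A⟯) :
    triv F A (ι y₀) (leafMap ι y₀ q) (𝒜.leviCivita a b (leafMap ι y₀ q)) =
      Γ (leafCoord ι y₀ a q) (leafCoord ι y₀ b q) +
        fderiv ℝ (leafCoord ι y₀ b) q (ρ q (leafCoord ι y₀ a q)) := by
  set x := leafMap ι y₀ q with hx
  set Y := Γ (leafCoord ι y₀ a q) (leafCoord ι y₀ b q) +
        fderiv ℝ (leafCoord ι y₀ b) q (ρ q (leafCoord ι y₀ a q)) with hY
  suffices H : 𝒜.leviCivita a b x = T Y x by rw [H, hD.triv_frame hq]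
  unfold leviCivita
  conv_rhs => rw [← (stdOrthonormalBasis ℝ (A x)).sum_repr' (T Y x)]
  refine Finset.sum_congr rfl fun i _ => ?_
  congr 1
  set e := stdOrthonormalBasis ℝ (A x) i
  rw [hD.koszul_eq hq, ← hΓ, real_inner_comm, hD.inner_eq hq, hD.triv_frame hq]
  have h1 : leafCoord ι y₀ (sectionThrough EM F x e) q = triv F A (ι y₀) x e := by
    rw [leafCoord, ← hx, sectionThrough_apply_self]
  rw [h1, hY, map_add, add_apply]
  ring

end LeafMetric

end LieAlgebroid

/-! ### A Riemannian Lie algebroid in coordinates along a leaf -/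

namespace LieAlgebroid

section LeafChart

variable {EM F EL M L : Type*}
  [NormedAddCommGroup EM] [NormedSpace ℝ EM] [FiniteDimensional ℝ EM]
  [NormedAddCommGroup F] [NormedSpace ℝ F] [FiniteDimensional ℝ F]
  [NormedAddCommGroup EL] [NormedSpace ℝ EL] [FiniteDimensional ℝ EL]
  [TopologicalSpace M] [T2Space M] [ChartedSpace EM M] [IsManifold 𝓘(ℝ, EM) ∞ M]
  {A : M → Type*} [TopologicalSpace (TotalSpace F A)]
  [∀ x, NormedAddCommGroup (A x)] [∀ x, InnerProductSpace ℝ (A x)]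
  [FiberBundle F A] [VectorBundle ℝ F A] [ContMDiffVectorBundle ∞ F A 𝓘(ℝ, EM)]
  [IsContMDiffRiemannianBundle 𝓘(ℝ, EM) ∞ F A]
  (𝒜 : LieAlgebroid EM F A)
  [TopologicalSpace L] [ChartedSpace EL L] [IsManifold 𝓘(ℝ, EL) ∞ L]
  (ι : C^∞⟮𝓘(ℝ, EL), L; 𝓘(ℝ, EM), M⟯)
  (y₀ : L) (T : F →ₗ[ℝ] Cₛ^∞⟮𝓘(ℝ, EM); F, A⟯) (𝒞 : AlgebroidChart EL F)

/-- `𝒞` is the local expression, in the frame `T`, of the restriction to the leaf of the Riemannian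
Lie algebroid `𝒜`. -/
structure IsLeafChart : Prop extends IsLeafDomain 𝒜 ι y₀ T 𝒞.ρ 𝒞.U where
  G_eq : 𝒞.G = leafForm ι y₀ T
  c_eq : 𝒞.c = leafBracket 𝒜 ι y₀ T

variable {𝒜 ι y₀ T 𝒞}

/-- Every point of a leaf lies in the domain of such a local expression, the Christoffel symbols
being defined by the Koszul formula. -/
theorem exists_isLeafChart (hL : 𝒜.IsLeaf ι) (y₀ : L) :
    ∃ T 𝒞, IsLeafChart 𝒜 ι y₀ T 𝒞 := by
  obtain ⟨T, ρ, U, hD⟩ := exists_isLeafDomain hL y₀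
  have hpos : ∀ q ∈ U, ∀ v, v ≠ 0 → 0 < leafForm ι y₀ T q v v := fun q hq => hD.leafForm_pos hq
  obtain ⟨h, hh, hρh, hGh⟩ := exists_horizontal_lift hD.contDiffOn_leafForm hpos hD.contDiffOn_ρ
    hD.surjective
  obtain ⟨Γ, hΓ, hK⟩ := exists_christoffel hD.isOpen hD.contDiffOn_leafForm hpos hD.contDiffOn_ρ
    hD.contDiffOn_leafBracket
  have hsymm : ∀ q ∈ U, ∀ v ξ η, fderiv ℝ (leafForm ι y₀ T) q v ξ η =
      fderiv ℝ (leafForm ι y₀ T) q v η ξ := by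
    intro q hq v ξ η
    have h1 : ∀ ξ η : F, HasFDerivAt (fun p => leafForm ι y₀ T p ξ η)
        (((fderiv ℝ (leafForm ι y₀ T) q).flip ξ).flip η) q := fun ξ η =>
      (((hD.hasFDerivAt_leafForm hq).clm_apply (hasFDerivAt_const ξ q)).clm_apply
        (hasFDerivAt_const η q)).congr_fderiv (by ext; simp)
    have h2 := (h1 ξ η).unique ((h1 η ξ).congr_of_eventuallyEq
      (Filter.Eventually.of_forall fun p => leafForm_symm p ξ η))
    exact congrArg (fun l : EL →L[ℝ] ℝ => l v) h2
  have hskew := leafBracket_skew (𝒜 := 𝒜) (ι := ι) (y₀ := y₀) (T := T)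
  have hGs := leafForm_symm (ι := ι) (y₀ := y₀) (T := T)
  refine ⟨T, ⟨U, hD.isOpen, leafForm ι y₀ T, ρ, leafBracket 𝒜 ι y₀ T, Γ, h,
    hD.contDiffOn_leafForm, hD.contDiffOn_ρ, hD.contDiffOn_leafBracket, hΓ, hh,
    fun q _ => hGs q, hpos, fun q _ => hskew q, fun q hq => hD.anchor_leafBracket hq,
    fun q hq => hD.jacobi_leafBracket hq, ?_, ?_, hρh, hGh⟩, ⟨hD, rfl, rfl⟩⟩
  -- metricity
  · intro q hq ξ η ζ
    have h1 := hK q hq ξ η ζ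
    have h2 := hK q hq ξ ζ η
    rw [hsymm q hq _ ζ η, hskew q η ξ, hskew q η ζ] at h2
    rw [hskew q ζ ξ] at h1
    rw [hGs q η]
    simp only [map_neg, neg_apply] at h1 h2
    linarith
  -- torsion-freeness
  · intro q hq ξ η
    refine sub_eq_zero.1 ?_
    by_contra hne
    have h0 := hpos q hq _ hne
    have h1 := hK q hq ξ η (Γ q ξ η - Γ q η ξ - leafBracket 𝒜 ι y₀ T q ξ η)
    have h2 := hK q hq η ξ (Γ q ξ η - Γ q η ξ - leafBracket 𝒜 ι y₀ T q ξ η)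
    set ζ := Γ q ξ η - Γ q η ξ - leafBracket 𝒜 ι y₀ T q ξ η with hζ
    rw [hsymm q hq _ η ξ, hskew q η ξ] at h2
    have h3 : leafForm ι y₀ T q ζ ζ = leafForm ι y₀ T q (Γ q ξ η) ζ -
      leafForm ι y₀ T q (Γ q η ξ) ζ - leafForm ι y₀ T q (leafBracket 𝒜 ι y₀ T q ξ η) ζ := by
      have h4 : leafForm ι y₀ T q ζ = leafForm ι y₀ T q (Γ q ξ η) - leafForm ι y₀ T q (Γ q η ξ) -
        leafForm ι y₀ T q (leafBracket 𝒜 ι y₀ T q ξ η) := by rw [hζ, map_sub, map_sub]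
      exact congrArg (fun l : F →L[ℝ] ℝ => l ζ) h4
    simp only [map_neg, neg_apply] at h2
    linarith

namespace IsLeafChart

variable {q : EL}

local notation "τ" => triv F A (ι y₀) (leafMap ι y₀ q)

theorem inner_eq (hC : IsLeafChart 𝒜 ι y₀ T 𝒞) (hq : q ∈ 𝒞.U) (v w : A (leafMap ι y₀ q)) :
    inner ℝ v w = 𝒞.G q (τ v) (τ w) := by
  rw [hC.G_eq]
  exact hC.toIsLeafDomain.inner_eq hq v w

theorem triv_injective (hC : IsLeafChart 𝒜 ι y₀ T 𝒞) (hq : q ∈ 𝒞.U)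
    {v w : A (leafMap ι y₀ q)} (h : τ v = τ w) : v = w := by
  rw [← hC.frame_triv hq v, h, hC.frame_triv hq]

theorem koszulForm_eq (hq : q ∈ 𝒞.U) (ξ η ζ : F) :
    2 * 𝒞.G q (𝒞.Γ q ξ η) ζ = koszulForm 𝒞.G 𝒞.ρ 𝒞.c q ξ η ζ := by
  have h1 := 𝒞.metric q hq ξ η ζ
  have h2 := 𝒞.metric q hq η ξ ζ
  have h3 := 𝒞.metric q hq ζ ξ η
  rw [koszulForm, h1, h2, h3, ← 𝒞.torsion q hq, ← 𝒞.torsion q hq, ← 𝒞.torsion q hq]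
  simp only [map_sub, sub_apply]
  have hs := 𝒞.G_symm q hq
  rw [hs η (𝒞.Γ q ξ ζ), hs ξ (𝒞.Γ q η ζ), hs ξ (𝒞.Γ q ζ η)]
  ring

theorem mfderiv_ρ (hC : IsLeafChart 𝒜 ι y₀ T 𝒞) (hq : q ∈ 𝒞.U) (v : A (leafMap ι y₀ q)) :
    (mfderiv 𝓘(ℝ, EL) 𝓘(ℝ, EM) (leafMap ι y₀) q (𝒞.ρ q (τ v)) : EM) =
      𝒜.anchor (leafMap ι y₀ q) v := hC.toIsLeafDomain.mfderiv_ρ hq v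

theorem anchor_eq_iff (hC : IsLeafChart 𝒜 ι y₀ T 𝒞) (hq : q ∈ 𝒞.U)
    (v : A (leafMap ι y₀ q)) (u : EL) :
    𝒜.anchor (leafMap ι y₀ q) v = (mfderiv 𝓘(ℝ, EL) 𝓘(ℝ, EM) (leafMap ι y₀) q u : EM) ↔
      𝒞.ρ q (τ v) = u := by
  rw [← hC.mfderiv_ρ hq]
  exact (hC.injective q hq).eq_iff

theorem mem_isotropy_iff (hC : IsLeafChart 𝒜 ι y₀ T 𝒞) (hq : q ∈ 𝒞.U) (v : A (leafMap ι y₀ q)) :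
    v ∈ 𝒜.isotropy (leafMap ι y₀ q) ↔ 𝒞.ρ q (τ v) = 0 := by
  rw [← hC.anchor_eq_iff hq]
  have h0 : (mfderiv 𝓘(ℝ, EL) 𝓘(ℝ, EM) (leafMap ι y₀) q (0 : EL) : EM) = 0 :=
    (mfderiv 𝓘(ℝ, EL) 𝓘(ℝ, EM) (leafMap ι y₀) q).map_zero
  rw [h0]
  rfl

theorem mem_orthogonal (hC : IsLeafChart 𝒜 ι y₀ T 𝒞) (hq : q ∈ 𝒞.U) (u : EL) :
    T (𝒞.h q u) (leafMap ι y₀ q) ∈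
    (𝒜.isotropy (leafMap ι y₀ q))ᗮ := by
  rw [Submodule.mem_orthogonal']
  intro v hv
  rw [hC.inner_eq hq, hC.triv_frame hq]
  exact 𝒞.G_h q hq _ _ ((hC.mem_isotropy_iff hq v).1 hv)

theorem triv_bracket (hC : IsLeafChart 𝒜 ι y₀ T 𝒞) (hq : q ∈ 𝒞.U)
    (a b : Cₛ^∞⟮𝓘(ℝ, EM); F, A⟯) (ha : a (leafMap ι y₀ q) ∈ 𝒜.isotropy _)
    (hb : b (leafMap ι y₀ q) ∈ 𝒜.isotropy _) : τ (𝒜.bracket a b (leafMap ι y₀ q)) =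
      𝒞.c q (τ (a (leafMap ι y₀ q))) (τ (b (leafMap ι y₀ q))) := by
  have h1 := hC.leafCoord_bracket hq a b
  rw [leafCoord, leafCoord, leafCoord] at h1
  rw [h1, (hC.mem_isotropy_iff hq _).1 ha, (hC.mem_isotropy_iff hq _).1 hb, map_zero, map_zero,
    add_zero, sub_zero, hC.c_eq]

theorem triv_isotropyBracket (hC : IsLeafChart 𝒜 ι y₀ T 𝒞) (hq : q ∈ 𝒞.U)
    (u v : 𝒜.isotropy (leafMap ι y₀ q)) :
    τ (𝒜.isotropyBracket (leafMap ι y₀ q) u v) = 𝒞.c q (τ u) (τ v) := by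
  have h1 := hC.triv_bracket hq (sectionThrough EM F (leafMap ι y₀ q) u)
    (sectionThrough EM F (leafMap ι y₀ q) v) (by rw [sectionThrough_apply_self]; exact u.2)
    (by rw [sectionThrough_apply_self]; exact v.2)
  rwa [sectionThrough_apply_self, sectionThrough_apply_self] at h1

variable [∀ x, FiniteDimensional ℝ (A x)]

theorem triv_leviCivita (hC : IsLeafChart 𝒜 ι y₀ T 𝒞) (hq : q ∈ 𝒞.U) (a b : Cₛ^∞⟮𝓘(ℝ, EM); F, A⟯) :
    τ (𝒜.leviCivita a b (leafMap ι y₀ q)) = 𝒞.Γ q (τ (a (leafMap ι y₀ q)))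
      (τ (b (leafMap ι y₀ q))) +
      fderiv ℝ (leafCoord ι y₀ b) q (𝒞.ρ q (τ (a (leafMap ι y₀ q)))) :=
  hC.toIsLeafDomain.triv_leviCivita hq (fun ξ η ζ => by
    rw [← hC.G_eq, ← hC.c_eq]; exact koszulForm_eq hq ξ η ζ) a b

theorem hor_eq (hC : IsLeafChart 𝒜 ι y₀ T 𝒞) (hq : q ∈ 𝒞.U) (v : A (leafMap ι y₀ q)) :
    𝒜.hor v = T (𝒞.h q (𝒞.ρ q (τ v))) (leafMap ι y₀ q) := by
  have h1 : v - T (𝒞.h q (𝒞.ρ q (τ v))) (leafMap ι y₀ q) ∈ 𝒜.isotropy (leafMap ι y₀ q) := by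
    rw [hC.mem_isotropy_iff hq, map_sub, map_sub, hC.triv_frame hq, 𝒞.ρ_h q hq, sub_self]
  have h2 : (𝒜.vert v : A (leafMap ι y₀ q)) = v - T (𝒞.h q (𝒞.ρ q (τ v))) (leafMap ι y₀ q) :=
    Submodule.eq_starProjection_of_mem_orthogonal' h1 (hC.mem_orthogonal hq _)
      (sub_add_cancel _ _).symm
  rw [hor, h2, sub_sub_cancel]

theorem triv_hor (hC : IsLeafChart 𝒜 ι y₀ T 𝒞) (hq : q ∈ 𝒞.U) (v : A (leafMap ι y₀ q)) :
    τ (𝒜.hor v) = 𝒞.h q (𝒞.ρ q (τ v)) := by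
  rw [hC.hor_eq hq, hC.triv_frame hq]

theorem triv_vert (hC : IsLeafChart 𝒜 ι y₀ T 𝒞) (hq : q ∈ 𝒞.U) (v : A (leafMap ι y₀ q)) :
    τ (𝒜.vert v) = 𝒞.vertProj q (τ v) := by
  have h : (𝒜.vert v : A (leafMap ι y₀ q)) = v - 𝒜.hor v := (sub_sub_cancel _ _).symm
  rw [h, map_sub, hC.triv_hor hq, AlgebroidChart.vertProj_apply]

/-- The trivialization identifies the isotropy with the kernel of `ρ`. -/
def isotropyEquiv (hC : IsLeafChart 𝒜 ι y₀ T 𝒞) (hq : q ∈ 𝒞.U) :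
    𝒜.isotropy (leafMap ι y₀ q) ≃ₗ[ℝ] LinearMap.ker (𝒞.ρ q).toLinearMap :=
  LinearEquiv.ofBijective (LinearMap.restrict (p := 𝒜.isotropy (leafMap ι y₀ q))
    (q := LinearMap.ker (𝒞.ρ q).toLinearMap) (τ).toLinearMap
    (fun v hv => (hC.mem_isotropy_iff hq v).1 hv))
    ⟨fun v w h => Subtype.ext (hC.triv_injective hq (congrArg Subtype.val h)), fun w =>
      ⟨⟨T w (leafMap ι y₀ q), (hC.mem_isotropy_iff hq _).2 (by
        rw [hC.triv_frame hq]; exact w.2)⟩, Subtype.ext (hC.triv_frame hq _)⟩⟩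

/-- On the isotropy, the modular form is the trace of the adjoint representation. -/
theorem trace_isotropyBracket (hC : IsLeafChart 𝒜 ι y₀ T 𝒞) (hq : q ∈ 𝒞.U)
    (u : 𝒜.isotropy (leafMap ι y₀ q)) :
    LinearMap.trace ℝ _ (𝒜.isotropyBracket (leafMap ι y₀ q) u) = 𝒞.modularForm q (τ u) := by
  have hu : 𝒞.ρ q (τ u) = 0 := (hC.mem_isotropy_iff hq _).1 u.2
  have hf : ∀ w ∈ LinearMap.ker (𝒞.ρ q).toLinearMap,
      (𝒞.c q (τ u)).toLinearMap w ∈ LinearMap.ker (𝒞.ρ q).toLinearMap := by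
    intro w hw
    have hw' : 𝒞.ρ q w = 0 := hw
    change 𝒞.ρ q (𝒞.c q (τ u) w) = 0
    rw [𝒞.anchor_c q hq, hu, hw']
    simp
  rw [AlgebroidChart.modularForm_eq_trace_restrict hq _ hu hf,
    ← LinearMap.trace_conj' _ (hC.isotropyEquiv hq)]
  congr 1
  refine LinearMap.ext fun w => Subtype.ext ?_
  obtain ⟨v, rfl⟩ := (hC.isotropyEquiv hq).surjective w
  rw [LinearEquiv.conj_apply_apply, LinearEquiv.symm_apply_apply]
  exact hC.triv_isotropyBracket hq u v

/-- Unimodularity in coordinates. -/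
theorem isUnimodularAt_iff (hC : IsLeafChart 𝒜 ι y₀ T 𝒞) (hq : q ∈ 𝒞.U) :
    𝒜.IsUnimodularAt (leafMap ι y₀ q) ↔ 𝒞.isotropyModularForm q = 0 := by
  constructor
  · intro h
    ext w
    have hw := AlgebroidChart.ρ_vertProj hq w
    have h1 := hC.trace_isotropyBracket hq ⟨T (𝒞.vertProj q w) (leafMap ι y₀ q),
      (hC.mem_isotropy_iff hq _).2 (by rw [hC.triv_frame hq, hw])⟩
    rw [h, hC.triv_frame hq] at h1
    exact h1.symm
  · intro h u
    rw [hC.trace_isotropyBracket hq, ← AlgebroidChart.vertProj_of_ρ_eq_zero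
      ((hC.mem_isotropy_iff hq _).1 u.2)]
    exact congrArg (fun l : F →L[ℝ] ℝ => l (τ u)) h

/-- The divergence of the geodesic field, computed in coordinates, in terms of `𝒜`. -/
theorem neg_trace_eq (hC : IsLeafChart 𝒜 ι y₀ T 𝒞) (hq : q ∈ 𝒞.U) (v : A (leafMap ι y₀ q)) {k : ℕ}
    (b : OrthonormalBasis (Fin k) ℝ (𝒜.isotropy (leafMap ι y₀ q))) :
    - LinearMap.trace ℝ F (((𝒞.Γ q).flip (τ v)).toLinearMap ∘ₗ
      (LinearMap.id - (𝒞.h q).toLinearMap ∘ₗ (𝒞.ρ q).toLinearMap)) =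
    LinearMap.trace ℝ _ (𝒜.isotropyBracket (leafMap ι y₀ q) (𝒜.vert v)) +
      inner ℝ (𝒜.hor v) (𝒜.oneillN (leafMap ι y₀ q) b) := by
  let β : Fin k → F := fun i => τ (b i)
  have hβ : ∀ i, 𝒞.ρ q (β i) = 0 := fun i => (hC.mem_isotropy_iff hq _).1 (b i).2
  -- the projection to the isotropy, expanded in the orthonormal basis
  have hP : ((𝒞.Γ q).flip (τ v)).toLinearMap ∘ₗ
      (LinearMap.id - (𝒞.h q).toLinearMap ∘ₗ (𝒞.ρ q).toLinearMap) =
      ∑ i, ((𝒞.G q (β i)).toLinearMap.smulRight (𝒞.Γ q (β i) (τ v))) := by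
    refine LinearMap.ext fun w => ?_
    have h1 : 𝒞.vertProj q w = ∑ i, 𝒞.G q (β i) w • β i := by
      rw [← hC.triv_frame hq w, ← hC.triv_vert hq, ← b.sum_repr' (𝒜.vert _)]
      simp only [AddSubmonoidClass.coe_finsetSum, map_sum, Submodule.coe_smul, map_smul, β]
      refine Finset.sum_congr rfl fun i _ => ?_
      congr 1
      rw [← hC.inner_eq hq, Submodule.coe_inner]
      exact Submodule.inner_orthogonalProjectionOnto_eq_of_mem_left _ _
    change 𝒞.Γ q (𝒞.vertProj q w) (τ v) = _
    rw [h1]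
    simp
  have htr : ∀ (l : F →ₗ[ℝ] ℝ) (w : F), LinearMap.trace ℝ F (l.smulRight w) = l w :=
    fun l w => LinearMap.trace_smulRight l w
  -- the second term of `T` is vertical, hence orthogonal to the horizontal part of `v`
  have hT : ∀ i, (inner ℝ (𝒜.hor v) (𝒜.oneillT (leafMap ι y₀ q) (b i) (b i)) : ℝ) =
      𝒞.G q (𝒞.h q (𝒞.ρ q (τ v))) (𝒞.Γ q (β i) (β i)) := by
    intro i
    have h0 : ∀ w : 𝒜.isotropy (leafMap ι y₀ q),
        (inner ℝ (𝒜.hor v) (w : A (leafMap ι y₀ q)) : ℝ) = 0 := fun w => by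
      rw [hC.hor_eq hq]
      exact Submodule.mem_orthogonal' _ _ |>.1 (hC.mem_orthogonal hq _) _ w.2
    have h1 : 𝒜.vert (b i : A (leafMap ι y₀ q)) = b i :=
      Submodule.orthogonalProjectionOnto_mem_subspace_eq_self (b i)
    have h2 : ∀ w : A (leafMap ι y₀ q), (inner ℝ (𝒜.hor v) (𝒜.hor w) : ℝ) =
        inner ℝ (𝒜.hor v) w := fun w => by
      change (inner ℝ (𝒜.hor v) (w - 𝒜.vert w) : ℝ) = _
      rw [inner_sub_right, h0, sub_zero]
    rw [oneillT, inner_add_right, h0, add_zero, h2, h1, hC.inner_eq hq, hC.triv_hor hq,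
      hC.triv_leviCivita hq, sectionThrough_apply_self]
    change 𝒞.G q _ (𝒞.Γ q (β i) (β i) + fderiv ℝ _ q (𝒞.ρ q (β i))) = _
    rw [hβ, map_zero, add_zero]
  rw [hP, map_sum, LinearMap.trace_eq_sum_inner _ b, oneillN, inner_sum, ← Finset.sum_add_distrib,
    ← Finset.sum_neg_distrib]
  refine Finset.sum_congr rfl fun i _ => ?_
  rw [htr, hT, Submodule.coe_inner, hC.inner_eq hq, hC.triv_isotropyBracket hq, hC.triv_vert hq]
  change -(𝒞.G q (β i) (𝒞.Γ q (β i) (τ v))) = 𝒞.G q (β i) (𝒞.c q (𝒞.vertProj q (τ v)) (β i)) + _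
  rw [← 𝒞.torsion q hq]
  -- metricity for `v^v, bᵢ, bᵢ` gives `G(Γ(v^v, bᵢ), bᵢ) = 0`; for `bᵢ, v^h, bᵢ` it moves
  -- `Γ(bᵢ, ·)` to the other factor; both derivative terms vanish, since the anchor kills `v^v`
  -- and `bᵢ`
  have h1 := 𝒞.metric q hq (𝒞.vertProj q (τ v)) (β i) (β i)
  have h2 := 𝒞.metric q hq (β i) (𝒞.h q (𝒞.ρ q (τ v))) (β i)
  rw [AlgebroidChart.ρ_vertProj hq] at h1
  rw [hβ] at h2
  have h3 : 𝒞.Γ q (β i) (τ v) = 𝒞.Γ q (β i) (𝒞.vertProj q (τ v)) +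
      𝒞.Γ q (β i) (𝒞.h q (𝒞.ρ q (τ v))) := by
    rw [AlgebroidChart.vertProj_apply, ← map_add, sub_add_cancel]
  have hs := 𝒞.G_symm q hq
  rw [h3]
  simp only [map_zero, zero_apply, map_add, map_sub] at h1 h2 ⊢
  rw [hs _ (β i)] at h1 h2
  linarith

/-- The vector `N` is horizontal: `T_b b` is `(𝒟_b b)^h` for vertical `b`, as `b^h = 0`. -/
theorem oneillN_mem_orthogonal (hC : IsLeafChart 𝒜 ι y₀ T 𝒞) (hq : q ∈ 𝒞.U) {k : ℕ}
    (b : OrthonormalBasis (Fin k) ℝ (𝒜.isotropy (leafMap ι y₀ q))) :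
    𝒜.oneillN (leafMap ι y₀ q) b ∈ (𝒜.isotropy (leafMap ι y₀ q))ᗮ := by
  refine Submodule.sum_mem _ fun i _ => ?_
  have h1 : 𝒜.vert (b i : A (leafMap ι y₀ q)) = b i :=
    Submodule.orthogonalProjectionOnto_mem_subspace_eq_self (b i)
  have h2 : 𝒜.leviCivita (sectionThrough EM F (leafMap ι y₀ q) (𝒜.vert (b i : A (leafMap ι y₀ q))))
      (sectionThrough EM F (leafMap ι y₀ q) (𝒜.hor (b i : A (leafMap ι y₀ q))))
      (leafMap ι y₀ q) = 0 := by
    refine hC.triv_injective hq ?_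
    rw [hC.triv_leviCivita hq, sectionThrough_apply_self, sectionThrough_apply_self, h1,
      hC.triv_hor hq, (hC.mem_isotropy_iff hq _).1 (b i).2, map_zero, map_zero, map_zero, map_zero,
      add_zero]
  rw [oneillT, h2, hC.hor_eq hq]
  refine Submodule.add_mem _ (hC.mem_orthogonal hq _) ?_
  have h3 : 𝒜.vert (0 : A (leafMap ι y₀ q)) = 0 :=
    map_zero ((𝒜.isotropy (leafMap ι y₀ q)).orthogonalProjectionOnto)
  rw [h3]
  exact Submodule.zero_mem _

end IsLeafChart

end LeafChart

end LieAlgebroid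

/-! ### Tangent vectors of a pulled back bundle -/

section PullbackBundle

variable {EM F EL M L : Type*}
  [NormedAddCommGroup EM] [NormedSpace ℝ EM]
  [NormedAddCommGroup F] [NormedSpace ℝ F]
  [NormedAddCommGroup EL] [NormedSpace ℝ EL]
  [TopologicalSpace M] [ChartedSpace EM M] [IsManifold 𝓘(ℝ, EM) ∞ M]
  {A : M → Type*} [TopologicalSpace (TotalSpace F A)]
  [∀ x, AddCommGroup (A x)] [∀ x, Module ℝ (A x)] [∀ x, TopologicalSpace (A x)]
  [FiberBundle F A] [VectorBundle ℝ F A] [ContMDiffVectorBundle ∞ F A 𝓘(ℝ, EM)]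
  [TopologicalSpace L] [ChartedSpace EL L] [IsManifold 𝓘(ℝ, EL) ∞ L]
  (ι : C^∞⟮𝓘(ℝ, EL), L; 𝓘(ℝ, EM), M⟯)

local notation "𝓙L" => ModelWithCorners.prod 𝓘(ℝ, EL) 𝓘(ℝ, F)
local notation "𝓙M" => ModelWithCorners.prod 𝓘(ℝ, EM) 𝓘(ℝ, F)

theorem contMDiff_pullback_lift :
    ContMDiff 𝓙L 𝓙M ∞ (Pullback.lift ι : TotalSpace F (ι *ᵖ A) → TotalSpace F A) := by
  intro a
  rw [contMDiffAt_totalSpace]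
  refine ⟨ι.contMDiff.contMDiffAt.comp a (contMDiff_proj (ι *ᵖ A)).contMDiffAt, ?_⟩
  have h := (contMDiffAt_totalSpace (IB := 𝓘(ℝ, EL)) (n := ∞) (IM := 𝓙L)
    (f := fun a : TotalSpace F (ι *ᵖ A) => a) (x₀ := a)).1 contMDiffAt_id
  exact h.2

theorem contMDiff_pullback_section (s : Cₛ^∞⟮𝓘(ℝ, EM); F, A⟯) :
    ContMDiff 𝓘(ℝ, EL) 𝓙L ∞ (fun y => (⟨y, s (ι y)⟩ : TotalSpace F (ι *ᵖ A))) := by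
  intro y
  rw [contMDiffAt_totalSpace]
  refine ⟨contMDiffAt_id, ?_⟩
  exact ((contMDiffAt_totalSpace (IB := 𝓘(ℝ, EM))).1 (s.contMDiff (ι y))).2.comp y
    ι.contMDiff.contMDiffAt

theorem contMDiff_vertical_line {EB B : Type*} [NormedAddCommGroup EB] [NormedSpace ℝ EB]
    [TopologicalSpace B] [ChartedSpace EB B]
    {V : B → Type*} [TopologicalSpace (TotalSpace F V)]
    [∀ x, AddCommMonoid (V x)] [∀ x, Module ℝ (V x)] [∀ x, TopologicalSpace (V x)]
    [FiberBundle F V] [VectorBundle ℝ F V] (x : B) (v w : V x) :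
    ContMDiff 𝓘(ℝ, ℝ) (𝓘(ℝ, EB).prod 𝓘(ℝ, F)) ∞
      (fun t : ℝ => (⟨x, v + t • w⟩ : TotalSpace F V)) := by
  intro t
  rw [contMDiffAt_totalSpace]
  refine ⟨contMDiffAt_const, ?_⟩
  set e := trivializationAt F V x
  have hx : x ∈ e.baseSet := FiberBundle.mem_baseSet_trivializationAt' x
  have h : (fun t : ℝ => (e ⟨x, v + t • w⟩).2) = fun t : ℝ => (e ⟨x, v⟩).2 + t • (e ⟨x, w⟩).2 := by
    funext t
    have h1 := e.coe_linearMapAt_of_mem (R := ℝ) hx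
    have h2 : ∀ z, (e ⟨x, z⟩).2 = e.linearMapAt ℝ x z := fun z => (congrFun h1 z).symm
    rw [h2, h2, h2, map_add, map_smul]
  change ContMDiffAt _ _ _ (fun t : ℝ => (e ⟨x, v + t • w⟩).2) t
  rw [h]
  exact (contDiff_const.add (contDiff_id.smul contDiff_const)).contMDiff.contMDiffAt

/-- The immersion of the pulled back bundle maps the differential of a section to the differential
of a section. -/
theorem mfderiv_lift_dsection (a : TotalSpace F (ι *ᵖ A)) (s : Cₛ^∞⟮𝓘(ℝ, EM); F, A⟯)
    (hs : s (ι a.proj) = a.2) (u : EL) :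
    (mfderiv 𝓙L 𝓙M (Pullback.lift ι : TotalSpace F (ι *ᵖ A) → TotalSpace F A) a
      (dsection EL F a (fun y => s (ι y)) u) : EM × F) =
    dsection EM F (Pullback.lift ι a) s (mfderiv 𝓘(ℝ, EL) 𝓘(ℝ, EM) ι a.proj u) := by
  obtain ⟨y, v⟩ := a
  change s (ι y) = v at hs
  subst hs
  have h1 := ((contMDiff_pullback_lift (F := F) (A := A) ι).mdifferentiable (by simp)
    ⟨y, s (ι y)⟩).hasMFDerivAt
  have h2 := ((contMDiff_pullback_section ι s).mdifferentiable (by simp) y).hasMFDerivAt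
  have h3 := (s.contMDiff.mdifferentiable (by simp) (ι y)).hasMFDerivAt
  have h4 := (ι.contMDiff.mdifferentiable (by simp) y).hasMFDerivAt
  have h5 := hasMFDerivAt_unique (HasMFDerivAt.comp y h1 h2)
    (HasMFDerivAt.comp (g := fun x => (⟨x, s x⟩ : TotalSpace F A)) y h3 h4)
  exact congrArg (fun l : EL →L[ℝ] EM × F => l u) h5

theorem mfderiv_lift_vlift (a : TotalSpace F (ι *ᵖ A)) (w : (ι *ᵖ A) a.proj) :
    (mfderiv 𝓙L 𝓙M (Pullback.lift ι : TotalSpace F (ι *ᵖ A) → TotalSpace F A) a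
      (vlift EL F a w) : EM × F) = vlift EM F (Pullback.lift ι a) w := by
  obtain ⟨y, v⟩ := a
  change (ι *ᵖ A) y at w
  have h1 : HasMFDerivAt 𝓙L 𝓙M (Pullback.lift ι : TotalSpace F (ι *ᵖ A) → TotalSpace F A)
      (⟨y, v + (0 : ℝ) • w⟩ : TotalSpace F (ι *ᵖ A))
      (mfderiv 𝓙L 𝓙M (Pullback.lift ι : TotalSpace F (ι *ᵖ A) → TotalSpace F A) ⟨y, v⟩) := by
    rw [zero_smul, add_zero]
    exact ((contMDiff_pullback_lift (F := F) (A := A) ι).mdifferentiable (by simp)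
      ⟨y, v⟩).hasMFDerivAt
  have h2 := ((contMDiff_vertical_line (EB := EL) (F := F) (V := ι *ᵖ A) y v w).mdifferentiable
    (by simp) 0).hasMFDerivAt
  exact (congrArg (fun l : ℝ →L[ℝ] EM × F => l 1) (HasMFDerivAt.comp (0 : ℝ) h1 h2).mfderiv).symm

theorem proj_mfderiv_lift (a : TotalSpace F (ι *ᵖ A)) (Z : TangentSpace 𝓙L a) :
    (mfderiv 𝓙M 𝓘(ℝ, EM) (TotalSpace.proj : TotalSpace F A → M) (Pullback.lift ι a)
      (mfderiv 𝓙L 𝓙M (Pullback.lift ι : TotalSpace F (ι *ᵖ A) → TotalSpace F A) a Z) : EM) =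
    mfderiv 𝓘(ℝ, EL) 𝓘(ℝ, EM) ι a.proj
      (mfderiv 𝓙L 𝓘(ℝ, EL) (TotalSpace.proj : TotalSpace F (ι *ᵖ A) → L) a Z) := by
  have h1 := ((contMDiff_pullback_lift (F := F) (A := A) ι).mdifferentiable (by simp)
    a).hasMFDerivAt
  have h2 := (mdifferentiableAt_proj (IB := 𝓘(ℝ, EM)) (F := F) A
      (p := Pullback.lift ι a)).hasMFDerivAt
  have h3 := (mdifferentiableAt_proj (IB := 𝓘(ℝ, EL)) (F := F) (ι *ᵖ A) (p := a)).hasMFDerivAt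
  have h4 := (ι.contMDiff.mdifferentiable (by simp) a.proj).hasMFDerivAt
  have h5 := hasMFDerivAt_unique
    (HasMFDerivAt.comp (g := (TotalSpace.proj : TotalSpace F A → M)) a h2 h1)
    (HasMFDerivAt.comp (g := ι) (f := (TotalSpace.proj : TotalSpace F (ι *ᵖ A) → L)) a h4 h3)
  exact congrArg (fun l : EL × F →L[ℝ] EM => l Z) h5

end PullbackBundle

/-! ### The geodesic field and the Sasaki metric in coordinates -/

theorem vlift_zero {EB F B : Type*} [NormedAddCommGroup EB] [NormedSpace ℝ EB]
    [NormedAddCommGroup F] [NormedSpace ℝ F] [TopologicalSpace B] [ChartedSpace EB B]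
    {V : B → Type*} [TopologicalSpace (TotalSpace F V)]
    [∀ x, AddCommMonoid (V x)] [∀ x, Module ℝ (V x)] [∀ x, TopologicalSpace (V x)]
    [FiberBundle F V] [VectorBundle ℝ F V] (a : TotalSpace F V) :
    vlift EB F a (0 : V a.proj) = 0 := by
  have h : (fun t : ℝ => (⟨a.proj, a.2 + t • (0 : V a.proj)⟩ : TotalSpace F V)) = fun _ => a := by
    funext t
    rw [smul_zero, add_zero]
  unfold vlift
  rw [h, mfderiv_const]
  rfl

namespace LieAlgebroid

section LeafGeometry

variable {EM F EL M L : Type*}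
  [NormedAddCommGroup EM] [NormedSpace ℝ EM] [FiniteDimensional ℝ EM]
  [NormedAddCommGroup F] [NormedSpace ℝ F] [FiniteDimensional ℝ F]
  [NormedAddCommGroup EL] [NormedSpace ℝ EL] [FiniteDimensional ℝ EL]
  [TopologicalSpace M] [T2Space M] [ChartedSpace EM M] [IsManifold 𝓘(ℝ, EM) ∞ M]
  {A : M → Type*} [TopologicalSpace (TotalSpace F A)]
  [∀ x, NormedAddCommGroup (A x)] [∀ x, InnerProductSpace ℝ (A x)]
  [FiberBundle F A] [VectorBundle ℝ F A] [ContMDiffVectorBundle ∞ F A 𝓘(ℝ, EM)]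
  [IsContMDiffRiemannianBundle 𝓘(ℝ, EM) ∞ F A]
  {𝒜 : LieAlgebroid EM F A}
  [TopologicalSpace L] [ChartedSpace EL L] [IsManifold 𝓘(ℝ, EL) ∞ L]
  {ι : C^∞⟮𝓘(ℝ, EL), L; 𝓘(ℝ, EM), M⟯}
  {T : F →ₗ[ℝ] Cₛ^∞⟮𝓘(ℝ, EM); F, A⟯} {𝒞 : AlgebroidChart EL F}

local notation "𝓙L" => ModelWithCorners.prod 𝓘(ℝ, EL) 𝓘(ℝ, F)
local notation "𝓙M" => ModelWithCorners.prod 𝓘(ℝ, EM) 𝓘(ℝ, F)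

/-- The differential of the inverse of the chart of `A_L` at `a₀`. -/
def coordFrame (a₀ : TotalSpace F (ι *ᵖ A)) (p : EL × F) : EL × F →L[ℝ] EL × F :=
  mfderiv 𝓘(ℝ, EL × F) 𝓙L (extChartAt 𝓙L a₀).symm p

variable (ι T) in
/-- The element of `A_L` with coordinates `p`, in the frame `T`. -/
def leafPoint (y₀ : L) (p : EL × F) : TotalSpace F (ι *ᵖ A) :=
  ⟨(extChartAt 𝓘(ℝ, EL) y₀).symm p.1, T p.2 (leafMap ι y₀ p.1)⟩

namespace IsLeafChart

variable {a₀ : TotalSpace F (ι *ᵖ A)} {p : EL × F}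

local notation "τ" => triv F A (ι a₀.proj) (leafMap ι a₀.proj (Prod.fst p))

theorem mem_trivDomain (hC : IsLeafChart 𝒜 ι a₀.proj T 𝒞) (hp : p.1 ∈ 𝒞.U) :
    p.1 ∈ trivDomain EL F (ι *ᵖ A) a₀.proj :=
  ⟨hC.subset hp, hC.mem_baseSet _ hp⟩

theorem trivializationAt_pullback (hC : IsLeafChart 𝒜 ι a₀.proj T 𝒞) (hp : p.1 ∈ 𝒞.U)
    (v : A (leafMap ι a₀.proj p.1)) :
    (trivializationAt F (ι *ᵖ A) a₀.proj ⟨(extChartAt 𝓘(ℝ, EL) a₀.proj).symm p.1, v⟩).2 = τ v :=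
  (triv_apply (hC.mem_baseSet _ hp) v).symm

theorem extChartAt_symm (hC : IsLeafChart 𝒜 ι a₀.proj T 𝒞) (hp : p.1 ∈ 𝒞.U) :
    (extChartAt 𝓙L a₀).symm p = leafPoint ι T a₀.proj p := by
  refine (extChartAt_totalSpace_symm_apply a₀ (hC.mem_trivDomain hp) p.2).trans ?_
  have h1 := (trivializationAt F (ι *ᵖ A) a₀.proj).symm_proj_apply (leafPoint ι T a₀.proj p)
    (hC.mem_trivDomain hp).2
  have h2 := (hC.trivializationAt_pullback hp (T p.2 (leafMap ι a₀.proj p.1))).trans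
    (hC.triv_frame hp p.2)
  change (⟨(extChartAt 𝓘(ℝ, EL) a₀.proj).symm p.1, _⟩ : TotalSpace F (ι *ᵖ A))
      = ⟨(extChartAt 𝓘(ℝ, EL) a₀.proj).symm p.1, _⟩
  congr 1
  exact (congrArg (fun ξ => (trivializationAt F (ι *ᵖ A) a₀.proj).symm
    ((extChartAt 𝓘(ℝ, EL) a₀.proj).symm p.1) ξ) h2.symm).trans h1

theorem coordFrame_injective (hC : IsLeafChart 𝒜 ι a₀.proj T 𝒞) (hp : p.1 ∈ 𝒞.U) :
    Function.Injective (coordFrame a₀ p) :=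
  mfderiv_bundleChart_injective a₀ (hC.mem_trivDomain hp)

theorem coordFrame_surjective (hC : IsLeafChart 𝒜 ι a₀.proj T 𝒞) (hp : p.1 ∈ 𝒞.U) :
    Function.Surjective (coordFrame a₀ p) :=
  mfderiv_bundleChart_surjective a₀ (hC.mem_trivDomain hp)

theorem vlift_leafPoint (hC : IsLeafChart 𝒜 ι a₀.proj T 𝒞) (hp : p.1 ∈ 𝒞.U)
    (w : A (leafMap ι a₀.proj p.1)) :
    (vlift EL F (leafPoint ι T a₀.proj p) w : EL × F) = coordFrame a₀ p (0, τ w) := by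
  have key : ∀ a : TotalSpace F (ι *ᵖ A), (extChartAt 𝓙L a₀).symm p = a →
      ∀ w : (ι *ᵖ A) a.proj, (vlift EL F a w : EL × F) =
        coordFrame a₀ p (0, (trivializationAt F (ι *ᵖ A) a₀.proj ⟨_, w⟩).2) := by
    rintro _ rfl w
    exact vlift_bundleChart a₀ (hC.mem_trivDomain hp) w
  refine (key _ (hC.extChartAt_symm hp) w).trans ?_
  rw [← hC.trivializationAt_pullback hp w]
  rfl

theorem dsection_leafPoint (hC : IsLeafChart 𝒜 ι a₀.proj T 𝒞) (hp : p.1 ∈ 𝒞.U)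
    (s : Cₛ^∞⟮𝓘(ℝ, EM); F, A⟯)
    (hs : s (leafMap ι a₀.proj p.1) = T p.2 (leafMap ι a₀.proj p.1)) (u : EL) :
    (dsection EL F (leafPoint ι T a₀.proj p) (fun y => s (ι y))
      (mfderiv 𝓘(ℝ, EL) 𝓘(ℝ, EL) (extChartAt 𝓘(ℝ, EL) a₀.proj).symm p.1 u : EL) : EL × F) =
      coordFrame a₀ p (u, fderiv ℝ (leafCoord ι a₀.proj s) p.1 u) := by
  have hS : HasFDerivAt (fun q => (trivializationAt F (ι *ᵖ A) a₀.proj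
      ⟨(extChartAt 𝓘(ℝ, EL) a₀.proj).symm q, s (ι ((extChartAt 𝓘(ℝ, EL) a₀.proj).symm q))⟩).2)
      (fderiv ℝ (leafCoord ι a₀.proj s) p.1) p.1 := by
    refine (hC.hasFDerivAt_leafCoord hp s).congr_of_eventuallyEq ?_
    filter_upwards [hC.isOpen.mem_nhds hp] with q hq
    exact hC.trivializationAt_pullback (p := (q, p.2)) hq _
  have key : ∀ a : TotalSpace F (ι *ᵖ A), (extChartAt 𝓙L a₀).symm p = a → s (ι a.proj) = a.2 →
      (dsection EL F a (fun y => s (ι y))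
      (mfderiv 𝓘(ℝ, EL) 𝓘(ℝ, EL) (extChartAt 𝓘(ℝ, EL) a₀.proj).symm p.1 u : EL) : EL × F) =
      coordFrame a₀ p (u, fderiv ℝ (leafCoord ι a₀.proj s) p.1 u) := by
    rintro _ rfl h
    exact dsection_bundleChart a₀ (hC.mem_trivDomain hp) (s := fun y => s (ι y)) h hS u
  exact key _ (hC.extChartAt_symm hp) hs

theorem dproj_leafPoint (hC : IsLeafChart 𝒜 ι a₀.proj T 𝒞) (hp : p.1 ∈ 𝒞.U) (z : EL × F) :
    (dproj ι (leafPoint ι T a₀.proj p) (coordFrame a₀ p z) : EL) =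
      mfderiv 𝓘(ℝ, EL) 𝓘(ℝ, EL) (extChartAt 𝓘(ℝ, EL) a₀.proj).symm p.1 z.1 := by
  have key : ∀ a : TotalSpace F (ι *ᵖ A), (extChartAt 𝓙L a₀).symm p = a →
      (dproj ι a (coordFrame a₀ p z) : EL) =
          mfderiv 𝓘(ℝ, EL) 𝓘(ℝ, EL) (extChartAt 𝓘(ℝ, EL) a₀.proj).symm p.1 z.1 := by
    rintro _ rfl
    exact mfderiv_proj_bundleChart a₀ (hC.mem_trivDomain hp) z
  exact key _ (hC.extChartAt_symm hp)

/-- The map `A_L → A` is an immersion. -/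
theorem mfderiv_lift_injective (hC : IsLeafChart 𝒜 ι a₀.proj T 𝒞) (hp : p.1 ∈ 𝒞.U) :
    Function.Injective (mfderiv 𝓙L 𝓙M (Pullback.lift ι : TotalSpace F (ι *ᵖ A) → TotalSpace F A)
      (leafPoint ι T a₀.proj p)) := by
  refine (injective_iff_map_eq_zero _).2 fun Z hZ => ?_
  obtain ⟨z, rfl⟩ := hC.coordFrame_surjective hp Z
  have h1 := proj_mfderiv_lift ι (leafPoint ι T a₀.proj p) (coordFrame a₀ p z)
  have h2 : (mfderiv 𝓘(ℝ, EL) 𝓘(ℝ, EM) (leafMap ι a₀.proj) p.1 z.1 : EM) = 0 := by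
    refine (mfderiv_leafMap ι (hC.subset hp) z.1).trans ?_
    refine Eq.trans ?_ (h1.symm.trans ?_)
    · exact congrArg (mfderiv 𝓘(ℝ, EL) 𝓘(ℝ, EM) ι ((extChartAt 𝓘(ℝ, EL) a₀.proj).symm p.1))
        (hC.dproj_leafPoint hp z).symm
    · rw [hZ]
      exact map_zero _
  have h3 : z.1 = 0 := by
    refine hC.injective _ hp (h2.trans ?_)
    exact (map_zero (mfderiv 𝓘(ℝ, EL) 𝓘(ℝ, EM) (leafMap ι a₀.proj) p.1)).symm
  have h4 : (vlift EL F (leafPoint ι T a₀.proj p) (T z.2 (leafMap ι a₀.proj p.1)) : EL × F) =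
      coordFrame a₀ p z := by
    refine (hC.vlift_leafPoint hp _).trans ?_
    rw [hC.triv_frame hp, ← h3]
  have h5 := mfderiv_lift_vlift ι (leafPoint ι T a₀.proj p) (T z.2 (leafMap ι a₀.proj p.1))
  have h6 : (vlift EM F (Pullback.lift ι (leafPoint ι T a₀.proj p))
      (T z.2 (leafMap ι a₀.proj p.1)) : EM × F) = 0 := by
    refine h5.symm.trans (Eq.trans ?_ hZ)
    exact congrArg (mfderiv 𝓙L 𝓙M (Pullback.lift ι : TotalSpace F (ι *ᵖ A) → TotalSpace F A)
      (leafPoint ι T a₀.proj p)) h4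
  have h7 : T z.2 (leafMap ι a₀.proj p.1) = 0 :=
    vlift_injective (EB := EM) (Pullback.lift ι (leafPoint ι T a₀.proj p))
      (h6.trans (vlift_zero _).symm)
  have h8 : z = 0 := Prod.ext h3 (by
    rw [← hC.triv_frame hp z.2, h7]
    exact map_zero _)
  rw [h8]
  exact map_zero _

variable [∀ x, FiniteDimensional ℝ (A x)]

/-- The geodesic field in coordinates. -/
theorem leafGeodesicField_leafPoint (hC : IsLeafChart 𝒜 ι a₀.proj T 𝒞) (hp : p.1 ∈ 𝒞.U) :
    (𝒜.leafGeodesicField ι (leafPoint ι T a₀.proj p) : EL × F) =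
      coordFrame a₀ p (𝒞.geodesicField p) := by
  let x := leafMap ι a₀.proj p.1
  let s := sectionThrough EM F x (T p.2 x)
  have hs : s x = T p.2 x := sectionThrough_apply_self x _
  have hτ : τ (s x) = p.2 := by rw [hs]; exact hC.triv_frame hp _
  have e1 := hC.dsection_leafPoint hp s hs (𝒞.ρ p.1 p.2)
  have e2 := hC.vlift_leafPoint hp (𝒜.leviCivita s s x)
  have e3 : τ (𝒜.leviCivita s s x) = 𝒞.Γ p.1 p.2 p.2 +
      fderiv ℝ (leafCoord ι a₀.proj s) p.1 (𝒞.ρ p.1 p.2) := by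
    have h := hC.triv_leviCivita hp s s
    rwa [hτ] at h
  have e4 : (mfderiv 𝓘(ℝ, EL) 𝓘(ℝ, EM) ι ((extChartAt 𝓘(ℝ, EL) a₀.proj).symm p.1)
      (mfderiv 𝓘(ℝ, EL) 𝓘(ℝ, EL) (extChartAt 𝓘(ℝ, EL) a₀.proj).symm p.1 (𝒞.ρ p.1 p.2)) : EM) =
      𝒜.anchor x (T p.2 x) := by
    refine (mfderiv_leafMap ι (hC.subset hp) _).symm.trans ?_
    exact ((hC.anchor_eq_iff hp _ _).2 (by rw [hC.triv_frame hp])).symm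
  -- the differential of `A_L → A` maps the coordinate field to the geodesic field of `A`,
  -- and the geodesic field of `A_L` is the preimage under this injective map
  let dl : EL × F →L[ℝ] EM × F := mfderiv 𝓙L 𝓙M
    (Pullback.lift ι : TotalSpace F (ι *ᵖ A) → TotalSpace F A) (leafPoint ι T a₀.proj p)
  have e5 : coordFrame a₀ p (𝒞.geodesicField p) =
      (dsection EL F (leafPoint ι T a₀.proj p) (fun y => s (ι y))
        (mfderiv 𝓘(ℝ, EL) 𝓘(ℝ, EL) (extChartAt 𝓘(ℝ, EL) a₀.proj).symm p.1
          (𝒞.ρ p.1 p.2) : EL) : EL × F) -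
        (vlift EL F (leafPoint ι T a₀.proj p) (𝒜.leviCivita s s x) : EL × F) := by
    refine Eq.trans ?_ (congrArg₂ (fun a b : EL × F => a - b) e1 e2).symm
    refine Eq.trans (congrArg (coordFrame a₀ p) ?_) ((coordFrame a₀ p).map_sub _ _)
    rw [e3]
    ext <;> simp [AlgebroidChart.geodesicField]
  have e6 : dl (coordFrame a₀ p (𝒞.geodesicField p)) =
      (𝒜.geodesicField (Pullback.lift ι (leafPoint ι T a₀.proj p)) : EM × F) := by
    refine (congrArg dl e5).trans ((dl.map_sub _ _).trans ?_)
    have e7 := mfderiv_lift_dsection ι (leafPoint ι T a₀.proj p) s hs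
      (mfderiv 𝓘(ℝ, EL) 𝓘(ℝ, EL) (extChartAt 𝓘(ℝ, EL) a₀.proj).symm p.1 (𝒞.ρ p.1 p.2) : EL)
    have e8 := mfderiv_lift_vlift ι (leafPoint ι T a₀.proj p) (𝒜.leviCivita s s x)
    refine (congrArg₂ (fun a b : EM × F => a - b) e7 e8).trans ?_
    refine congrArg (fun a : EM × F => a - _) ?_
    exact congrArg (fun v : EM =>
      (dsection EM F (Pullback.lift ι (leafPoint ι T a₀.proj p)) s v : EM × F)) e4
  refine Eq.trans (congrArg (Function.invFun dl) e6.symm) ?_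
  exact Function.leftInverse_invFun (hC.mfderiv_lift_injective hp) _

/-- The horizontal lift in coordinates. -/
theorem horLift_leafPoint (hC : IsLeafChart 𝒜 ι a₀.proj T 𝒞) (hp : p.1 ∈ 𝒞.U) (u : EL) :
    𝒜.horLift ι ((extChartAt 𝓘(ℝ, EL) a₀.proj).symm p.1)
        (mfderiv 𝓘(ℝ, EL) 𝓘(ℝ, EL) (extChartAt 𝓘(ℝ, EL) a₀.proj).symm p.1 u : EL) =
      T (𝒞.h p.1 u) (leafMap ι a₀.proj p.1) := by
  let x := leafMap ι a₀.proj p.1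
  let f : (𝒜.isotropy x)ᗮ → EM := fun w => 𝒜.anchor x w
  have hf : Function.Injective f := by
    intro w w' h
    have h1 : (w - w' : A x) ∈ 𝒜.isotropy x := by
      change 𝒜.anchor x (w - w') = 0
      rw [map_sub, sub_eq_zero]
      exact h
    have h2 : (w - w' : A x) ∈ (𝒜.isotropy x)ᗮ := Submodule.sub_mem _ w.2 w'.2
    exact Subtype.ext (sub_eq_zero.1 (inner_self_eq_zero.1 (h2 _ h1)))
  have h1 : f ⟨T (𝒞.h p.1 u) x, hC.mem_orthogonal hp u⟩ =
      mfderiv 𝓘(ℝ, EL) 𝓘(ℝ, EM) ι ((extChartAt 𝓘(ℝ, EL) a₀.proj).symm p.1)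
        (mfderiv 𝓘(ℝ, EL) 𝓘(ℝ, EL) (extChartAt 𝓘(ℝ, EL) a₀.proj).symm p.1 u) := by
    refine Eq.trans ?_ (mfderiv_leafMap ι (hC.subset hp) u)
    exact (hC.anchor_eq_iff hp _ _).2 (by rw [hC.triv_frame hp, 𝒞.ρ_h _ hp])
  have h2 := Function.leftInverse_invFun hf ⟨T (𝒞.h p.1 u) x, hC.mem_orthogonal hp u⟩
  exact congrArg Subtype.val ((congrArg (Function.invFun f) h1.symm).trans h2)

/-- The connection map in coordinates. -/
theorem triv_connector_leafPoint (hC : IsLeafChart 𝒜 ι a₀.proj T 𝒞) (hp : p.1 ∈ 𝒞.U)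
    (z : EL × F) : τ (𝒜.connector ι (leafPoint ι T a₀.proj p) (coordFrame a₀ p z)) =
      z.2 + 𝒞.Γ p.1 (𝒞.h p.1 z.1) p.2 := by
  let x := leafMap ι a₀.proj p.1
  let s := sectionThrough EM F x (T p.2 x)
  have hs : s x = T p.2 x := sectionThrough_apply_self x _
  let a := leafPoint ι T a₀.proj p
  have hd : (dproj ι a (coordFrame a₀ p z) : EL) = _ := hC.dproj_leafPoint hp z
  have hl : 𝒜.horLift ι a.proj (dproj ι a (coordFrame a₀ p z)) = T (𝒞.h p.1 z.1) x :=
    (congrArg (fun u : EL => 𝒜.horLift ι a.proj u) hd).trans (hC.horLift_leafPoint hp z.1)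
  let S := fderiv ℝ (leafCoord ι a₀.proj s) p.1
  let Y : EL × F := dsection EL F a (fun y => s (ι y)) (dproj ι a (coordFrame a₀ p z))
  have hu : unlift a (coordFrame a₀ p z - Y : EL × F) = T (z.2 - S z.1) x := by
    have h1 : coordFrame a₀ p z - Y = (vlift EL F a (T (z.2 - S z.1) x) : EL × F) := by
      refine Eq.trans (congrArg (fun b : EL × F => coordFrame a₀ p z - b)
        ((congrArg (fun u : EL => (dsection EL F a (fun y => s (ι y)) u : EL × F)) hd).trans
          (hC.dsection_leafPoint hp s hs z.1))) ?_
      refine Eq.trans ?_ (hC.vlift_leafPoint hp _).symm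
      rw [hC.triv_frame hp]
      refine ((coordFrame a₀ p).map_sub _ _).symm.trans (congrArg (coordFrame a₀ p) ?_)
      ext <;> simp [S]
    exact (congrArg (Function.invFun (vlift EL F a)) h1).trans
      (Function.leftInverse_invFun (vlift_injective a) _)
  have hc : 𝒜.connector ι a (coordFrame a₀ p z) =
      𝒜.leviCivita (sectionThrough EM F x (T (𝒞.h p.1 z.1) x)) s x + T (z.2 - S z.1) x :=
    congrArg₂ (fun v w : A x => 𝒜.leviCivita (sectionThrough EM F x v) s x + w) hl hu
  refine (congrArg (fun v : A x => τ v) hc).trans ?_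
  rw [map_add, hC.triv_leviCivita hp, hC.triv_frame hp, sectionThrough_apply_self,
    hC.triv_frame hp, hs, hC.triv_frame hp, 𝒞.ρ_h _ hp]
  change _ + S z.1 + (z.2 - S z.1) = _
  abel

/-- The Sasaki metric in coordinates. -/
theorem sasaki_leafPoint (hC : IsLeafChart 𝒜 ι a₀.proj T 𝒞) (hp : p.1 ∈ 𝒞.U) (z w : EL × F) :
    𝒜.sasaki ι (leafPoint ι T a₀.proj p) (coordFrame a₀ p z) (coordFrame a₀ p w) =
      𝒞.sasakiForm p z w := by
  have h1 : ∀ z : EL × F, 𝒜.horLift ι (leafPoint ι T a₀.proj p).proj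
      (dproj ι (leafPoint ι T a₀.proj p) (coordFrame a₀ p z)) =
      T (𝒞.h p.1 z.1) (leafMap ι a₀.proj p.1) := fun z =>
    (congrArg (fun u : EL => 𝒜.horLift ι ((extChartAt 𝓘(ℝ, EL) a₀.proj).symm p.1) u)
      (hC.dproj_leafPoint hp z)).trans (hC.horLift_leafPoint hp z.1)
  unfold sasaki leafMetric
  rw [h1, h1]
  refine (congrArg₂ (fun a b : ℝ => a + b) (hC.inner_eq hp _ _) (hC.inner_eq hp _ _)).trans ?_
  rw [hC.triv_frame hp, hC.triv_frame hp, hC.triv_connector_leafPoint hp,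
    hC.triv_connector_leafPoint hp, AlgebroidChart.sasakiForm_apply]

end IsLeafChart

end LeafGeometry

end LieAlgebroid

/-! ### Divergence and unimodularity -/

namespace LieAlgebroid

section LeafDivergence

variable {EM F EL M L : Type*}
  [NormedAddCommGroup EM] [NormedSpace ℝ EM] [FiniteDimensional ℝ EM]
  [NormedAddCommGroup F] [NormedSpace ℝ F] [FiniteDimensional ℝ F]
  [NormedAddCommGroup EL] [NormedSpace ℝ EL] [FiniteDimensional ℝ EL]
  [TopologicalSpace M] [T2Space M] [ChartedSpace EM M] [IsManifold 𝓘(ℝ, EM) ∞ M]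
  {A : M → Type*} [TopologicalSpace (TotalSpace F A)]
  [∀ x, NormedAddCommGroup (A x)] [∀ x, InnerProductSpace ℝ (A x)]
  [∀ x, FiniteDimensional ℝ (A x)]
  [FiberBundle F A] [VectorBundle ℝ F A] [ContMDiffVectorBundle ∞ F A 𝓘(ℝ, EM)]
  [IsContMDiffRiemannianBundle 𝓘(ℝ, EM) ∞ F A]
  {𝒜 : LieAlgebroid EM F A}
  [TopologicalSpace L] [ChartedSpace EL L] [IsManifold 𝓘(ℝ, EL) ∞ L]
  {ι : C^∞⟮𝓘(ℝ, EL), L; 𝓘(ℝ, EM), M⟯}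
  {T : F →ₗ[ℝ] Cₛ^∞⟮𝓘(ℝ, EM); F, A⟯} {𝒞 : AlgebroidChart EL F}

local notation "𝓙L" => ModelWithCorners.prod 𝓘(ℝ, EL) 𝓘(ℝ, F)

variable {a₀ : TotalSpace F (ι *ᵖ A)}

theorem extChartAt_center (a₀ : TotalSpace F (ι *ᵖ A)) : extChartAt 𝓙L a₀ a₀ =
    (extChartAt 𝓘(ℝ, EL) a₀.proj a₀.proj, triv F A (ι a₀.proj) (ι a₀.proj) (fib a₀)) := by
  rw [extChartAt_totalSpace_apply, triv_apply (FiberBundle.mem_baseSet_trivializationAt' _)]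
  rfl

theorem IsLeafChart.center_mem (hC : IsLeafChart 𝒜 ι a₀.proj T 𝒞) :
    (extChartAt 𝓙L a₀ a₀).1 ∈ 𝒞.U := by
  rw [extChartAt_center]
  exact hC.mem

theorem IsLeafChart.eventually_mem (hC : IsLeafChart 𝒜 ι a₀.proj T 𝒞) :
    ∀ᶠ p in 𝓝 (extChartAt 𝓙L a₀ a₀), p.1 ∈ 𝒞.U :=
  continuous_fst.continuousAt (hC.isOpen.mem_nhds hC.center_mem)

theorem IsLeafChart.isMetricInChart (hC : IsLeafChart 𝒜 ι a₀.proj T 𝒞) :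
    IsMetricInChart 𝓙L (𝒜.sasaki ι) a₀ 𝒞.sasakiForm where
  eq := by
    filter_upwards [hC.eventually_mem] with p hp z w
    have key : ∀ a : TotalSpace F (ι *ᵖ A), leafPoint ι T a₀.proj p = a →
        𝒜.sasaki ι a (coordFrame a₀ p z) (coordFrame a₀ p w) = 𝒞.sasakiForm p z w := by
      rintro _ rfl
      exact hC.sasaki_leafPoint hp z w
    exact key _ (hC.extChartAt_symm hp).symm
  differentiableAt := AlgebroidChart.differentiableAt_sasakiForm hC.center_mem _
  symm := AlgebroidChart.sasakiForm_symm hC.center_mem _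
  pos := AlgebroidChart.sasakiForm_pos hC.center_mem _

/-- The chart expression of the geodesic field of `A_L` is the coordinate geodesic field of `𝒞`. -/
theorem IsLeafChart.chartField_eventuallyEq (hC : IsLeafChart 𝒜 ι a₀.proj T 𝒞) :
    chartField 𝓙L (𝒜.leafGeodesicField ι) a₀ =ᶠ[𝓝 (extChartAt 𝓙L a₀ a₀)] 𝒞.geodesicField := by
  have : IsManifold 𝓙L 1 (TotalSpace F (ι *ᵖ A)) := by
    have : IsManifold 𝓙L ∞ (TotalSpace F (ι *ᵖ A)) := inferInstance
    exact IsManifold.of_le (n := ∞) (by simp)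
  filter_upwards [hC.eventually_mem] with p hp
  refine hC.coordFrame_injective hp ?_
  have h1 : (coordFrame a₀ p (chartField 𝓙L (𝒜.leafGeodesicField ι) a₀ p) : EL × F) =
      𝒜.leafGeodesicField ι ((extChartAt 𝓙L a₀).symm p) :=
    mfderiv_symm_chartField 𝓙L (𝒜.leafGeodesicField ι) a₀ (by
      rw [extChartAt_totalSpace_target]; exact ⟨hC.mem_trivDomain hp, mem_univ _⟩)
  have key : ∀ a : TotalSpace F (ι *ᵖ A), leafPoint ι T a₀.proj p = a →
      (𝒜.leafGeodesicField ι a : EL × F) = coordFrame a₀ p (𝒞.geodesicField p) := by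
    rintro _ rfl
    exact hC.leafGeodesicField_leafPoint hp
  exact h1.trans (key _ (hC.extChartAt_symm hp).symm)

/-- The divergence of the geodesic field is `Tr ad_{a^v} + ⟨a^h, N⟩`. -/
theorem divergence_leafGeodesicField (hL : 𝒜.IsLeaf ι) (a : TotalSpace F (ι *ᵖ A)) {k : ℕ}
    (b : OrthonormalBasis (Fin k) ℝ (𝒜.isotropy (ι a.proj))) :
    divergence 𝓙L (𝒜.sasaki ι) (𝒜.leafGeodesicField ι) a =
      LinearMap.trace ℝ (𝒜.isotropy (ι a.proj))
        (𝒜.isotropyBracket (ι a.proj) (𝒜.vert (fib a))) +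
      inner ℝ (𝒜.hor (fib a)) (𝒜.oneillN (ι a.proj) b) := by
  have : IsManifold 𝓙L 1 (TotalSpace F (ι *ᵖ A)) := by
    have : IsManifold 𝓙L ∞ (TotalSpace F (ι *ᵖ A)) := inferInstance
    exact IsManifold.of_le (n := ∞) (by simp)
  obtain ⟨T, 𝒞, hC⟩ := exists_isLeafChart hL a.proj
  obtain ⟨X', D, hX, hD, hdiv⟩ := AlgebroidChart.trace_geodesicField_add hC.center_mem
    (extChartAt 𝓙L a a).2
  rw [divergence_eq hC.isMetricInChart (hX.congr_of_eventuallyEq hC.chartField_eventuallyEq) hD,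
    hC.chartField_eventuallyEq.self_of_nhds]
  refine hdiv.trans ?_
  have hq := hC.center_mem
  set q := (extChartAt 𝓙L a a).1 with hq'
  set ξ := (extChartAt 𝓙L a a).2 with hξ
  have key : ∀ (x : M) (_ : leafMap ι a.proj q = x) (v : A x)
      (b : OrthonormalBasis (Fin k) ℝ (𝒜.isotropy x)),
      triv F A (ι a.proj) x v = ξ →
      - LinearMap.trace ℝ F (((𝒞.Γ q).flip ξ).toLinearMap ∘ₗ
          (LinearMap.id - (𝒞.h q).toLinearMap ∘ₗ (𝒞.ρ q).toLinearMap)) =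
        LinearMap.trace ℝ (𝒜.isotropy x) (𝒜.isotropyBracket x (𝒜.vert v)) +
          inner ℝ (𝒜.hor v) (𝒜.oneillN x b) := by
    rintro _ rfl v b hv
    rw [← hv]
    exact hC.neg_trace_eq hq v b
  refine key _ ?_ (fib a) b ?_
  · rw [hq', extChartAt_center]
    exact leafMap_extChartAt ι (mem_extChartAt_source _)
  · rw [hξ, extChartAt_center]

/-- Unimodularity of the isotropy algebras propagates along the leaf. -/
theorem isUnimodularAt_of_isLeaf (hL : 𝒜.IsLeaf ι) {y₁ : L} (h : 𝒜.IsUnimodularAt (ι y₁)) (y : L) :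
    𝒜.IsUnimodularAt (ι y) := by
  have := hL.connected
  have hloc : ∀ y₀ : L, ∃ W ∈ 𝓝 y₀, ∀ y₁ ∈ W, ∀ y₂ ∈ W,
      𝒜.IsUnimodularAt (ι y₁) → 𝒜.IsUnimodularAt (ι y₂) := by
    intro y₀
    obtain ⟨T, 𝒞, hC⟩ := exists_isLeafChart hL y₀
    obtain ⟨V, hV, hVq⟩ := AlgebroidChart.eventually_isotropyModularForm hC.mem
    refine ⟨(extChartAt 𝓘(ℝ, EL) y₀).source ∩ extChartAt 𝓘(ℝ, EL) y₀ ⁻¹' (V ∩ 𝒞.U),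
      Filter.inter_mem (extChartAt_source_mem_nhds y₀)
        ((continuousAt_extChartAt y₀) (Filter.inter_mem hV (hC.isOpen.mem_nhds hC.mem))), ?_⟩
    rintro y₁ ⟨h₁, hV₁, hU₁⟩ y₂ ⟨h₂, hV₂, hU₂⟩ h
    rw [← leafMap_extChartAt ι h₁, hC.isUnimodularAt_iff hU₁] at h
    rw [← leafMap_extChartAt ι h₂, hC.isUnimodularAt_iff hU₂]
    exact hVq _ hV₁ _ hV₂ h
  have hclopen : IsClopen {y : L | 𝒜.IsUnimodularAt (ι y)} := by
    constructor
    · rw [← isOpen_compl_iff, isOpen_iff_mem_nhds]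
      intro y₀ h₀
      obtain ⟨W, hW, hWy⟩ := hloc y₀
      filter_upwards [hW] with y hy h
      exact h₀ (hWy y hy y₀ (mem_of_mem_nhds hW) h)
    · rw [isOpen_iff_mem_nhds]
      intro y₀ h₀
      obtain ⟨W, hW, hWy⟩ := hloc y₀
      filter_upwards [hW] with y hy
      exact hWy y₀ (mem_of_mem_nhds hW) y hy h₀
  exact (hclopen.eq_univ ⟨y₁, h⟩).ge (mem_univ y)

theorem oneillN_mem_isotropy_orthogonal (hL : 𝒜.IsLeaf ι) (y : L) {k : ℕ}
    (b : OrthonormalBasis (Fin k) ℝ (𝒜.isotropy (ι y))) :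
    𝒜.oneillN (ι y) b ∈ (𝒜.isotropy (ι y))ᗮ := by
  obtain ⟨T, 𝒞, hC⟩ := exists_isLeafChart hL y
  have key : ∀ x, leafMap ι y (extChartAt 𝓘(ℝ, EL) y y) = x →
      ∀ b : OrthonormalBasis (Fin k) ℝ (𝒜.isotropy x), 𝒜.oneillN x b ∈ (𝒜.isotropy x)ᗮ := by
    rintro _ rfl b
    exact hC.oneillN_mem_orthogonal hC.mem b
  exact key _ (leafMap_extChartAt ι (mem_extChartAt_source y)) b

theorem divergence_eq_zero_iff (hL : 𝒜.IsLeaf ι) :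
    (∀ a, divergence 𝓙L (𝒜.sasaki ι) (𝒜.leafGeodesicField ι) a = 0) ↔
      (∀ (y : L) (k : ℕ) (b : OrthonormalBasis (Fin k) ℝ (𝒜.isotropy (ι y))),
        𝒜.oneillN (ι y) b = 0) ∧ ∃ y : L, 𝒜.IsUnimodularAt (ι y) := by
  constructor
  · intro h
    have hN : ∀ (y : L) (k : ℕ) (b : OrthonormalBasis (Fin k) ℝ (𝒜.isotropy (ι y))),
        𝒜.oneillN (ι y) b = 0 := by
      intro y k b
      -- the divergence at the horizontal vector `N` is `‖N‖²`
      have h1 := h ⟨y, 𝒜.oneillN (ι y) b⟩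
      rw [divergence_leafGeodesicField hL _ b] at h1
      have h2 : 𝒜.vert (𝒜.oneillN (ι y) b) = 0 :=
        Submodule.orthogonalProjectionOnto_eq_zero_iff.2 (oneillN_mem_isotropy_orthogonal hL y b)
      change LinearMap.trace ℝ (𝒜.isotropy (ι y)) (𝒜.isotropyBracket (ι y)
        (𝒜.vert (𝒜.oneillN (ι y) b))) +
        inner ℝ (𝒜.oneillN (ι y) b - 𝒜.vert (𝒜.oneillN (ι y) b) : A (ι y))
          (𝒜.oneillN (ι y) b) = 0 at h1
      rw [h2, map_zero, map_zero, zero_add, ZeroMemClass.coe_zero, sub_zero] at h1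
      exact inner_self_eq_zero.1 h1
    obtain ⟨y⟩ := hL.connected.toNonempty
    refine ⟨hN, y, fun u => ?_⟩
    have h1 := h ⟨y, (u : A (ι y))⟩
    rw [divergence_leafGeodesicField hL _ (stdOrthonormalBasis ℝ (𝒜.isotropy (ι y))), hN,
      inner_zero_right, add_zero] at h1
    have h2 : 𝒜.vert (u : A (ι y)) = u :=
      Submodule.orthogonalProjectionOnto_mem_subspace_eq_self u
    change LinearMap.trace ℝ (𝒜.isotropy (ι y)) (𝒜.isotropyBracket (ι y)
      (𝒜.vert (u : A (ι y)))) = 0 at h1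
    rwa [h2] at h1
  · rintro ⟨hN, y, hy⟩ a
    rw [divergence_leafGeodesicField hL a (stdOrthonormalBasis ℝ (𝒜.isotropy (ι a.proj))), hN,
      inner_zero_right, add_zero]
    exact isUnimodularAt_of_isLeaf hL hy a.proj _

/-- Liouville's theorem applies to the geodesic field, which is smooth in the charts of `A_L`. -/
theorem flowPreservesVolume_leafGeodesicField_iff (hL : 𝒜.IsLeaf ι) :
    FlowPreservesVolume 𝓙L (𝒜.sasaki ι) (𝒜.leafGeodesicField ι) ↔
      ∀ a, divergence 𝓙L (𝒜.sasaki ι) (𝒜.leafGeodesicField ι) a = 0 := by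
  have : IsManifold 𝓙L ∞ (TotalSpace F (ι *ᵖ A)) := inferInstance
  have : IsManifold 𝓙L 1 (TotalSpace F (ι *ᵖ A)) := IsManifold.of_le (n := ∞) (by simp)
  refine flowPreservesVolume_iff (fun a => ?_) fun a => ?_
  · obtain ⟨T, 𝒞, hC⟩ := exists_isLeafChart hL a.proj
    exact ⟨_, hC.isMetricInChart⟩
  · obtain ⟨T, 𝒞, hC⟩ := exists_isLeafChart hL a.proj
    refine ContDiffAt.congr_of_eventuallyEq ?_ hC.chartField_eventuallyEq
    exact (AlgebroidChart.contDiffAt_geodesicField hC.center_mem _).of_le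
      (WithTop.coe_le_coe.2 (le_top (a := (2 : ℕ∞))))

end LeafDivergence

end LieAlgebroid

end

theorem theorem3p2
    {EM F EL M L : Type*}
    [NormedAddCommGroup EM] [NormedSpace ℝ EM] [FiniteDimensional ℝ EM]
    [NormedAddCommGroup F] [NormedSpace ℝ F] [FiniteDimensional ℝ F]
    [NormedAddCommGroup EL] [NormedSpace ℝ EL] [FiniteDimensional ℝ EL]
    [TopologicalSpace M] [T2Space M] [ChartedSpace EM M] [IsManifold 𝓘(ℝ, EM) ∞ M]
    {A : M → Type*} [TopologicalSpace (TotalSpace F A)]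
    [∀ x, NormedAddCommGroup (A x)] [∀ x, InnerProductSpace ℝ (A x)]
    [∀ x, FiniteDimensional ℝ (A x)]
    [FiberBundle F A] [VectorBundle ℝ F A] [ContMDiffVectorBundle ∞ F A 𝓘(ℝ, EM)]
    [IsContMDiffRiemannianBundle 𝓘(ℝ, EM) ∞ F A]
    (𝒜 : LieAlgebroid EM F A)
    [TopologicalSpace L] [ChartedSpace EL L] [IsManifold 𝓘(ℝ, EL) ∞ L]
    (ι : C^∞⟮𝓘(ℝ, EL), L; 𝓘(ℝ, EM), M⟯) (hL : 𝒜.IsLeaf ι) :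
    (∀ (a : TotalSpace F (ι *ᵖ A)) (k : ℕ)
        (b : OrthonormalBasis (Fin k) ℝ (𝒜.isotropy (ι a.proj))),
      divergence (𝓘(ℝ, EL).prod 𝓘(ℝ, F)) (𝒜.sasaki ι) (𝒜.leafGeodesicField ι) a =
        LinearMap.trace ℝ (𝒜.isotropy (ι a.proj))
            (𝒜.isotropyBracket (ι a.proj) (𝒜.vert (LieAlgebroid.fib a)))
          + inner ℝ (𝒜.hor (LieAlgebroid.fib a)) (𝒜.oneillN (ι a.proj) b)) ∧
    (FlowPreservesVolume (𝓘(ℝ, EL).prod 𝓘(ℝ, F)) (𝒜.sasaki ι) (𝒜.leafGeodesicField ι) ↔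
      (∀ (y : L) (k : ℕ) (b : OrthonormalBasis (Fin k) ℝ (𝒜.isotropy (ι y))),
        𝒜.oneillN (ι y) b = 0) ∧
      ∃ y : L, 𝒜.IsUnimodularAt (ι y)) := by
  exact ⟨fun a _ b => LieAlgebroid.divergence_leafGeodesicField hL a b,
    (LieAlgebroid.flowPreservesVolume_leafGeodesicField_iff hL).trans
      (LieAlgebroid.divergence_eq_zero_iff hL)⟩
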